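/- Let $S=\{-1,1\}$ and $V=\mathbb Z\times S$, and let $\kappa\ge 0$, $\lambda\ge 0$, $\gamma>0$, $\rho\ge 0$. For each integer $N\ge 1$ let $\eta^N_t(x,\sigma)$, $(x,\sigma)\in V$, $t\ge 0$, be the numbers of particles in a system of independent run-and-tumble particles on $V$: every particle performs, independently of the others, the Markov chain on $V$ which jumps $(x,\sigma)\to(x+1,\sigma)$ and $(x,\sigma)\to(x-1,\sigma)$ at rate $\kappa N^2$ each, $(x,\sigma)\to(x+\sigma,\sigma)$ at rate $\lambda N$, and $(x,\sigma)\to(x,-\sigma)$ at rate $\gamma$; the initial numbers $\eta^N_0(x,\sigma)$ are independent $\mathrm{Pois}(\rho)$ variables, independent of the motions. Let $$\langle\varphi,Z^N_t\rangle=\frac1{\sqrt N}\sum_{(x,\sigma)\in V}\big(\eta^N_t(x,\sigma)-\rho\big)\,\varphi\big(\tfrac xN\big),\qquad \varphi\in C_c^\infty(\mathbb R),$$ be the fluctuation field of the total density, summed over internal states. For $\varphi:\mathbb R\times S\to\mathbb R$ with $\varphi(\cdot,\sigma)\in C_c^\infty(\mathbb R)$ for both $\sigma$ put $$A\varphi(x,\sigma)=\kappa\,\partial_{xx}\varphi(x,\sigma)+\sigma\lambda\,\partial_x\varphi(x,\sigma)+\gamma\big(\varphi(x,-\sigma)-\varphi(x,\sigma)\big),\qquad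 \langle\langle\varphi,\psi\rangle\rangle=\sum_{\sigma\in S}\int_{\mathbb R}\varphi(x,\sigma)\psi(x,\sigma)\,dx .$$ For $\varphi\in C_c^\infty(\mathbb R)$ let $\bar\varphi(x,\sigma)=\varphi(x)$ be the layer-constant extension. Then the following hold. (i) There is exactly one strongly continuous semigroup $(e^{tA})_{t\ge0}$ on $L^2(\mathbb R\times S)$, with $\mathbb R\times S$ carrying Lebesgue times counting measure, whose generator agrees with $A$ on these test functions. (ii) For all $t_1,\dots,t_n\ge 0$ and $\varphi_1,\dots,\varphi_n\in C_c^\infty(\mathbb R)$ the random vectors $(\langle\varphi_i,Z^N_{t_i}\rangle)_{i\le n}$ converge in law as $N\to\infty$ to a centred Gaussian vector $(G_1,\dots,G_n)$ with $\mathbb E[G_iG_j]=\rho\,\langle\langle e^{(t_i-t_j)A}\bar\varphi_i,\bar\varphi_j\rangle\rangle$ whenever $t_j\le t_i$. (iii) Let $(Z_t)_{t\ge0}$ be the limiting fluctuation field of the total density, that is, any process with values in the distributions on $\mathbb R$ which is the limit of $Z^N$ in the sense that all vectors $(\langle\varphi_i,Z^N_{t_i}\rangle)_{i\le n}$ converge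 in law to $(\langle\varphi_i,Z_{t_i}\rangle)_{i\le n}$. Then $Z$ is a centred stationary Gaussian process; if $\lambda>0$ and $\rho>0$, it is not a Markov process with respect to its natural filtration; and for all $t\ge 0$ and $\varphi,\psi\in C_c^\infty(\mathbb R)$ $$\mathbb E\big[\langle\varphi,Z_t\rangle\langle\psi,Z_0\rangle\big]=\rho\,\big\langle\big\langle e^{tA}\bar\varphi,\bar\psi\big\rangle\big\rangle .$$ -/

import Mathlib

open MeasureTheory ProbabilityTheory Filter Topology TopologicalSpace
open scoped NNReal ENNReal Distributions LineDeriv RealInnerProductSpace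

universe u v

noncomputable section

namespace RunTumble

/-! ### Layers, test functions, the space `L²(dx × counting)` -/

/-- The set of internal states `S = {-1, 1}`, realized as the units of `ℤ`. -/
abbrev Layer : Type := ℤˣ

/-- The state space `V = ℤ × S` of one particle. -/
abbrev Site : Type := ℤ × Layer

/-- `C_c^∞(ℝ)`, with its usual (LF) topology. -/
abbrev TestFn : Type := 𝓓((⊤ : Opens ℝ), ℝ)

/-- The distributions on `ℝ`. -/
abbrev Distr : Type := 𝓓'((⊤ : Opens ℝ), ℝ)

/-- `C_{c,S}^∞`: the functions `φ` on `ℝ × S` with `φ(·, σ) ∈ C_c^∞(ℝ)` for every `σ`. -/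
abbrev LayerTestFn : Type := Layer → TestFn

/-- The Hilbert space `L²(ℝ × S, dx × counting)`, as the Hilbert sum over `σ ∈ S` of `L²(ℝ)`.
Its inner product is `⟪⟪φ, ψ⟫⟫ = ∑ σ, ∫ φ(x, σ) ψ(x, σ) dx`. -/
abbrev LayerL2 : Type := PiLp 2 (fun _ : Layer => Lp ℝ 2 (volume : Measure ℝ))

/-- The class in `L²(ℝ × S)` of a test function. -/
def toL2 (φ : LayerTestFn) : LayerL2 :=
  WithLp.toLp 2 fun σ =>
    ((φ σ).continuous.memLp_of_hasCompactSupport (μ := volume) (φ σ).hasCompactSupport).toLp (φ σ)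

/-- The layer-constant extension `φ̄(x, σ) = φ(x)`. -/
def layerConst (φ : TestFn) : LayerTestFn := fun _ => φ

/-- `⟪⟪φ, ψ⟫⟫ = ∑ σ, ∫ φ(x, σ) ψ(x, σ) dx` on test functions. -/
theorem inner_toL2 (φ ψ : LayerTestFn) :
    ⟪toL2 φ, toL2 ψ⟫ = ∑ σ : Layer, ∫ x : ℝ, φ σ x * ψ σ x := by
  rw [PiLp.inner_apply]
  refine Finset.sum_congr rfl fun σ _ => ?_
  rw [L2.inner_def]
  refine integral_congr_ae ?_
  filter_upwards [((φ σ).continuous.memLp_of_hasCompactSupport (μ := volume) (p := 2)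
      (φ σ).hasCompactSupport).coeFn_toLp,
    ((ψ σ).continuous.memLp_of_hasCompactSupport (μ := volume) (p := 2)
      (ψ σ).hasCompactSupport).coeFn_toLp] with x h1 h2
  simp only [toL2, h1, h2]
  simp [mul_comm]

/-! ### The limiting one-particle generator and its semigroup -/

/-- `Aφ(x, σ) = (κ ∂ₓₓ + σ lam ∂ₓ) φ(x, σ) + γ (φ(x, -σ) - φ(x, σ))`. -/
def limitGen (κ lam γ : ℝ) (φ : LayerTestFn) : LayerTestFn := fun σ =>
  κ • ∂_{(1 : ℝ)} (∂_{(1 : ℝ)} (φ σ)) + (((σ : ℤ) : ℝ) * lam) • ∂_{(1 : ℝ)} (φ σ)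
    + γ • (φ (-σ) - φ σ)

theorem limitGen_apply (κ lam γ : ℝ) (φ : LayerTestFn) (σ : Layer) (x : ℝ) :
    limitGen κ lam γ φ σ x =
      κ * deriv (deriv (φ σ)) x + ((σ : ℤ) : ℝ) * lam * deriv (φ σ) x
        + γ * (φ (-σ) x - φ σ x) := by
  have h : ∀ f : TestFn, ((∂_{(1 : ℝ)} f : TestFn) : ℝ → ℝ) = deriv f := by
    intro f
    ext y
    rw [TestFunction.lineDerivOp_eq_lineDerivCLM ℝ, TestFunction.lineDerivCLM_apply_of_le (by simp)]
    simp [lineDeriv, deriv_comp_const_add]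
  simp [limitGen, h]

/-- `T` is the strongly continuous semigroup `(e^{tA})_{t ≥ 0}` on `L²(ℝ × S)` whose generator is
`A` on the test functions. -/
structure IsSemigroupGeneratedBy (κ lam γ : ℝ) (T : ℝ≥0 → LayerL2 →L[ℝ] LayerL2) : Prop where
  zero : T 0 = ContinuousLinearMap.id ℝ LayerL2
  add : ∀ s t, T (s + t) = (T s).comp (T t)
  continuous : ∀ f, Continuous fun t => T t f
  generator : ∀ φ : LayerTestFn,
    Tendsto (fun h : ℝ≥0 => (h : ℝ)⁻¹ • (T h (toL2 φ) - toL2 φ)) (𝓝[>] 0)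
      (𝓝 (toL2 (limitGen κ lam γ φ)))

/-! ### The system of independent run-and-tumble particles -/

/-- The generator of one particle on `V = ℤ × S`: jumps `x → x ± 1` at rate `κ N²` each, an active
jump `x → x + σ` at rate `lam N`, and a flip `σ → -σ` at rate `γ`. -/
def walkGen (κ lam γ : ℝ) (N : ℕ+) (f : Site → ℝ) (v : Site) : ℝ :=
  κ * (N : ℝ) ^ 2 * (f (v.1 + 1, v.2) + f (v.1 - 1, v.2) - 2 * f v)
    + lam * (N : ℝ) * (f (v.1 + (v.2 : ℤ), v.2) - f v)
    + γ * (f (v.1, -v.2) - f v)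

/-- `p t u v` are the transition probabilities of the Markov chain on `V` with generator `L`: they
solve the backward Kolmogorov equation `(d/dt) p t u v = (L (p t · v)) u`. -/
structure IsTransitionFunction (L : (Site → ℝ) → Site → ℝ) (p : ℝ≥0 → Site → Site → ℝ) :
    Prop where
  nonneg : ∀ t u v, 0 ≤ p t u v
  hasSum_one : ∀ t u, HasSum (p t u) 1
  zero : ∀ u v, p 0 u v = if u = v then 1 else 0
  backward : ∀ (t : ℝ≥0) (u v : Site),
    HasDerivWithinAt (fun s : ℝ => p s.toNNReal u v) (L (fun w => p t w v) u) (Set.Ici 0) (t : ℝ)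

/-- `X` is a Markov chain with transition probabilities `p`, started at `u`. -/
structure IsMarkovChain {Ω : Type*} [MeasurableSpace Ω] (p : ℝ≥0 → Site → Site → ℝ) (u : Site)
    (P : Measure Ω) (X : ℝ≥0 → Ω → Site) : Prop where
  measurable : ∀ t, Measurable (X t)
  fdd : ∀ (n : ℕ) (t : Fin (n + 1) → ℝ≥0), Monotone t → ∀ v : Fin (n + 1) → Site,
    P {ω | ∀ i, X (t i) ω = v i} = ENNReal.ofReal
      (p (t 0) u (v 0) *
        ∏ i : Fin n, p (t i.succ - t i.castSucc) (v i.castSucc) (v i.succ))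

/-- `η` is the run-and-tumble particle process with scaling parameter `N`, started from the
product Poisson measure of density `ρ`: at time `0` there are independent `Poisson(ρ)` numbers
`η 0 ω u` of particles at the sites `u`, the `k`-th particle (`k < η 0 ω u`) started at `u` follows
the path `X u k`, all these paths are independent Markov chains, also independent of `η 0`, and
`η t ω v` is the number of particles at `v` at time `t`. -/
def IsRunAndTumble {Ω : Type*} [MeasurableSpace Ω] (κ lam γ : ℝ) (ρ : ℝ≥0) (N : ℕ+)
    (P : Measure Ω) (η : ℝ≥0 → Ω → Site → ℕ) : Prop :=
  (∀ t v, Measurable fun ω => η t ω v) ∧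
  ∃ (p : ℝ≥0 → Site → Site → ℝ) (X : Site → ℕ → ℝ≥0 → Ω → Site),
    IsTransitionFunction (walkGen κ lam γ N) p ∧
    (∀ u k, IsMarkovChain p u P (X u k)) ∧
    (∀ u, HasLaw (fun ω => η 0 ω u) (poissonMeasure ρ) P) ∧
    iIndep (Sum.elim
      (fun u : Site => MeasurableSpace.comap (fun ω => η 0 ω u) inferInstance)
      (fun q : Site × ℕ => ⨆ t : ℝ≥0, MeasurableSpace.comap (X q.1 q.2 t) inferInstance)) P ∧
    ∀ t, ∀ᵐ ω ∂P, ∀ v,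
      (η t ω v : ℕ∞) = {q : Site × ℕ | q.2 < η 0 ω q.1 ∧ X q.1 q.2 t ω = v}.encard

/-- The fluctuation field of the total density, paired with a test function:
`⟨φ, Z^N_t⟩ = N^{-1/2} ∑_{(x, σ) ∈ V} (η_t(x, σ) - ρ) φ(x / N)` (a finite sum). -/
def totalField {Ω : Type*} (ρ : ℝ≥0) (N : ℕ+) (η : ℝ≥0 → Ω → Site → ℕ)
    (t : ℝ≥0) (φ : TestFn) (ω : Ω) : ℝ :=
  (√(N : ℝ))⁻¹ * ∑' v : Site, ((η t ω v : ℝ) - ρ) * φ ((v.1 : ℝ) / (N : ℝ))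

/-! ### Distribution-valued processes -/

section RandomFields

variable {Ω : Type*} [MeasurableSpace Ω]

/-- The `σ`-algebra generated by `Z_t`, i.e. by all `⟨φ, Z_t⟩`. -/
abbrev sigmaAt (Z : ℝ≥0 → Ω → Distr) (t : ℝ≥0) : MeasurableSpace Ω :=
  ⨆ φ : TestFn, MeasurableSpace.comap (fun ω => Z t ω φ) inferInstance

/-- The natural filtration `σ(Z_r : r ≤ s)`. -/
abbrev sigmaUpTo (Z : ℝ≥0 → Ω → Distr) (s : ℝ≥0) : MeasurableSpace Ω :=
  ⨆ (r : ℝ≥0) (_ : r ≤ s), sigmaAt Z r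

/-- The Markov property with respect to the natural filtration: for `s ≤ t`, the conditional law of
`Z_t` given `(Z_r)_{r ≤ s}` is its conditional law given `Z_s`. -/
def IsMarkovProcess (P : Measure Ω) (Z : ℝ≥0 → Ω → Distr) : Prop :=
  ∀ s t : ℝ≥0, s ≤ t → ∀ B : Set Ω, MeasurableSet[sigmaAt Z t] B →
    P⟦B | sigmaUpTo Z s⟧ =ᵐ[P] P⟦B | sigmaAt Z s⟧

/-- Stationarity: the finite-dimensional distributions are invariant under time shifts. -/
def IsStationaryProcess (P : Measure Ω) (Z : ℝ≥0 → Ω → Distr) : Prop :=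
  ∀ (n : ℕ) (t : Fin n → ℝ≥0) (φ : Fin n → TestFn) (h : ℝ≥0),
    IdentDistrib (fun ω i => Z (t i + h) ω (φ i)) (fun ω i => Z (t i) ω (φ i)) P P

/-- The distribution-valued process `Z` is a limit of the fields `ZN N` as `N → ∞`, in the sense of
convergence in law of all finite-dimensional distributions. -/
def IsFluctuationLimit {Ω' : ℕ+ → Type*} [∀ N, MeasurableSpace (Ω' N)]
    (PN : ∀ N, Measure (Ω' N)) [∀ N, IsProbabilityMeasure (PN N)]
    (ZN : ∀ N, ℝ≥0 → TestFn → Ω' N → ℝ)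
    (P : Measure Ω) [IsProbabilityMeasure P] (Z : ℝ≥0 → Ω → Distr) : Prop :=
  (∀ t φ, Measurable fun ω => Z t ω φ) ∧
  ∀ (n : ℕ) (t : Fin n → ℝ≥0) (φ : Fin n → TestFn),
    TendstoInDistribution (fun N ω i => ZN N (t i) (φ i) ω) atTop
      (fun ω i => Z (t i) ω (φ i)) PN P

end RandomFields

end RunTumble

end

/-! Everything is compared with the operators `discGen` on `LayerL2`, the generator with lattice
spacing `h`, built from translations and the layer flip. Such an operator is `K - c • 1` with `‖K‖ ≤
c`, so its exponentials are contractions, and it commutes with translations common to both layers.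
On a test function it differs from the limiting generator by at most `discErr`, which no contraction
commuting with these translations can increase (`discErr_map_le`). Duhamel's formula therefore makes
the exponentials Cauchy as `h → 0` without any regularity theory for the evolved function, and the
limit is the semigroup.

Uniqueness has to work from the generator on test functions alone. The Euler steps `1 + δ A_h` map
test functions to test functions, commute with derivatives and contract for small `δ`, so any
admissible semigroup can be telescoped against their powers with uniform error bounds
(`IsSemigroupGeneratedBy.norm_sub_euler_le`). Two admissible semigroups are both the limit of the
same scheme.

Pairing with indicators of cells of width `1 / N` turns `discGen κ lam γ (1 / N)` into the generator
of the particle. Bounded solutions of the backward equation are unique, so transition probabilities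
are matrix elements of the discrete exponential (`IsTransitionFunction.eq_inner`), and lattice
covariances converge to `⟪T t φ̄, ψ̄⟫`. The adjoint of the generator is its conjugate by the flip;
hence counting measure is invariant.

For independent Poisson numbers of independent particles the characteristic function is `exp (ρ ∑ u,
(g u - 1))`, with `g u` the characteristic function of the contribution of one particle started at
`u`. Taylor expansion at scale `N ^ (-1/2)` leaves the quadratic term: the linear one cancels the
centring, the cubic one is of order `N ^ (-1/2)`. Lévy's theorem gives the Gaussian limit; its
covariance depends only on time differences, whence stationarity.

The density alone is not Markovian because the drift couples it to the odd combination of the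
layers. If `Z` were Markov, the projection of `Z_{2h}(φ)` onto the closed span of `Z_h` would leave
a residual orthogonal to `Z_0(φ)`. To order `h ^ 2` that projection is `Z_h(φ + h κ φ'')`, and
`Z_0(φ) - Z_h(φ)` has norm `O(√h)`, so `markovDefect` would be `O(h ^ (5/2))`
(`IsGaussianField.exists_markovDefect_le`). Expanding the semigroup gives instead `h ^ 2 lam ^ 2
⟪φ'', φ⟫ + O(h ^ 3)` (`exists_markovDefect_expansion`), where `A ^ 2` has gone from constant to odd
and back. -/

set_option linter.unusedSectionVars false

noncomputable section

namespace RunTumble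

/-! ### Exponentials of bounded operators -/

section Exponential

variable {E : Type*} [NormedAddCommGroup E] [NormedSpace ℝ E] [CompleteSpace E]

/-- The exponential `e^{tA}` of a bounded operator. -/
def expOp (A : E →L[ℝ] E) (t : ℝ) : E →L[ℝ] E := NormedSpace.exp (t • A)

theorem expOp_zero (A : E →L[ℝ] E) : expOp A 0 = 1 := by
  simp [expOp, NormedSpace.exp_zero]

theorem commute_expOp {A B : E →L[ℝ] E} (h : Commute B A) (t : ℝ) : Commute B (expOp A t) := by
  let _ : NormedAlgebra ℚ (E →L[ℝ] E) := NormedAlgebra.restrictScalars ℚ ℝ _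
  exact (h.smul_right t).exp_right

theorem expOp_add (A : E →L[ℝ] E) (s t : ℝ) : expOp A (s + t) = expOp A s * expOp A t := by
  let _ : NormedAlgebra ℚ (E →L[ℝ] E) := NormedAlgebra.restrictScalars ℚ ℝ _
  rw [expOp, add_smul, NormedSpace.exp_add_of_commute]
  · rfl
  · exact ((Commute.refl A).smul_left s).smul_right t

theorem hasDerivAt_expOp (A : E →L[ℝ] E) (t : ℝ) :
    HasDerivAt (expOp A) (expOp A t * A) t := by
  let _ : NormedAlgebra ℚ (E →L[ℝ] E) := NormedAlgebra.restrictScalars ℚ ℝ _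
  exact hasDerivAt_exp_smul_const A t

theorem hasDerivAt_expOp' (A : E →L[ℝ] E) (t : ℝ) :
    HasDerivAt (expOp A) (A * expOp A t) t := by
  let _ : NormedAlgebra ℚ (E →L[ℝ] E) := NormedAlgebra.restrictScalars ℚ ℝ _
  exact hasDerivAt_exp_smul_const' A t

theorem hasDerivAt_expOp_apply (A : E →L[ℝ] E) (f : E) (t : ℝ) :
    HasDerivAt (fun s => expOp A s f) (expOp A t (A f)) t :=
  (hasDerivAt_expOp A t).clm_apply (hasDerivAt_const t f) |>.congr_deriv (by simp)

theorem norm_expOp_le (A : E →L[ℝ] E) {t : ℝ} (ht : 0 ≤ t) :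
    ‖expOp A t‖ ≤ Real.exp (t * ‖A‖) := by
  let _ : NormedAlgebra ℚ (E →L[ℝ] E) := NormedAlgebra.restrictScalars ℚ ℝ _
  have h1 : HasSum (fun n : ℕ => ((n.factorial : ℝ)⁻¹) • (t • A) ^ n) (expOp A t) :=
    NormedSpace.exp_series_hasSum_exp' (𝕂 := ℝ) (t • A)
  have h2 : HasSum (fun n : ℕ => ((n.factorial : ℝ)⁻¹) • (t * ‖A‖) ^ n)
      (Real.exp (t * ‖A‖)) := by
    rw [Real.exp_eq_exp_ℝ]
    exact NormedSpace.exp_series_hasSum_exp' (𝕂 := ℝ) (t * ‖A‖)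
  refine h1.norm_le_of_bounded h2 fun n => ?_
  rw [norm_smul, Real.norm_of_nonneg (by positivity), smul_eq_mul]
  gcongr
  -- The power `0` is separate: on a trivial space the identity has norm `0`, so only `‖1‖ ≤ 1` is
  -- available.
  rcases n with _ | n
  · simpa using! ContinuousLinearMap.norm_id_le (𝕜 := ℝ) (E := E)
  · refine (norm_pow_le' _ n.succ_pos).trans ?_
    rw [norm_smul, Real.norm_of_nonneg ht]

/-- The scalar part commutes with `K` and contributes the factor `e^{-tc}`, which beats `‖e^{tK}‖ ≤
e^{t‖K‖}`. This is the form of a jump generator with total rate `c`. -/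
theorem norm_expOp_sub_smul_one_le_one {K : E →L[ℝ] E} {c : ℝ} (hK : ‖K‖ ≤ c) {t : ℝ}
    (ht : 0 ≤ t) : ‖expOp (K - c • 1) t‖ ≤ 1 := by
  let _ : NormedAlgebra ℚ (E →L[ℝ] E) := NormedAlgebra.restrictScalars ℚ ℝ _
  have h1 : expOp (K - c • 1) t = Real.exp (-(t * c)) • expOp K t := by
    have h2 : t • (K - c • (1 : E →L[ℝ] E)) = algebraMap ℝ (E →L[ℝ] E) (-(t * c)) + t • K := by
      rw [Algebra.algebraMap_eq_smul_one, smul_sub, smul_smul, neg_smul]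
      abel
    rw [expOp, h2, NormedSpace.exp_add_of_commute (Algebra.commutes _ _),
      ← NormedSpace.algebraMap_exp_comm, ← Real.exp_eq_exp_ℝ, Algebra.algebraMap_eq_smul_one,
      smul_one_mul]
    rfl
  rw [h1, norm_smul, Real.norm_of_nonneg (Real.exp_pos _).le]
  calc Real.exp (-(t * c)) * ‖expOp K t‖ ≤ Real.exp (-(t * c)) * Real.exp (t * c) := by
        gcongr
        exact (norm_expOp_le K ht).trans (by gcongr)
    _ = 1 := by rw [← Real.exp_add]; simp

theorem norm_apply_le_of_norm_le_one {B : E →L[ℝ] E} (hB : ‖B‖ ≤ 1) (f : E) : ‖B f‖ ≤ ‖f‖ := by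
  simpa using B.le_of_opNorm_le hB f

/-- Duhamel's comparison of two semigroups. -/
theorem norm_expOp_sub_expOp_le {A B : E →L[ℝ] E} (hA : ∀ t, 0 ≤ t → ‖expOp A t‖ ≤ 1) {f : E}
    {C t : ℝ} (ht : 0 ≤ t) (hC : ∀ s, 0 ≤ s → ‖(B - A) (expOp B s f)‖ ≤ C) :
    ‖expOp B t f - expOp A t f‖ ≤ t * C := by
  -- The path `s ↦ e^{(t-s)A} e^{sB} f` joins the two vectors being compared. Its velocity is a
  -- contraction applied to `(B - A) e^{sB} f`.
  have hd : ∀ s, HasDerivAt (fun s => expOp A (t - s) (expOp B s f))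
      (expOp A (t - s) ((B - A) (expOp B s f))) s := by
    intro s
    have h1 : HasDerivAt (fun s => expOp A (t - s)) (-(expOp A (t - s) * A)) s := by
      simpa using! (hasDerivAt_expOp A (t - s)).scomp s ((hasDerivAt_id s).const_sub t)
    have h2 := (hasDerivAt_expOp' B s).clm_apply (hasDerivAt_const s f)
    refine (h1.clm_apply h2).congr_deriv ?_
    simp
    abel
  have := norm_image_sub_le_of_norm_deriv_le_segment' (f := fun s => expOp A (t - s) (expOp B s f))
    (a := 0) (b := t) (C := C) (fun s _ => (hd s).hasDerivWithinAt) (fun s hs =>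
      (norm_apply_le_of_norm_le_one (hA _ (by linarith [hs.2])) _).trans (hC s hs.1)) t ⟨ht, le_rfl⟩
  simpa [expOp_zero, mul_comm] using this

theorem norm_expOp_sub_self_le {A : E →L[ℝ] E} (hA : ∀ t, 0 ≤ t → ‖expOp A t‖ ≤ 1) (f : E)
    {t : ℝ} (ht : 0 ≤ t) : ‖expOp A t f - f‖ ≤ t * ‖A f‖ := by
  have := norm_image_sub_le_of_norm_deriv_le_segment' (f := fun s => expOp A s f)
    (a := 0) (b := t) (C := ‖A f‖) (fun s _ => (hasDerivAt_expOp_apply A f s).hasDerivWithinAt)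
    (fun s hs => norm_apply_le_of_norm_le_one (hA s hs.1) _) t ⟨ht, le_rfl⟩
  simpa [expOp_zero, mul_comm] using this

/-- The vector `g` stands for the value of the limiting generator at `f`. Keeping it separate from
`A f` gives a bound that survives `h → 0`, although the norms of the discrete generators need not
stay bounded. -/
theorem norm_expOp_sub_sub_le {A : E →L[ℝ] E} (hA : ∀ t, 0 ≤ t → ‖expOp A t‖ ≤ 1) (f g : E)
    {t : ℝ} (ht : 0 ≤ t) : ‖expOp A t f - f - t • g‖ ≤ t * (‖A f - g‖ + t * ‖A g‖) := by
  have hd : ∀ s, HasDerivAt (fun s => expOp A s f - s • g) (expOp A s (A f) - g) s := fun s =>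
    ((hasDerivAt_expOp_apply A f s).sub ((hasDerivAt_id s).smul_const g)).congr_deriv (by simp)
  have := norm_image_sub_le_of_norm_deriv_le_segment' (f := fun s => expOp A s f - s • g)
    (a := 0) (b := t) (C := ‖A f - g‖ + t * ‖A g‖) (fun s _ => (hd s).hasDerivWithinAt)
    (fun s hs => by
      have h1 : expOp A s (A f) - g = expOp A s (A f - g) + (expOp A s g - g) := by
        rw [map_sub]; abel
      rw [h1]
      refine (norm_add_le _ _).trans (add_le_add
        (norm_apply_le_of_norm_le_one (hA s hs.1) _) ?_)
      exact (norm_expOp_sub_self_le hA g hs.1).trans (by gcongr; exact hs.2.le)) t ⟨ht, le_rfl⟩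
  rw [mul_comm]
  simpa [expOp_zero, sub_right_comm] using this

end Exponential

/-! ### Layerwise translations on `L²(ℝ × S)` -/

section Translations

/-- Translation `f ↦ f (· + a)` on `L²(ℝ)`. -/
def transL2 (a : ℝ) : Lp ℝ 2 (volume : Measure ℝ) →ₗᵢ[ℝ] Lp ℝ 2 (volume : Measure ℝ) :=
  Lp.compMeasurePreservingₗᵢ ℝ (fun x => x + a) (measurePreserving_add_right volume a)

theorem transL2_toLp (a : ℝ) {f : ℝ → ℝ} (hf : MemLp f 2 volume) :
    transL2 a (hf.toLp f) =
      (hf.comp_measurePreserving (measurePreserving_add_right volume a)).toLp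
        (fun x => f (x + a)) :=
  rfl

theorem transL2_transL2 (a b : ℝ) (f : Lp ℝ 2 (volume : Measure ℝ)) :
    transL2 a (transL2 b f) = transL2 (a + b) f := by
  obtain ⟨g, hg, rfl⟩ : ∃ (g : ℝ → ℝ) (hg : MemLp g 2 volume), hg.toLp g = f :=
    ⟨f, Lp.memLp f, Lp.toLp_coeFn f _⟩
  rw [transL2_toLp, transL2_toLp, transL2_toLp]
  congr 1
  ext x
  simp [add_assoc]

theorem transL2_zero (f : Lp ℝ 2 (volume : Measure ℝ)) : transL2 0 f = f := by
  obtain ⟨g, hg, rfl⟩ : ∃ (g : ℝ → ℝ) (hg : MemLp g 2 volume), hg.toLp g = f :=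
    ⟨f, Lp.memLp f, Lp.toLp_coeFn f _⟩
  rw [transL2_toLp]
  congr 1
  ext x
  simp

/-- The isometry `(x, σ) ↦ (x + a σ, ε σ)` acting on functions. -/
def layerMove (a : Layer → ℝ) (ε : Layer) : LayerL2 →ₗᵢ[ℝ] LayerL2 where
  toFun f := WithLp.toLp 2 fun σ => transL2 (a σ) (f (ε * σ))
  map_add' f g := by ext1 σ; simp
  map_smul' c f := by ext1 σ; simp
  norm_map' f := by
    change ‖(WithLp.toLp 2 fun σ => transL2 (a σ) (f (ε * σ)) : LayerL2)‖ = ‖f‖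
    rw [PiLp.norm_eq_of_L2, PiLp.norm_eq_of_L2]
    congr 1
    simp only [LinearIsometry.norm_map]
    exact Equiv.sum_comp (Equiv.mulLeft ε) fun σ => ‖f σ‖ ^ 2

theorem layerMove_apply (a : Layer → ℝ) (ε : Layer) (f : LayerL2) (σ : Layer) :
    layerMove a ε f σ = transL2 (a σ) (f (ε * σ)) := rfl

theorem layerMove_layerMove (a b : Layer → ℝ) (ε δ : Layer) (f : LayerL2) :
    layerMove a ε (layerMove b δ f) = layerMove (fun σ => a σ + b (ε * σ)) (ε * δ) f := by
  ext1 σ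
  simp only [layerMove_apply, transL2_transL2, mul_comm δ, mul_right_comm ε σ δ]

theorem layerMove_zero_one (f : LayerL2) : layerMove 0 1 f = f := by
  ext1 σ
  simp [layerMove_apply, transL2_zero]

/-- The adjoint of an invertible isometry is its inverse. As `ε` is its own inverse, the inverse
move flips by `ε` again and undoes the shifts on the relabelled layers. -/
theorem inner_layerMove (a : Layer → ℝ) (ε : Layer) (f g : LayerL2) :
    ⟪layerMove a ε f, g⟫ = ⟪f, layerMove (fun σ => -a (ε * σ)) ε g⟫ := by
  rw [← (layerMove (fun σ => -a (ε * σ)) ε).inner_map_map, layerMove_layerMove]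
  congr 1
  rw [show ε * ε = 1 from Int.units_mul_self ε]
  convert layerMove_zero_one f using 3
  ext
  simp

instance : SMulCommClass ℝ (LayerL2 →L[ℝ] LayerL2) (LayerL2 →L[ℝ] LayerL2) :=
  ⟨fun c A B => by ext1 f; exact (map_smul A c (B f)).symm⟩

instance : IsScalarTower ℝ (LayerL2 →L[ℝ] LayerL2) (LayerL2 →L[ℝ] LayerL2) :=
  ⟨fun _ _ _ => rfl⟩

/-- `layerMove` as a bounded operator. -/
def moveOp (a : Layer → ℝ) (ε : Layer) : LayerL2 →L[ℝ] LayerL2 :=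
  (layerMove a ε).toContinuousLinearMap

theorem moveOp_apply (a : Layer → ℝ) (ε : Layer) (f : LayerL2) :
    moveOp a ε f = layerMove a ε f := rfl

theorem norm_moveOp_le (a : Layer → ℝ) (ε : Layer) : ‖moveOp a ε‖ ≤ 1 :=
  (layerMove a ε).norm_toContinuousLinearMap_le

theorem moveOp_mul (a b : Layer → ℝ) (ε δ : Layer) :
    moveOp a ε * moveOp b δ = moveOp (fun σ => a σ + b (ε * σ)) (ε * δ) := by
  ext1 f
  exact layerMove_layerMove a b ε δ f

/-- A shift common to both layers is not affected by relabelling them. Translation invariance of the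
dynamics enters the proof through this fact. -/
theorem commute_moveOp_const (c : ℝ) (b : Layer → ℝ) (δ : Layer) :
    Commute (moveOp (fun _ => c) 1) (moveOp b δ) := by
  rw [Commute, SemiconjBy, moveOp_mul, moveOp_mul]
  simp [add_comm]

theorem adjoint_moveOp (a : Layer → ℝ) (ε : Layer) :
    ContinuousLinearMap.adjoint (moveOp a ε) = moveOp (fun σ => -a (ε * σ)) ε := by
  symm
  rw [ContinuousLinearMap.eq_adjoint_iff]
  intro f g
  rw [moveOp_apply, moveOp_apply, real_inner_comm, ← inner_layerMove, real_inner_comm]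

/-! ### Difference operators and the discretized generator -/

/-- Difference quotient in the direction `a σ` on layer `σ`. -/
def diffQuot (a : Layer → ℝ) (h : ℝ) : LayerL2 →L[ℝ] LayerL2 :=
  h⁻¹ • (moveOp (fun σ => a σ * h) 1 - 1)

/-- Second order central difference quotient. -/
def secondDiff (h : ℝ) : LayerL2 →L[ℝ] LayerL2 :=
  (h ^ 2)⁻¹ • (moveOp (fun _ => h) 1 + moveOp (fun _ => -h) 1 - (2 : ℝ) • 1)

/-- The sign `σ`, as a function on the layers. -/
def layerSign (σ : Layer) : ℝ := ((σ : ℤ) : ℝ)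

/-- Multiplication by the sign `σ`. -/
def signOp : LayerL2 →ₗᵢ[ℝ] LayerL2 where
  toFun f := WithLp.toLp 2 fun σ => layerSign σ • f σ
  map_add' f g := by ext1 σ; simp
  map_smul' c f := by ext1 σ; simp [smul_comm c]
  norm_map' f := by
    change ‖(WithLp.toLp 2 fun σ => layerSign σ • f σ : LayerL2)‖ = ‖f‖
    rw [PiLp.norm_eq_of_L2, PiLp.norm_eq_of_L2]
    congr 1
    refine Finset.sum_congr rfl fun σ _ => ?_
    rcases Int.units_eq_one_or σ with rfl | rfl <;> simp [layerSign]

theorem signOp_apply (f : LayerL2) (σ : Layer) : signOp f σ = layerSign σ • f σ := rfl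

/-- The flip of the layers. -/
abbrev flipOp : LayerL2 →L[ℝ] LayerL2 := moveOp 0 (-1)

/-- The generator of one rescaled particle with lattice spacing `h`, acting on `L²(ℝ × S)`. -/
def discGen (κ lam γ h : ℝ) : LayerL2 →L[ℝ] LayerL2 :=
  κ • secondDiff h + lam • diffQuot layerSign h + γ • (flipOp - 1)

theorem flipOp_mul_flipOp : flipOp * flipOp = 1 := by
  rw [moveOp_mul]
  ext1 f
  simpa [moveOp_apply, -Pi.zero_apply] using! layerMove_zero_one f

/-- The adjoint of a translation is the opposite translation, so taking adjoints reverses the drift.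
Conjugation by the flip reverses it too, while the diffusive and flip parts are symmetric and
unchanged by either operation. -/
theorem adjoint_discGen (κ lam γ h : ℝ) :
    ContinuousLinearMap.adjoint (discGen κ lam γ h) = flipOp * discGen κ lam γ h * flipOp := by
  have h1 : ∀ a : Layer → ℝ, flipOp * moveOp a 1 * flipOp = moveOp (fun σ => a (-σ)) 1 := by
    intro a
    rw [moveOp_mul, moveOp_mul]
    simp
  have h2 : ContinuousLinearMap.adjoint (1 : LayerL2 →L[ℝ] LayerL2) = 1 :=
    star_one (LayerL2 →L[ℝ] LayerL2)
  have h4 : ∀ σ : Layer, layerSign (-σ) = -layerSign σ := fun σ => by simp [layerSign]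
  simp only [discGen, secondDiff, diffQuot, map_add, map_sub, LinearIsometryEquiv.map_smulₛₗ,
    adjoint_moveOp, h2, mul_add, add_mul, mul_sub, sub_mul, mul_smul_comm, smul_mul_assoc, h1,
    mul_one, flipOp_mul_flipOp, h4]
  simp only [add_comm, Pi.zero_def, neg_neg, one_mul, neg_mul, neg_zero, conj_trivial]
  rfl

/-- Jump form of the generator: moves weighted by their rates, minus the total rate. Nonnegative
rates then give contractivity. -/
theorem discGen_eq_sub_smul_one (κ lam γ h : ℝ) :
    discGen κ lam γ h = (κ / h ^ 2) • moveOp (fun _ => h) 1 + (κ / h ^ 2) • moveOp (fun _ => -h) 1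
      + (lam / h) • moveOp (fun σ => layerSign σ * h) 1 + γ • flipOp
      - (2 * (κ / h ^ 2) + lam / h + γ) • (1 : LayerL2 →L[ℝ] LayerL2) := by
  simp only [discGen, secondDiff, diffQuot, div_eq_mul_inv]
  module

theorem norm_moves_le {κ lam γ h : ℝ} (hκ : 0 ≤ κ) (hlam : 0 ≤ lam) (hγ : 0 ≤ γ) (hh : 0 < h) :
    ‖(κ / h ^ 2) • moveOp (fun _ => h) 1 + (κ / h ^ 2) • moveOp (fun _ => -h) 1
      + (lam / h) • moveOp (fun σ => layerSign σ * h) 1 + γ • flipOp‖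
      ≤ 2 * (κ / h ^ 2) + lam / h + γ := by
  have h1 : ∀ (c : ℝ) (a : Layer → ℝ) (ε : Layer), 0 ≤ c → ‖c • moveOp a ε‖ ≤ c := by
    intro c a ε hc
    rw [norm_smul, Real.norm_of_nonneg hc]
    exact mul_le_of_le_one_right hc (norm_moveOp_le a ε)
  rw [two_mul]
  refine norm_add_le_of_le (norm_add_le_of_le (norm_add_le_of_le ?_ ?_) ?_) ?_ <;>
    exact h1 _ _ _ (by positivity)

theorem norm_expOp_discGen_le_one {κ lam γ h : ℝ} (hκ : 0 ≤ κ) (hlam : 0 ≤ lam) (hγ : 0 ≤ γ)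
    (hh : 0 < h) {t : ℝ} (ht : 0 ≤ t) : ‖expOp (discGen κ lam γ h) t‖ ≤ 1 := by
  rw [discGen_eq_sub_smul_one]
  exact norm_expOp_sub_smul_one_le_one (norm_moves_le hκ hlam hγ hh) ht

/-- The Euler step `1 + δ A_h` is a contraction for small `δ`. -/
theorem norm_one_add_smul_discGen_le_one {κ lam γ h δ : ℝ} (hκ : 0 ≤ κ) (hlam : 0 ≤ lam)
    (hγ : 0 ≤ γ) (hh : 0 < h) (hδ : 0 ≤ δ) (hδ' : δ * (2 * (κ / h ^ 2) + lam / h + γ) ≤ 1) :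
    ‖1 + δ • discGen κ lam γ h‖ ≤ 1 := by
  set c := 2 * (κ / h ^ 2) + lam / h + γ with hc
  rw [discGen_eq_sub_smul_one, ← hc]
  set K := (κ / h ^ 2) • moveOp (fun _ => h) 1 + (κ / h ^ 2) • moveOp (fun _ => -h) 1
      + (lam / h) • moveOp (fun σ => layerSign σ * h) 1 + γ • flipOp with hK
  have h1 : 1 + δ • (K - c • 1) = (1 - δ * c) • (1 : LayerL2 →L[ℝ] LayerL2) + δ • K := by module
  have h2 : ‖K‖ ≤ c := norm_moves_le hκ hlam hγ hh
  rw [h1]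
  calc _ ≤ ‖(1 - δ * c) • (1 : LayerL2 →L[ℝ] LayerL2)‖ + ‖δ • K‖ := norm_add_le _ _
    _ ≤ (1 - δ * c) * 1 + δ * c := by
        rw [norm_smul, norm_smul, Real.norm_of_nonneg (by linarith), Real.norm_of_nonneg hδ]
        have h3 : ‖(1 : LayerL2 →L[ℝ] LayerL2)‖ ≤ 1 := ContinuousLinearMap.norm_id_le
        have h4 : 0 ≤ 1 - δ * c := by linarith
        gcongr
    _ = 1 := by ring

theorem commute_moveOp_discGen (c κ lam γ h : ℝ) :
    Commute (moveOp (fun _ => c) 1) (discGen κ lam γ h) := by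
  have h1 := fun b δ => commute_moveOp_const c b δ
  refine Commute.add_right (Commute.add_right ?_ ?_) ?_ <;> refine Commute.smul_right ?_ _
  · exact (((h1 _ _).add_right (h1 _ _)).sub_right ((Commute.one_right _).smul_right _)).smul_right _
  · exact ((h1 _ _).sub_right (Commute.one_right _)).smul_right _
  · exact (h1 _ _).sub_right (Commute.one_right _)

/-! ### Consistency of the discretization -/

/-- The operator `κ ∂² + σ lam ∂ + γ (flip - 1)` evaluated at `f` with derivatives `f₁`, `f₂`. -/
def genOf (κ lam γ : ℝ) (f f₁ f₂ : LayerL2) : LayerL2 :=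
  κ • f₂ + lam • signOp f₁ + γ • (flipOp f - f)

/-- The consistency error of `discGen`. -/
def discErr (κ lam h : ℝ) (f f₁ f₂ : LayerL2) : ℝ :=
  κ * ‖secondDiff h f - f₂‖ + lam * (‖diffQuot (fun _ => 1) h f - f₁‖ +
    ‖diffQuot (fun _ => -1) h f - (-f₁)‖)

/-- Needed because the direction of the active drift depends on the layer: on each layer its
difference quotient agrees with one that uses the same shift everywhere. The error can then be
written with globally translation-invariant operators only. -/
theorem norm_le_add_of_layers {f g k : LayerL2} (h1 : f 1 = g 1) (h2 : f (-1) = k (-1)) :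
    ‖f‖ ≤ ‖g‖ + ‖k‖ := by
  refine le_of_sq_le_sq ?_ (by positivity)
  have hs : ∀ F : Layer → ℝ, ∑ σ, F σ = F 1 + F (-1) := fun F => by
    rw [show (Finset.univ : Finset Layer) = {1, -1} from rfl]
    rw [Finset.sum_pair (by decide)]
  rw [PiLp.norm_sq_eq_of_L2, hs, h1, h2]
  have hg := PiLp.norm_sq_eq_of_L2 _ g
  have hk := PiLp.norm_sq_eq_of_L2 _ k
  rw [hs] at hg hk
  nlinarith [sq_nonneg ‖g (-1)‖, sq_nonneg ‖k 1‖, norm_nonneg g, norm_nonneg k]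

/-- The flip terms cancel exactly. The vectors `f₁`, `f₂` are arbitrary candidates for derivatives,
so nothing is assumed about `f`. -/
theorem norm_discGen_sub_genOf_le {κ lam : ℝ} (hκ : 0 ≤ κ) (hlam : 0 ≤ lam) (γ h : ℝ)
    (f f₁ f₂ : LayerL2) :
    ‖discGen κ lam γ h f - genOf κ lam γ f f₁ f₂‖ ≤ discErr κ lam h f f₁ f₂ := by
  have h1 : discGen κ lam γ h f - genOf κ lam γ f f₁ f₂ =
      κ • (secondDiff h f - f₂) + lam • (diffQuot layerSign h f - signOp f₁) := by
    simp only [discGen, genOf, add_apply, smul_apply,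
      sub_apply, one_apply_eq_self]
    module
  rw [h1, discErr]
  refine norm_add_le_of_le ?_ ?_
  · rw [norm_smul, Real.norm_of_nonneg hκ]
  · rw [norm_smul, Real.norm_of_nonneg hlam]
    gcongr
    refine norm_le_add_of_layers ?_ ?_ <;>
      simp [diffQuot, moveOp_apply, layerMove_apply, signOp_apply, layerSign]

/-- Since `B` commutes with common translations it passes through every difference quotient, and
being a contraction it can only shrink the norms. The triple of a function and its derivatives is
transported as a whole. -/
theorem discErr_map_le {κ lam : ℝ} (hκ : 0 ≤ κ) (hlam : 0 ≤ lam) {h : ℝ}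
    {B : LayerL2 →L[ℝ] LayerL2} (hB : ‖B‖ ≤ 1) (hc : ∀ c, Commute (moveOp (fun _ => c) 1) B)
    (f f₁ f₂ : LayerL2) : discErr κ lam h (B f) (B f₁) (B f₂) ≤ discErr κ lam h f f₁ f₂ := by
  have hc' : ∀ c f, moveOp (fun _ => c) 1 (B f) = B (moveOp (fun _ => c) 1 f) :=
    fun c f => congr($(hc c) f)
  have h1 : secondDiff h (B f) = B (secondDiff h f) := by simp [secondDiff, hc']
  have h2 : ∀ c, diffQuot (fun _ => c) h (B f) = B (diffQuot (fun _ => c) h f) := by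
    simp [diffQuot, hc']
  rw [discErr, h1, h2, h2, ← map_neg, ← map_sub, ← map_sub, ← map_sub, discErr]
  gcongr <;> exact norm_apply_le_of_norm_le_one hB _

end Translations

/-! ### Test functions in `L²` -/

section TestFunctions

/-- The class of a test function in `L²(ℝ)`. -/
def testL2 (φ : TestFn) : Lp ℝ 2 (volume : Measure ℝ) :=
  (φ.continuous.memLp_of_hasCompactSupport (μ := volume) φ.hasCompactSupport).toLp φ

theorem toL2_apply (φ : LayerTestFn) (σ : Layer) : toL2 φ σ = testL2 (φ σ) := rfl

theorem testL2_add (φ ψ : TestFn) : testL2 (φ + ψ) = testL2 φ + testL2 ψ := rfl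

theorem testL2_sub (φ ψ : TestFn) : testL2 (φ - ψ) = testL2 φ - testL2 ψ := rfl

theorem testL2_smul (c : ℝ) (φ : TestFn) : testL2 (c • φ) = c • testL2 φ := rfl

theorem toL2_add (φ ψ : LayerTestFn) : toL2 (φ + ψ) = toL2 φ + toL2 ψ := rfl

theorem toL2_sub (φ ψ : LayerTestFn) : toL2 (φ - ψ) = toL2 φ - toL2 ψ := rfl

theorem toL2_smul (c : ℝ) (φ : LayerTestFn) : toL2 (c • φ) = c • toL2 φ := rfl

/-- The derivative of a test function. -/
abbrev TestFn.d (φ : TestFn) : TestFn := ∂_{(1 : ℝ)} φ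

theorem TestFn.coe_d (φ : TestFn) : (φ.d : ℝ → ℝ) = deriv φ := by
  ext y
  rw [TestFn.d, TestFunction.lineDerivOp_eq_lineDerivCLM ℝ,
    TestFunction.lineDerivCLM_apply_of_le (by simp)]
  simp [lineDeriv, deriv_comp_const_add]

theorem TestFn.hasDerivAt (φ : TestFn) (x : ℝ) : HasDerivAt φ (φ.d x) x := by
  rw [TestFn.coe_d]
  exact ((φ.contDiff.differentiable (by simp)) x).hasDerivAt

/-- The translate `φ(· + a)` of a test function. -/
def TestFn.trans (a : ℝ) (φ : TestFn) : TestFn where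
  toFun x := φ (x + a)
  contDiff' := φ.contDiff.comp (contDiff_id.add contDiff_const)
  hasCompactSupport' := φ.hasCompactSupport.comp_homeomorph (Homeomorph.addRight a)
  tsupport_subset' := by simp

theorem TestFn.trans_apply (a : ℝ) (φ : TestFn) (x : ℝ) : φ.trans a x = φ (x + a) := rfl

theorem TestFn.d_trans (a : ℝ) (φ : TestFn) : (φ.trans a).d = φ.d.trans a := by
  ext x
  rw [TestFn.trans_apply]
  have h := (φ.hasDerivAt (x + a)).comp_add_const x a
  exact ((φ.trans a).hasDerivAt x).unique h

theorem testL2_trans (a : ℝ) (φ : TestFn) : testL2 (φ.trans a) = transL2 a (testL2 φ) := rfl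

theorem TestFn.exists_bound (φ : TestFn) : ∃ C, 0 ≤ C ∧ ∀ x, |φ x| ≤ C := by
  obtain ⟨C, hC⟩ := φ.continuous.bounded_above_of_compact_support φ.hasCompactSupport
  exact ⟨C, (norm_nonneg _).trans (hC 0), hC⟩

theorem TestFn.exists_support (φ : TestFn) : ∃ R, 0 ≤ R ∧ ∀ x, R < |x| → φ x = 0 := by
  obtain ⟨R, hR⟩ := φ.hasCompactSupport.isCompact.isBounded.subset_closedBall 0
  refine ⟨max R 0, le_max_right _ _, fun x hx => ?_⟩
  by_contra h
  have := hR (subset_tsupport _ h)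
  simp only [Metric.mem_closedBall, dist_zero_right, Real.norm_eq_abs] at this
  exact absurd (le_max_of_le_left this) (not_le.2 hx)

theorem norm_toLp_le_of_bound {f : ℝ → ℝ} (hf : MemLp f 2 volume) {c R : ℝ}
    (hR : 0 ≤ R) (hc : ∀ x, |f x| ≤ c) (hs : ∀ x, R < |x| → f x = 0) :
    ‖hf.toLp f‖ ≤ c * √(2 * R) := by
  have hc0 : 0 ≤ c := (abs_nonneg _).trans (hc 0)
  have hsub : f.support ⊆ Set.Icc (-R) R := by
    intro x hx
    rw [Set.mem_Icc, ← abs_le]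
    by_contra h
    exact hx (hs x (not_le.1 h))
  rw [Lp.norm_toLp]
  refine ENNReal.toReal_le_of_le_ofReal (by positivity) ?_
  rw [← eLpNorm_restrict_eq_of_support_subset hsub]
  refine (eLpNorm_le_of_ae_bound (C := c) (Eventually.of_forall hc)).trans ?_
  rw [Measure.restrict_apply_univ, Real.volume_Icc, mul_comm, ENNReal.ofReal_mul hc0]
  gcongr
  rw [Real.sqrt_eq_rpow, ← ENNReal.ofReal_rpow_of_nonneg (by positivity) (by norm_num)]
  apply le_of_eq
  congr 2
  · ring
  · simp

theorem TestFn.abs_sub_le (φ : TestFn) : ∃ C, 0 ≤ C ∧ ∀ x y, |φ y - φ x| ≤ C * |y - x| := by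
  obtain ⟨C, hC0, hC⟩ := φ.d.exists_bound
  refine ⟨C, hC0, fun x y => ?_⟩
  exact convex_univ.norm_image_sub_le_of_norm_hasDerivWithin_le
    (fun z _ => (φ.hasDerivAt z).hasDerivWithinAt) (fun z _ => hC z) (Set.mem_univ x)
    (Set.mem_univ y)

theorem TestFn.abs_taylor_le (φ : TestFn) :
    ∃ C, 0 ≤ C ∧ ∀ x a, |φ (x + a) - φ x - a * φ.d x| ≤ C * a ^ 2 := by
  obtain ⟨C, hC0, hC⟩ := φ.d.abs_sub_le
  refine ⟨C, hC0, fun x a => ?_⟩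
  have hd : ∀ z, HasDerivAt (fun z => φ z - z * φ.d x) (φ.d z - φ.d x) z := fun z => by
    simpa using! (φ.hasDerivAt z).sub ((hasDerivAt_id z).mul_const (φ.d x))
  have h1 := (convex_uIcc x (x + a)).norm_image_sub_le_of_norm_hasDerivWithin_le (C := C * |a|)
    (fun z _ => (hd z).hasDerivWithinAt) (fun z hz => (hC x z).trans (by
      refine mul_le_mul_of_nonneg_left ?_ hC0
      simpa using Set.abs_sub_left_of_mem_uIcc hz)) Set.left_mem_uIcc Set.right_mem_uIcc
  have h2 : φ (x + a) - (x + a) * φ.d x - (φ x - x * φ.d x) = φ (x + a) - φ x - a * φ.d x := by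
    ring
  rw [h2] at h1
  simpa [mul_assoc, ← sq] using h1

theorem hasDerivAt_transL2_zero (φ : TestFn) :
    HasDerivAt (fun a => transL2 a (testL2 φ)) (testL2 φ.d) 0 := by
  obtain ⟨C, hC0, hC⟩ := φ.abs_taylor_le
  obtain ⟨R, hR0, hR⟩ := φ.exists_support
  obtain ⟨R', hR0', hR'⟩ := φ.d.exists_support
  -- The extra `1` accommodates shifts by `|a| ≤ 1`, so that the whole Taylor remainder vanishes
  -- outside radius `r`.
  set r := R + R' + 1
  have hb : ∀ a : ℝ, |a| ≤ 1 →
      ‖transL2 a (testL2 φ) - testL2 φ - a • testL2 φ.d‖ ≤ C * √(2 * r) * a ^ 2 := by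
    intro a ha
    have h1 : transL2 a (testL2 φ) - testL2 φ - a • testL2 φ.d =
        testL2 (φ.trans a - φ - a • φ.d) := by
      rw [testL2_sub, testL2_sub, testL2_smul, testL2_trans]
    rw [h1, mul_right_comm]
    refine norm_toLp_le_of_bound _ (by positivity) (fun x => ?_) fun x hx => ?_
    · exact hC x a
    · change φ (x + a) - φ x - a * φ.d x = 0
      have h2 : |x| ≤ |x + a| + |a| := by simpa using abs_sub (x + a) a
      have h3 : r = R + R' + 1 := rfl
      rw [hR x (by linarith), hR' x (by linarith), hR (x + a) (by linarith)]
      simp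
  rw [hasDerivAt_iff_isLittleO_nhds_zero]
  refine Asymptotics.IsBigO.trans_isLittleO (g := fun a : ℝ => a ^ 2) ?_ ?_
  · refine Asymptotics.IsBigO.of_bound (C * √(2 * r)) ?_
    filter_upwards [Metric.closedBall_mem_nhds (0 : ℝ) one_pos] with a ha
    simpa [transL2_zero] using hb a (by simpa using ha)
  · simpa using Asymptotics.isLittleO_pow_id (𝕜 := ℝ) one_lt_two

theorem hasDerivAt_transL2 (φ : TestFn) (a : ℝ) :
    HasDerivAt (fun a => transL2 a (testL2 φ)) (transL2 a (testL2 φ.d)) a := by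
  have h := hasDerivAt_transL2_zero (φ.trans a)
  rw [TestFn.d_trans] at h
  have h2 : HasDerivAt (fun b => transL2 (b - a) (testL2 (φ.trans a)))
      (transL2 a (testL2 φ.d)) a := by
    have := HasDerivAt.comp_sub_const (f := fun b => transL2 b (testL2 (φ.trans a))) a a
      (by rwa [sub_self])
    rwa [testL2_trans] at this
  refine h2.congr_of_eventuallyEq (Eventually.of_forall fun b => ?_)
  simp [testL2_trans, transL2_transL2]

theorem tendsto_diffQuot_transL2 (φ : TestFn) (e : ℝ) :
    Tendsto (fun h : ℝ => h⁻¹ • (transL2 (e * h) (testL2 φ) - testL2 φ)) (𝓝[>] 0)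
      (𝓝 (e • testL2 φ.d)) := by
  have h1 : HasDerivAt (fun h : ℝ => transL2 (e * h) (testL2 φ)) (e • testL2 φ.d) 0 := by
    have := HasDerivAt.scomp (g₁ := fun a => transL2 a (testL2 φ)) (0 : ℝ)
      (h := fun h => e * h) (h' := e) (g₁' := testL2 φ.d)
      (by simpa using hasDerivAt_transL2_zero φ) (by simpa using (hasDerivAt_id (0 : ℝ)).const_mul e)
    exact this
  have h2 := h1.tendsto_slope_zero_right
  simpa [transL2_zero] using h2

theorem tendsto_secondDiff_transL2 (φ : TestFn) :
    Tendsto (fun h : ℝ => (h ^ 2)⁻¹ • (transL2 h (testL2 φ) + transL2 (-h) (testL2 φ)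
      - (2 : ℝ) • testL2 φ)) (𝓝[>] 0) (𝓝 (testL2 φ.d.d)) := by
  have hneg : ∀ ψ : TestFn, ∀ a, HasDerivAt (fun a => transL2 (-a) (testL2 ψ))
      (-transL2 (-a) (testL2 ψ.d)) a := fun ψ a => by
    simpa using! (hasDerivAt_transL2 ψ (-a)).scomp a (hasDerivAt_neg a)
  -- The remainder of the symmetric second difference is differentiated once in the shift. Its
  -- derivative is a first-order remainder for `φ.d`, hence `o(a)`, and the mean value inequality
  -- upgrades this to `o(h ^ 2)`.
  have hd : ∀ a, HasDerivAt (fun a => transL2 a (testL2 φ) + transL2 (-a) (testL2 φ)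
      - (2 : ℝ) • testL2 φ - a ^ 2 • testL2 φ.d.d)
      (transL2 a (testL2 φ.d) - transL2 (-a) (testL2 φ.d) - (2 * a) • testL2 φ.d.d) a := fun a => by
    refine ((((hasDerivAt_transL2 φ a).add (hneg φ a)).sub_const _).sub
      ((hasDerivAt_pow 2 a).smul_const _)).congr_deriv ?_
    simp [sub_eq_add_neg]
  have h1 : HasDerivAt (fun a => transL2 a (testL2 φ.d) - transL2 (-a) (testL2 φ.d))
      ((2 : ℝ) • testL2 φ.d.d) 0 := by
    refine ((hasDerivAt_transL2 φ.d 0).sub (hneg φ.d 0)).congr_deriv ?_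
    simp [transL2_zero, two_smul]
  rw [hasDerivAt_iff_isLittleO_nhds_zero] at h1
  rw [tendsto_iff_norm_sub_tendsto_zero, Metric.tendsto_nhds]
  intro ε hε
  have h2 := h1.def (half_pos hε)
  rw [Metric.eventually_nhds_iff] at h2
  obtain ⟨δ, hδ, h2⟩ := h2
  filter_upwards [Ioo_mem_nhdsGT hδ] with h hh
  have h3 := norm_image_sub_le_of_norm_deriv_le_segment' (a := 0) (b := h) (C := ε / 2 * h)
    (fun s _ => (hd s).hasDerivWithinAt) (fun s hs => by
      have h4 := h2 (y := s) (by
        rw [Real.dist_0_eq_abs, abs_of_nonneg hs.1]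
        exact hs.2.trans hh.2)
      simp only [zero_add, neg_zero, transL2_zero, sub_self, sub_zero, smul_smul,
        Real.norm_eq_abs, abs_of_nonneg hs.1] at h4
      rw [mul_comm 2 s]
      exact h4.trans (by gcongr; exact hs.2.le)) h ⟨hh.1.le, le_rfl⟩
  simp only [transL2_zero, neg_zero, ← two_smul ℝ (testL2 φ), sub_self, sub_zero, ne_eq,
    OfNat.ofNat_ne_zero, not_false_eq_true, zero_pow, zero_smul] at h3
  have hh2 : 0 < h ^ 2 := by have := hh.1; positivity
  have h5 : (h ^ 2)⁻¹ • (transL2 h (testL2 φ) + transL2 (-h) (testL2 φ) - (2 : ℝ) • testL2 φ)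
      - testL2 φ.d.d = (h ^ 2)⁻¹ • (transL2 h (testL2 φ) + transL2 (-h) (testL2 φ)
      - (2 : ℝ) • testL2 φ - h ^ 2 • testL2 φ.d.d) := by
    rw [smul_sub _ _ (h ^ 2 • _), smul_smul, inv_mul_cancel₀ hh2.ne', one_smul]
  rw [dist_zero_right, norm_norm, h5, norm_smul, Real.norm_of_nonneg (by positivity),
    inv_mul_lt_iff₀ hh2]
  nlinarith

/-- The layerwise derivative. -/
def LayerTestFn.d (φ : LayerTestFn) : LayerTestFn := fun σ => (φ σ).d

theorem toL2_limitGen (κ lam γ : ℝ) (φ : LayerTestFn) :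
    toL2 (limitGen κ lam γ φ) =
      genOf κ lam γ (toL2 φ) (toL2 (LayerTestFn.d φ)) (toL2 (LayerTestFn.d (LayerTestFn.d φ))) := by
  ext1 σ
  simp only [toL2_apply, limitGen, testL2_add, testL2_smul, testL2_sub, genOf, PiLp.add_apply,
    PiLp.smul_apply, PiLp.sub_apply, signOp_apply, moveOp_apply, layerMove_apply, smul_smul]
  simp [transL2_zero, LayerTestFn.d, layerSign, mul_comm]

theorem tendsto_discErr (κ lam : ℝ) (φ : LayerTestFn) :
    Tendsto (fun h => discErr κ lam h (toL2 φ) (toL2 (LayerTestFn.d φ))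
      (toL2 (LayerTestFn.d (LayerTestFn.d φ)))) (𝓝[>] 0) (𝓝 0) := by
  have key : ∀ {F : ℝ → LayerL2} {G : LayerL2}, (∀ σ, Tendsto (fun h => F h σ) (𝓝[>] 0) (𝓝 (G σ))) →
      Tendsto (fun h => ‖F h - G‖) (𝓝[>] 0) (𝓝 0) := by
    intro F G h
    rw [← tendsto_iff_norm_sub_tendsto_zero]
    have h1 := (PiLp.continuous_toLp 2 (fun _ : Layer => Lp ℝ 2 (volume : Measure ℝ))).tendsto
      (fun σ => G σ) |>.comp (tendsto_pi_nhds.2 h)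
    exact h1
  have h2 : ∀ e : ℝ, ∀ σ, Tendsto (fun h => diffQuot (fun _ => e) h (toL2 φ) σ) (𝓝[>] 0)
      (𝓝 (e • toL2 (LayerTestFn.d φ) σ)) := by
    intro e σ
    simpa [diffQuot, moveOp_apply, layerMove_apply, toL2_apply, LayerTestFn.d] using
      tendsto_diffQuot_transL2 (φ σ) e
  have h3 : ∀ σ, Tendsto (fun h => secondDiff h (toL2 φ) σ) (𝓝[>] 0)
      (𝓝 (toL2 (LayerTestFn.d (LayerTestFn.d φ)) σ)) := by
    intro σ
    simpa [secondDiff, moveOp_apply, layerMove_apply, toL2_apply, LayerTestFn.d] using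
      tendsto_secondDiff_transL2 (φ σ)
  have h4 := ((key h3).const_mul κ).add
    (((key (G := toL2 (LayerTestFn.d φ)) (by simpa using h2 1)).add
      (key (G := -toL2 (LayerTestFn.d φ)) (by simpa using h2 (-1)))).const_mul lam)
  simpa [discErr] using h4

theorem dense_testL2 (f : Lp ℝ 2 (volume : Measure ℝ)) (h : ∀ φ : TestFn, ⟪f, testL2 φ⟫ = 0) :
    f = 0 := by
  rw [Lp.eq_zero_iff_ae_eq_zero]
  refine ae_eq_zero_of_integral_contDiff_smul_eq_zero
    ((Lp.memLp f).locallyIntegrable (by norm_num)) fun g hg hg' => ?_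
  have h1 := h ⟨g, hg, hg', by simp⟩
  rw [L2.inner_def] at h1
  rw [← h1]
  refine integral_congr_ae ?_
  filter_upwards [(hg.continuous.memLp_of_hasCompactSupport (μ := volume) (p := 2)
    hg').coeFn_toLp] with x hx
  have h2 : (testL2 ⟨g, hg, hg', by simp⟩ : Lp ℝ 2 (volume : Measure ℝ)) x = g x := hx
  rw [h2]
  simp

/-- Test functions as a subspace of `L²(ℝ × S)`. -/
def testSubmodule : Submodule ℝ LayerL2 where
  carrier := Set.range toL2
  add_mem' := by
    rintro _ _ ⟨φ, rfl⟩ ⟨ψ, rfl⟩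
    exact ⟨φ + ψ, rfl⟩
  zero_mem' := ⟨0, rfl⟩
  smul_mem' := by
    rintro c _ ⟨φ, rfl⟩
    exact ⟨c • φ, rfl⟩

theorem denseRange_toL2 : DenseRange toL2 := by
  have h : testSubmodule.topologicalClosure = ⊤ := by
    rw [Submodule.topologicalClosure_eq_top_iff, Submodule.eq_bot_iff]
    intro f hf
    rw [Submodule.mem_orthogonal'] at hf
    ext1 σ
    refine dense_testL2 _ fun φ => ?_
    have h1 := hf (toL2 (Pi.single σ φ)) ⟨_, rfl⟩
    rw [PiLp.inner_apply, Finset.sum_eq_single σ] at h1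
    · simpa [toL2_apply] using h1
    · intro τ _ hτ
      rw [toL2_apply, Pi.single_eq_of_ne hτ]
      exact inner_zero_right _
    · exact fun hσ => absurd (Finset.mem_univ σ) hσ
  intro f
  have : f ∈ testSubmodule.topologicalClosure := h ▸ Submodule.mem_top
  exact this

end TestFunctions

/-! ### Existence of the limiting semigroup -/

section Existence

variable {κ lam γ : ℝ}

theorem tendsto_discGen (hκ : 0 ≤ κ) (hlam : 0 ≤ lam) (φ : LayerTestFn) :
    Tendsto (fun h => discGen κ lam γ h (toL2 φ)) (𝓝[>] 0) (𝓝 (toL2 (limitGen κ lam γ φ))) := by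
  rw [tendsto_iff_norm_sub_tendsto_zero]
  refine squeeze_zero (fun _ => norm_nonneg _) (fun h => ?_) (tendsto_discErr κ lam φ)
  rw [toL2_limitGen]
  exact norm_discGen_sub_genOf_le hκ hlam γ h _ _ _

theorem norm_expOp_discGen_sub_le (hκ : 0 ≤ κ) (hlam : 0 ≤ lam) (hγ : 0 ≤ γ) {h k t : ℝ}
    (hh : 0 < h) (hk : 0 < k) (ht : 0 ≤ t) (f f₁ f₂ : LayerL2) :
    ‖expOp (discGen κ lam γ h) t f - expOp (discGen κ lam γ k) t f‖ ≤
      t * (discErr κ lam h f f₁ f₂ + discErr κ lam k f f₁ f₂) := by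
  refine norm_expOp_sub_expOp_le (fun t ht => norm_expOp_discGen_le_one hκ hlam hγ hk ht) ht
    fun s hs => ?_
  set B := expOp (discGen κ lam γ h) s
  have hB : ‖B‖ ≤ 1 := norm_expOp_discGen_le_one hκ hlam hγ hh hs
  have hc : ∀ c, Commute (moveOp (fun _ => c) 1) B := fun c =>
    commute_expOp (commute_moveOp_discGen c κ lam γ h) s
  -- The same formal value of the limiting generator is inserted for both spacings, so only two
  -- consistency errors remain.
  have h1 : (discGen κ lam γ h - discGen κ lam γ k) (B f) =
      (discGen κ lam γ h (B f) - genOf κ lam γ (B f) (B f₁) (B f₂)) -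
      (discGen κ lam γ k (B f) - genOf κ lam γ (B f) (B f₁) (B f₂)) := by
    rw [sub_apply]; abel
  rw [h1]
  refine (norm_sub_le _ _).trans (add_le_add ?_ ?_) <;>
    exact (norm_discGen_sub_genOf_le hκ hlam γ _ _ _ _).trans (discErr_map_le hκ hlam hB hc _ _ _)

theorem exists_tendsto_expOp_discGen (hκ : 0 ≤ κ) (hlam : 0 ≤ lam) (hγ : 0 ≤ γ) {t : ℝ}
    (ht : 0 ≤ t) (f : LayerL2) :
    ∃ g, Tendsto (fun h => expOp (discGen κ lam γ h) t f) (𝓝[>] 0) (𝓝 g) := by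
  refine cauchy_map_iff_exists_tendsto.1 (Metric.cauchy_iff.2 ⟨inferInstance, fun ε hε => ?_⟩)
  -- Four quarters: the approximation of `f` by `φ` is paid once for each spacing, and each spacing
  -- contributes one consistency error.
  obtain ⟨φ, hφ⟩ := denseRange_toL2.exists_dist_lt f (ε := ε / 4) (by positivity)
  rw [dist_eq_norm] at hφ
  have h1 := ((tendsto_discErr κ lam φ).const_mul t).eventually
    (Iio_mem_nhds (show t * 0 < ε / 4 by rw [mul_zero]; positivity))
  refine ⟨_, image_mem_map (h1.and self_mem_nhdsWithin), ?_⟩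
  rintro _ ⟨h, ⟨hh, hh0⟩, rfl⟩ _ ⟨k, ⟨hk, hk0⟩, rfl⟩
  rw [dist_eq_norm]
  have h2 := norm_expOp_discGen_sub_le hκ hlam hγ hh0 hk0 ht (toL2 φ) (toL2 (LayerTestFn.d φ))
    (toL2 (LayerTestFn.d (LayerTestFn.d φ)))
  have h3 := norm_apply_le_of_norm_le_one (norm_expOp_discGen_le_one hκ hlam hγ hh0 ht) (f - toL2 φ)
  have h4 := norm_apply_le_of_norm_le_one (norm_expOp_discGen_le_one hκ hlam hγ hk0 ht) (f - toL2 φ)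
  have h5 : expOp (discGen κ lam γ h) t f - expOp (discGen κ lam γ k) t f =
      expOp (discGen κ lam γ h) t (f - toL2 φ) - expOp (discGen κ lam γ k) t (f - toL2 φ) +
      (expOp (discGen κ lam γ h) t (toL2 φ) - expOp (discGen κ lam γ k) t (toL2 φ)) := by
    rw [map_sub, map_sub]; abel
  change _ < ε / 4 at hh
  change _ < ε / 4 at hk
  calc _ ≤ ‖expOp (discGen κ lam γ h) t (f - toL2 φ)‖
        + ‖expOp (discGen κ lam γ k) t (f - toL2 φ)‖
        + ‖expOp (discGen κ lam γ h) t (toL2 φ) - expOp (discGen κ lam γ k) t (toL2 φ)‖ := by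
        rw [h5]
        exact (norm_add_le _ _).trans (by gcongr; exact norm_sub_le _ _)
    _ < ε := by linarith

theorem exists_limitSemigroup (hκ : 0 ≤ κ) (hlam : 0 ≤ lam) (hγ : 0 ≤ γ) :
    ∃ T : ℝ≥0 → LayerL2 →L[ℝ] LayerL2, ∀ (t : ℝ≥0) f,
      Tendsto (fun h => expOp (discGen κ lam γ h) t f) (𝓝[>] 0) (𝓝 (T t f)) := by
  choose L hL using fun (t : ℝ≥0) => exists_tendsto_expOp_discGen hκ hlam hγ t.2
  refine ⟨fun t => continuousLinearMapOfTendsto (fun h => expOp (discGen κ lam γ h) t)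
    (tendsto_pi_nhds.2 (hL t)), fun t f => hL t f⟩

theorem isSemigroup_of_tendsto (hκ : 0 ≤ κ) (hlam : 0 ≤ lam) (hγ : 0 ≤ γ)
    {T : ℝ≥0 → LayerL2 →L[ℝ] LayerL2}
    (hT : ∀ (t : ℝ≥0) f, Tendsto (fun h => expOp (discGen κ lam γ h) t f) (𝓝[>] 0) (𝓝 (T t f))) :
    IsSemigroupGeneratedBy κ lam γ T := by
  have hc : ∀ (t : ℝ≥0), ∀ᶠ h : ℝ in 𝓝[>] 0, ‖expOp (discGen κ lam γ h) t‖ ≤ 1 := fun t => by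
    filter_upwards [self_mem_nhdsWithin] with h hh
    exact norm_expOp_discGen_le_one hκ hlam hγ hh t.2
  have hnorm : ∀ t f, ‖T t f‖ ≤ ‖f‖ := fun t f => by
    refine le_of_tendsto (hT t f).norm ?_
    filter_upwards [hc t] with h hh
    exact norm_apply_le_of_norm_le_one hh f
  have hzero : T 0 = ContinuousLinearMap.id ℝ LayerL2 := by
    ext1 f
    refine tendsto_nhds_unique (hT 0 f) ?_
    simp [expOp_zero]
  have hadd : ∀ s t, T (s + t) = (T s).comp (T t) := by
    intro s t
    ext1 f
    refine tendsto_nhds_unique (hT (s + t) f) ?_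
    have h1 : Tendsto (fun h => expOp (discGen κ lam γ h) s
        (expOp (discGen κ lam γ h) t f - T t f)) (𝓝[>] 0) (𝓝 0) := by
      have h0 := tendsto_iff_norm_sub_tendsto_zero.1 (hT t f)
      refine squeeze_zero_norm' ?_ h0
      filter_upwards [hc s] with h hh
      exact norm_apply_le_of_norm_le_one hh _
    have h2 := h1.add (hT s (T t f))
    simpa [expOp_add] using h2
  have hsub : ∀ (t : ℝ≥0) (φ : LayerTestFn),
      ‖T t (toL2 φ) - toL2 φ‖ ≤ t * ‖toL2 (limitGen κ lam γ φ)‖ := fun t φ => by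
    refine le_of_tendsto_of_tendsto ((hT t (toL2 φ)).sub_const _).norm
      ((tendsto_discGen (γ := γ) hκ hlam φ).norm.const_mul (t : ℝ)) ?_
    filter_upwards [self_mem_nhdsWithin] with h hh
    exact norm_expOp_sub_self_le (fun t ht => norm_expOp_discGen_le_one hκ hlam hγ hh ht) _ t.2
  refine ⟨hzero, hadd, fun f => ?_, fun φ => ?_⟩
  -- Orbits of test functions are Lipschitz. Contractivity makes approximation by such orbits
  -- uniform in time, which gives continuity of all orbits.
  · have hlip : ∀ φ : LayerTestFn, Continuous fun t => T t (toL2 φ) := by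
      intro φ
      refine LipschitzWith.continuous (K := ‖toL2 (limitGen κ lam γ φ)‖₊) ?_
      have hle : ∀ s t : ℝ≥0, s ≤ t → dist (T s (toL2 φ)) (T t (toL2 φ)) ≤
          ‖toL2 (limitGen κ lam γ φ)‖ * dist s t := by
        intro s t hst
        obtain ⟨r, rfl⟩ := exists_add_of_le hst
        rw [hadd, dist_comm, dist_eq_norm, ContinuousLinearMap.comp_apply, ← map_sub, dist_comm,
          NNReal.dist_eq, NNReal.coe_add, add_sub_cancel_left, abs_of_nonneg r.coe_nonneg, mul_comm]
        exact (hnorm _ _).trans (hsub r φ)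
      refine LipschitzWith.of_dist_le_mul fun s t => ?_
      rcases le_total s t with h | h
      · exact hle s t h
      · rw [dist_comm, dist_comm s]; exact hle t s h
    refine continuous_of_uniform_approx_of_continuous fun U hU => ?_
    obtain ⟨ε, hε, hU⟩ := Metric.mem_uniformity_dist.1 hU
    obtain ⟨φ, hφ⟩ := denseRange_toL2.exists_dist_lt f hε
    refine ⟨_, hlip φ, fun t => hU ?_⟩
    rw [dist_eq_norm, ← map_sub]
    exact (hnorm _ _).trans_lt (by rwa [← dist_eq_norm])
  -- A first-order expansion with error `t ^ 2 ‖A ^ 2 φ‖` is obtained by letting `h → 0`. This is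
  -- possible because `A φ` is again a test function, so the discrete generators converge on it too.
  · have h1 : ∀ (t : ℝ≥0), ‖T t (toL2 φ) - toL2 φ - (t : ℝ) • toL2 (limitGen κ lam γ φ)‖ ≤
        t * (t * ‖toL2 (limitGen κ lam γ (limitGen κ lam γ φ))‖) := fun t => by
      have h2 := ((tendsto_iff_norm_sub_tendsto_zero.1 (tendsto_discGen (γ := γ) hκ hlam φ)).add
        ((tendsto_discGen (γ := γ) hκ hlam (limitGen κ lam γ φ)).norm.const_mul (t : ℝ))).const_mul
          (t : ℝ)
      rw [zero_add] at h2
      refine le_of_tendsto_of_tendsto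
        (((hT t (toL2 φ)).sub_const _).sub_const _).norm h2 ?_
      filter_upwards [self_mem_nhdsWithin] with h hh
      exact norm_expOp_sub_sub_le (fun t ht => norm_expOp_discGen_le_one hκ hlam hγ hh ht) _ _ t.2
    rw [tendsto_iff_norm_sub_tendsto_zero]
    have h3 : Tendsto (fun t : ℝ≥0 => (t : ℝ) * ‖toL2 (limitGen κ lam γ (limitGen κ lam γ φ))‖)
        (𝓝[>] 0) (𝓝 0) := by
      refine Tendsto.mono_left ?_ nhdsWithin_le_nhds
      refine Continuous.tendsto' (by fun_prop) _ _ (by simp)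
    refine squeeze_zero' (Eventually.of_forall fun _ => norm_nonneg _) ?_ h3
    filter_upwards [self_mem_nhdsWithin] with t ht
    have ht' : (0 : ℝ) < t := ht
    have h4 : (t : ℝ)⁻¹ • (T t (toL2 φ) - toL2 φ) - toL2 (limitGen κ lam γ φ) =
        (t : ℝ)⁻¹ • (T t (toL2 φ) - toL2 φ - (t : ℝ) • toL2 (limitGen κ lam γ φ)) := by
      rw [smul_sub _ _ ((t : ℝ) • _), smul_smul, inv_mul_cancel₀ ht'.ne', one_smul]
    rw [h4, norm_smul, Real.norm_of_nonneg (by positivity), inv_mul_le_iff₀ ht']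
    exact h1 t

end Existence

/-! ### Uniqueness of the limiting semigroup -/

section Uniqueness

variable {κ lam γ : ℝ}

/-- The Euler step `1 + δ A_h` on test functions. -/
def eulerStep (κ lam γ h δ : ℝ) (φ : LayerTestFn) : LayerTestFn :=
  let move (a : Layer → ℝ) (ε : Layer) : LayerTestFn := fun σ => (φ (ε * σ)).trans (a σ)
  φ + δ • (κ • (h ^ 2)⁻¹ • (move (fun _ => h) 1 + move (fun _ => -h) 1 - (2 : ℝ) • φ)
    + lam • h⁻¹ • (move (fun σ => layerSign σ * h) 1 - φ) + γ • (move 0 (-1) - φ))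

theorem toL2_eulerStep (κ lam γ h δ : ℝ) (φ : LayerTestFn) :
    toL2 (eulerStep κ lam γ h δ φ) = (1 + δ • discGen κ lam γ h) (toL2 φ) := rfl

theorem LayerTestFn.d_add (φ ψ : LayerTestFn) : d (φ + ψ) = d φ + d ψ := by
  funext σ
  exact LineDeriv.lineDerivOp_add _ _ _

theorem LayerTestFn.d_smul (c : ℝ) (φ : LayerTestFn) : d (c • φ) = c • d φ := by
  funext σ
  exact LineDeriv.lineDerivOp_smul _ c (φ σ)

theorem LayerTestFn.d_sub (φ ψ : LayerTestFn) : d (φ - ψ) = d φ - d ψ := by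
  rw [sub_eq_add_neg, ← neg_one_smul ℝ, d_add, d_smul, neg_one_smul, ← sub_eq_add_neg]

/-- Translations, flips and linear combinations all commute with the derivative. Bounds on
derivatives are thus propagated along the scheme by the same contraction estimate as the function
itself. -/
theorem d_eulerStep (κ lam γ h δ : ℝ) (φ : LayerTestFn) :
    LayerTestFn.d (eulerStep κ lam γ h δ φ) = eulerStep κ lam γ h δ (LayerTestFn.d φ) := by
  have h1 : ∀ (a : Layer → ℝ) (ε : Layer), LayerTestFn.d (fun σ => (φ (ε * σ)).trans (a σ)) =
      fun σ => (LayerTestFn.d φ (ε * σ)).trans (a σ) := by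
    intro a ε
    funext σ
    exact TestFn.d_trans _ _
  simp only [eulerStep, LayerTestFn.d_add, LayerTestFn.d_smul, LayerTestFn.d_sub, h1]

theorem d_limitGen (κ lam γ : ℝ) (φ : LayerTestFn) :
    LayerTestFn.d (limitGen κ lam γ φ) = limitGen κ lam γ (LayerTestFn.d φ) := by
  funext σ
  have h1 : ∀ f g : TestFn, (f - g).d = f.d - g.d := fun f g => by
    rw [sub_eq_add_neg, ← neg_one_smul ℝ, TestFn.d, LineDeriv.lineDerivOp_add,
      LineDeriv.lineDerivOp_smul, neg_one_smul, ← sub_eq_add_neg]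
  simp only [LayerTestFn.d, limitGen, TestFn.d, LineDeriv.lineDerivOp_add,
    LineDeriv.lineDerivOp_smul] at h1 ⊢
  rw [h1]

/-- A bound for `‖A φ‖` in terms of the derivatives of `φ`. -/
def genBound (κ lam γ : ℝ) (φ : LayerTestFn) : ℝ :=
  κ * ‖toL2 (LayerTestFn.d (LayerTestFn.d φ))‖ + lam * ‖toL2 (LayerTestFn.d φ)‖
    + γ * (2 * ‖toL2 φ‖)

theorem norm_limitGen_le (hκ : 0 ≤ κ) (hlam : 0 ≤ lam) (hγ : 0 ≤ γ) (φ : LayerTestFn) :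
    ‖toL2 (limitGen κ lam γ φ)‖ ≤ genBound κ lam γ φ := by
  rw [toL2_limitGen, genOf, genBound]
  refine norm_add₃_le.trans (add_le_add_three ?_ ?_ ?_)
  · rw [norm_smul, Real.norm_of_nonneg hκ]
  · rw [norm_smul, Real.norm_of_nonneg hlam, LinearIsometry.norm_map]
  · rw [norm_smul, Real.norm_of_nonneg hγ, two_mul]
    gcongr
    refine (norm_sub_le _ _).trans ?_
    rw [moveOp_apply, LinearIsometry.norm_map]

/-- A bound for `‖A (A φ)‖` in terms of the derivatives of `φ`. -/
def genBoundSq (κ lam γ : ℝ) (φ : LayerTestFn) : ℝ :=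
  κ * genBound κ lam γ (LayerTestFn.d (LayerTestFn.d φ)) +
    lam * genBound κ lam γ (LayerTestFn.d φ) + γ * (2 * genBound κ lam γ φ)

theorem norm_limitGen_limitGen_le (hκ : 0 ≤ κ) (hlam : 0 ≤ lam) (hγ : 0 ≤ γ) (φ : LayerTestFn) :
    ‖toL2 (limitGen κ lam γ (limitGen κ lam γ φ))‖ ≤ genBoundSq κ lam γ φ := by
  refine (norm_limitGen_le hκ hlam hγ _).trans ?_
  rw [genBound, d_limitGen, d_limitGen, genBoundSq]
  gcongr <;> exact norm_limitGen_le hκ hlam hγ _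

/-- The bound involves only norms of derivatives, each contracted by the step. This is why it is
used in place of `‖A (A φ)‖`: it stays uniform over all Euler steps. -/
theorem genBoundSq_eulerStep_le (hκ : 0 ≤ κ) (hlam : 0 ≤ lam) (hγ : 0 ≤ γ) {h δ : ℝ}
    (hB : ‖1 + δ • discGen κ lam γ h‖ ≤ 1) (φ : LayerTestFn) :
    genBoundSq κ lam γ (eulerStep κ lam γ h δ φ) ≤ genBoundSq κ lam γ φ := by
  have h1 : ∀ ψ, ‖toL2 (eulerStep κ lam γ h δ ψ)‖ ≤ ‖toL2 ψ‖ := fun ψ => by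
    rw [toL2_eulerStep]
    exact norm_apply_le_of_norm_le_one hB _
  have h2 : ∀ ψ, genBound κ lam γ (eulerStep κ lam γ h δ ψ) ≤ genBound κ lam γ ψ := fun ψ => by
    simp only [genBound, d_eulerStep]
    gcongr <;> exact h1 _
  simp only [genBoundSq, d_eulerStep]
  gcongr <;> exact h2 _

variable {T : ℝ≥0 → LayerL2 →L[ℝ] LayerL2}

/-- Contractivity is not part of the definition of the semigroup. Orbits are bounded on compact time
intervals by continuity, and uniform boundedness does the rest. -/
theorem IsSemigroupGeneratedBy.exists_norm_le (hT : IsSemigroupGeneratedBy κ lam γ T) (t : ℝ≥0) :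
    ∃ C, 1 ≤ C ∧ ∀ s ≤ t, ‖T s‖ ≤ C := by
  obtain ⟨C, hC⟩ := banach_steinhaus (g := fun s : Set.Icc 0 t => T s) fun f => by
    obtain ⟨C, hC⟩ := (isCompact_Icc (a := 0) (b := t)).exists_bound_of_continuousOn
      (hT.continuous f).continuousOn
    exact ⟨C, fun s => hC s s.2⟩
  exact ⟨max C 1, le_max_right _ _, fun s hs =>
    (hC ⟨s, ⟨zero_le, hs⟩⟩).trans (le_max_left _ _)⟩

/-- For `r > s` the increment is `T s` applied to an increment at time `0`. Only the right
derivative comes out, which suffices for the mean value inequality. -/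
theorem IsSemigroupGeneratedBy.hasDerivWithinAt (hT : IsSemigroupGeneratedBy κ lam γ T)
    (φ : LayerTestFn) {s : ℝ} (hs : 0 ≤ s) :
    HasDerivWithinAt (fun s : ℝ => T s.toNNReal (toL2 φ))
      (T s.toNNReal (toL2 (limitGen κ lam γ φ))) (Set.Ici s) s := by
  rw [← hasDerivWithinAt_Ioi_iff_Ici, hasDerivWithinAt_iff_tendsto_slope' (by simp)]
  have h1 : Tendsto (fun r : ℝ => (r - s).toNNReal) (𝓝[>] s) (𝓝[>] 0) := by
    refine tendsto_nhdsWithin_iff.2 ⟨?_, ?_⟩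
    · refine Tendsto.mono_left ?_ nhdsWithin_le_nhds
      refine Continuous.tendsto' (by fun_prop) _ _ (by simp)
    · filter_upwards [self_mem_nhdsWithin] with r hr
      simpa using hr
  have h2 := ((T s.toNNReal).continuous.tendsto _).comp ((hT.generator φ).comp h1)
  refine h2.congr' ?_
  filter_upwards [self_mem_nhdsWithin] with r hr
  have hr' : s < r := hr
  have h3 : r.toNNReal = s.toNNReal + (r - s).toNNReal := by
    rw [← Real.toNNReal_add hs (by linarith)]; simp
  simp only [Function.comp, slope, vsub_eq_sub]
  rw [Real.coe_toNNReal _ (by linarith), map_smul, map_sub, h3, hT.add]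
  rfl

theorem IsSemigroupGeneratedBy.norm_sub_le (hT : IsSemigroupGeneratedBy κ lam γ T) {C : ℝ}
    {t : ℝ≥0} (hC : ∀ s ≤ t, ‖T s‖ ≤ C) (φ : LayerTestFn) :
    ‖T t (toL2 φ) - toL2 φ‖ ≤ t * (C * ‖toL2 (limitGen κ lam γ φ)‖) := by
  have h1 := norm_image_sub_le_of_norm_deriv_right_le_segment
    (f := fun s : ℝ => T s.toNNReal (toL2 φ)) (a := 0) (b := t)
    (C := C * ‖toL2 (limitGen κ lam γ φ)‖)
    ((hT.continuous _).comp continuous_real_toNNReal).continuousOn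
    (fun s hs => hT.hasDerivWithinAt φ hs.1)
    (fun s hs => (T _).le_of_opNorm_le (hC _ (Real.toNNReal_le_iff_le_coe.2 hs.2.le)) _)
    t ⟨t.2, le_rfl⟩
  rw [mul_comm]
  simpa [hT.zero] using h1

theorem IsSemigroupGeneratedBy.norm_sub_sub_le (hT : IsSemigroupGeneratedBy κ lam γ T) {C : ℝ}
    {t : ℝ≥0} (hC : ∀ s ≤ t, ‖T s‖ ≤ C) (hC0 : 0 ≤ C) (φ : LayerTestFn) :
    ‖T t (toL2 φ) - toL2 φ - (t : ℝ) • toL2 (limitGen κ lam γ φ)‖ ≤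
      t * (t * (C * ‖toL2 (limitGen κ lam γ (limitGen κ lam γ φ))‖)) := by
  have h1 := norm_image_sub_le_of_norm_deriv_right_le_segment
    (f := fun s : ℝ => T s.toNNReal (toL2 φ) - s • toL2 (limitGen κ lam γ φ)) (a := 0) (b := t)
    (C := t * (C * ‖toL2 (limitGen κ lam γ (limitGen κ lam γ φ))‖))
    (((hT.continuous _).comp continuous_real_toNNReal).sub (by fun_prop)).continuousOn
    (fun s hs => (hT.hasDerivWithinAt φ hs.1).sub
      ((hasDerivWithinAt_id s _).smul_const (toL2 (limitGen κ lam γ φ))))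
    (fun s hs => by
      have hst : s.toNNReal ≤ t := Real.toNNReal_le_iff_le_coe.2 hs.2.le
      rw [one_smul]
      refine (hT.norm_sub_le (fun r hr => hC r (hr.trans hst)) _).trans ?_
      gcongr)
    t ⟨t.2, le_rfl⟩
  rw [mul_comm]
  simpa [hT.zero, sub_right_comm] using h1

theorem IsSemigroupGeneratedBy.norm_sub_euler_le (hT : IsSemigroupGeneratedBy κ lam γ T)
    (hκ : 0 ≤ κ) (hlam : 0 ≤ lam) (hγ : 0 ≤ γ) {C h : ℝ} {t δ : ℝ≥0} (hC : ∀ s ≤ t, ‖T s‖ ≤ C)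
    (hC1 : 1 ≤ C) (hB : ‖1 + (δ : ℝ) • discGen κ lam γ h‖ ≤ 1) (n : ℕ) (hn : n * δ ≤ t)
    (φ : LayerTestFn) :
    ‖T (n * δ) (toL2 φ) - ((1 + (δ : ℝ) • discGen κ lam γ h) ^ n) (toL2 φ)‖ ≤
      n * (C * (δ * discErr κ lam h (toL2 φ) (toL2 (LayerTestFn.d φ))
        (toL2 (LayerTestFn.d (LayerTestFn.d φ))) + δ * (δ * (C * genBoundSq κ lam γ φ)))) := by
  have hC0 : 0 ≤ C := by linarith
  set B := 1 + (δ : ℝ) • discGen κ lam γ h with hBdef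
  have hcomm : ∀ c, Commute (moveOp (fun _ => c) 1) B := fun c =>
    (Commute.one_right _).add_right ((commute_moveOp_discGen c κ lam γ h).smul_right _)
  induction n generalizing φ with
  | zero => simp [hT.zero]
  | succ n ih =>
    have hn' : n * δ ≤ t := le_trans (by gcongr; simp) hn
    have hδ : δ ≤ t := le_trans (le_mul_of_one_le_left zero_le (by simp)) hn
    set err := discErr κ lam h (toL2 φ) (toL2 (LayerTestFn.d φ))
      (toL2 (LayerTestFn.d (LayerTestFn.d φ)))
    -- The local error is made in the first step and then carried by `T`. The rest starts from
    -- `eulerStep κ lam γ h δ φ`, again a test function, so the induction generalizes over `φ` and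
    -- needs the generator on test functions only.
    have h1 : T ((n + 1 : ℕ) * δ) (toL2 φ) - (B ^ (n + 1)) (toL2 φ) =
        T (n * δ) (T δ (toL2 φ) - B (toL2 φ)) +
        (T (n * δ) (toL2 (eulerStep κ lam γ h δ φ)) -
          (B ^ n) (toL2 (eulerStep κ lam γ h δ φ))) := by
      rw [toL2_eulerStep, ← hBdef, Nat.cast_add, Nat.cast_one, add_mul, one_mul, hT.add, pow_succ,
        map_sub]
      simp
    have h2 : ‖T δ (toL2 φ) - B (toL2 φ)‖ ≤ δ * err + δ * (δ * (C * genBoundSq κ lam γ φ)) := by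
      have h3 : T δ (toL2 φ) - B (toL2 φ) =
          (δ : ℝ) • (toL2 (limitGen κ lam γ φ) - discGen κ lam γ h (toL2 φ)) +
          (T δ (toL2 φ) - toL2 φ - (δ : ℝ) • toL2 (limitGen κ lam γ φ)) := by
        rw [hBdef, add_apply, smul_apply, one_apply_eq_self]
        module
      rw [h3]
      refine norm_add_le_of_le ?_ ?_
      · rw [norm_smul, Real.norm_of_nonneg δ.coe_nonneg, norm_sub_rev, toL2_limitGen]
        gcongr
        exact norm_discGen_sub_genOf_le hκ hlam γ h _ _ _
      · refine (hT.norm_sub_sub_le (fun s hs => hC s (hs.trans hδ)) hC0 φ).trans ?_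
        gcongr
        exact norm_limitGen_limitGen_le hκ hlam hγ φ
    have h4 : ‖T (n * δ) (T δ (toL2 φ) - B (toL2 φ))‖ ≤
        C * (δ * err + δ * (δ * (C * genBoundSq κ lam γ φ))) :=
      ((T _).le_of_opNorm_le (hC _ hn') _).trans (by gcongr)
    have h5 := ih hn' (eulerStep κ lam γ h δ φ)
    have h6 : discErr κ lam h (toL2 (eulerStep κ lam γ h δ φ))
        (toL2 (LayerTestFn.d (eulerStep κ lam γ h δ φ)))
        (toL2 (LayerTestFn.d (LayerTestFn.d (eulerStep κ lam γ h δ φ)))) ≤ err := by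
      simp only [d_eulerStep, toL2_eulerStep]
      exact discErr_map_le hκ hlam hB hcomm _ _ _
    have h7 := genBoundSq_eulerStep_le hκ hlam hγ hB φ
    rw [h1]
    refine (norm_add_le_of_le h4 (h5.trans (b := _) (c := n *
      (C * (δ * err + δ * (δ * (C * genBoundSq κ lam γ φ))))) (by gcongr))).trans (le_of_eq ?_)
    push_cast
    ring

/-- Both semigroups are compared with one Euler scheme of time step `t / n`. The order of limits
matters: `n → ∞` at fixed spacing removes the time discretization error, and `h → 0` afterwards
removes the spatial one. -/
theorem IsSemigroupGeneratedBy.unique (hκ : 0 ≤ κ) (hlam : 0 ≤ lam) (hγ : 0 ≤ γ)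
    {T₁ T₂ : ℝ≥0 → LayerL2 →L[ℝ] LayerL2} (h₁ : IsSemigroupGeneratedBy κ lam γ T₁)
    (h₂ : IsSemigroupGeneratedBy κ lam γ T₂) : T₁ = T₂ := by
  funext t
  obtain ⟨C₁, hC₁, hb₁⟩ := h₁.exists_norm_le t
  obtain ⟨C₂, hC₂, hb₂⟩ := h₂.exists_norm_le t
  set C := max C₁ C₂
  have hC : 1 ≤ C := hC₁.trans (le_max_left _ _)
  refine DFunLike.coe_injective (denseRange_toL2.equalizer (T₁ t).continuous (T₂ t).continuous ?_)
  funext φ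
  set err := fun h => discErr κ lam h (toL2 φ) (toL2 (LayerTestFn.d φ))
    (toL2 (LayerTestFn.d (LayerTestFn.d φ))) with herr
  have hh : ∀ h : ℝ, 0 < h → ‖T₁ t (toL2 φ) - T₂ t (toL2 φ)‖ ≤ 2 * (C * (t * err h)) := by
    intro h hh
    have hlim : Tendsto (fun n : ℕ => 2 * (C * (t * err h + t * ((t / n : ℝ) *
        (C * genBoundSq κ lam γ φ))))) atTop (𝓝 (2 * (C * (t * err h)))) := by
      have h0 : Tendsto (fun n : ℕ => (t / n : ℝ)) atTop (𝓝 0) :=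
        tendsto_const_div_atTop_nhds_zero_nat _
      have := (((h0.mul_const (C * genBoundSq κ lam γ φ)).const_mul (t : ℝ)).const_add
        (t * err h)).const_mul C |>.const_mul 2
      simpa using this
    refine ge_of_tendsto hlim ?_
    -- The total jump rate at spacing `h`. The Euler step is a contraction once `(t / n) * c ≤ 1`,
    -- which holds for large `n` because `h` is fixed.
    set c := 2 * (κ / h ^ 2) + lam / h + γ
    have h0 : Tendsto (fun n : ℕ => (t * c) / n) atTop (𝓝 0) :=
      tendsto_const_div_atTop_nhds_zero_nat _
    filter_upwards [h0.eventually (Iio_mem_nhds one_pos), eventually_gt_atTop 0] with n hn hn0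
    have hn0' : (n : ℝ) ≠ 0 := by positivity
    have hnt : (n : ℝ≥0) * (t / n) = t := by
      rw [mul_div_cancel₀]; exact_mod_cast hn0.ne'
    have hB : ‖1 + ((t / n : ℝ≥0) : ℝ) • discGen κ lam γ h‖ ≤ 1 := by
      refine norm_one_add_smul_discGen_le_one hκ hlam hγ hh (by positivity) ?_
      have hn' : (t * c) / n < 1 := hn
      push_cast
      calc (t / n : ℝ) * c = t * c / n := by ring
        _ ≤ 1 := hn'.le
    have e₁ := h₁.norm_sub_euler_le hκ hlam hγ
      (fun s hs => (hb₁ s hs).trans (le_max_left C₁ C₂)) hC hB n hnt.le φ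
    have e₂ := h₂.norm_sub_euler_le hκ hlam hγ
      (fun s hs => (hb₂ s hs).trans (le_max_right C₁ C₂)) hC hB n hnt.le φ
    rw [hnt] at e₁ e₂
    rw [norm_sub_rev] at e₂
    have e₃ := norm_add_le_of_le e₁ e₂
    rw [sub_add_sub_cancel] at e₃
    refine e₃.trans (le_of_eq ?_)
    push_cast
    simp only [herr]
    field_simp
    ring
  have hlim : Tendsto (fun h => 2 * (C * (t * err h))) (𝓝[>] 0) (𝓝 0) := by
    simpa using (((tendsto_discErr κ lam φ).const_mul (t : ℝ)).const_mul C).const_mul 2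
  have h0 : ‖T₁ t (toL2 φ) - T₂ t (toL2 φ)‖ ≤ 0 := by
    refine ge_of_tendsto hlim ?_
    filter_upwards [self_mem_nhdsWithin] with h h'
    exact hh h h'
  exact sub_eq_zero.1 (norm_le_zero_iff.1 h0)

theorem existsUnique_isSemigroupGeneratedBy (hκ : 0 ≤ κ) (hlam : 0 ≤ lam) (hγ : 0 ≤ γ) :
    ∃! T, IsSemigroupGeneratedBy κ lam γ T := by
  obtain ⟨T, hT⟩ := exists_limitSemigroup hκ hlam hγ
  exact ⟨T, isSemigroup_of_tendsto hκ hlam hγ hT, fun T' hT' =>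
    hT'.unique hκ hlam hγ (isSemigroup_of_tendsto hκ hlam hγ hT)⟩

/-- The semigroup is the limit of the discrete ones. -/
theorem IsSemigroupGeneratedBy.tendsto (hκ : 0 ≤ κ) (hlam : 0 ≤ lam) (hγ : 0 ≤ γ)
    (hT : IsSemigroupGeneratedBy κ lam γ T) (t : ℝ≥0) (f : LayerL2) :
    Tendsto (fun h => expOp (discGen κ lam γ h) t f) (𝓝[>] 0) (𝓝 (T t f)) := by
  obtain ⟨T', hT'⟩ := exists_limitSemigroup hκ hlam hγ
  rw [hT.unique hκ hlam hγ (isSemigroup_of_tendsto hκ hlam hγ hT')]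
  exact hT' t f

end Uniqueness

/-! ### Lattice cells -/

section Lattice

/-- The indicator of the cell `[k / N, (k + 1) / N)` in `L²(ℝ)`. -/
def cellL2 (N : ℕ+) (k : ℤ) : Lp ℝ 2 (volume : Measure ℝ) :=
  indicatorConstLp 2 (measurableSet_Ico (a := (k : ℝ) / N) (b := ((k : ℝ) + 1) / N))
    (by simp) (1 : ℝ)

theorem transL2_cellL2 (N : ℕ+) (k j : ℤ) :
    transL2 (j * (1 / N : ℝ)) (cellL2 N k) = cellL2 N (k - j) := by
  have h1 : transL2 (j * (1 / N : ℝ)) (cellL2 N k) = indicatorConstLp 2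
      ((measurePreserving_add_right volume (j * (1 / N : ℝ))).measurable
        (measurableSet_Ico (a := (k : ℝ) / N) (b := ((k : ℝ) + 1) / N))) (by simp) (1 : ℝ) :=
    Lp.indicatorConstLp_compMeasurePreserving _ _ _ _
  rw [h1, cellL2]
  congr 1
  ext x
  simp only [Set.mem_preimage, Set.mem_Ico]
  push_cast
  have hN : (0 : ℝ) < N := by exact_mod_cast N.pos
  constructor <;> rintro ⟨h2, h3⟩ <;> constructor <;> field_simp at * <;> linarith

theorem inner_cellL2 (N : ℕ+) (k l : ℤ) :
    ⟪cellL2 N k, cellL2 N l⟫ = if k = l then (N : ℝ)⁻¹ else 0 := by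
  have hN : (0 : ℝ) < N := by exact_mod_cast N.pos
  rw [cellL2, cellL2, L2.real_inner_indicatorConstLp_one_indicatorConstLp_one _ _ (by simp)
    (by simp)]
  split_ifs with h
  · subst h
    rw [Set.inter_self, Real.volume_real_Ico_of_le (by gcongr; linarith)]
    ring
  · have h1 : Set.Ico ((k : ℝ) / N) ((k + 1) / N) ∩ Set.Ico ((l : ℝ) / N) ((l + 1) / N) = ∅ := by
      ext x
      simp only [Set.mem_inter_iff, Set.mem_Ico, Set.mem_empty_iff_false, iff_false, not_and,
        div_le_iff₀ hN, lt_div_iff₀ hN]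
      rintro ⟨h2, h3⟩ h4 h5
      apply h
      have h6 : (k : ℝ) < l + 1 := by linarith
      have h7 : (l : ℝ) < k + 1 := by linarith
      have h6' : k < l + 1 := by exact_mod_cast h6
      have h7' : l < k + 1 := by exact_mod_cast h7
      omega
    simp [h1]

/-- The indicator of a site, as a function on `ℝ × S`. -/
def cell (N : ℕ+) (u : Site) : LayerL2 := WithLp.toLp 2 (Pi.single u.2 (cellL2 N u.1))

theorem cell_apply (N : ℕ+) (u : Site) (σ : Layer) :
    cell N u σ = if σ = u.2 then cellL2 N u.1 else 0 := by
  simp [cell]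

theorem layerMove_cell (N : ℕ+) (j : Layer → ℤ) (ε : Layer) (u : Site) :
    layerMove (fun σ => j σ * (1 / N : ℝ)) ε (cell N u) =
      cell N (u.1 - j (ε * u.2), ε * u.2) := by
  ext1 σ
  rw [layerMove_apply, cell_apply, cell_apply]
  have h1 : ε * σ = u.2 ↔ σ = ε * u.2 := by
    constructor <;> rintro h <;> [rw [← h]; rw [h]] <;> rw [← mul_assoc, Int.units_mul_self, one_mul]
  by_cases h : σ = ε * u.2
  · rw [if_pos (h1.2 h), if_pos h, transL2_cellL2, h]
  · rw [if_neg (fun h' => h (h1.1 h')), if_neg h, map_zero]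

theorem inner_cell (N : ℕ+) (u v : Site) :
    ⟪cell N u, cell N v⟫ = if u = v then (N : ℝ)⁻¹ else 0 := by
  rw [PiLp.inner_apply, Finset.sum_eq_single u.2]
  · rw [cell_apply, cell_apply, if_pos rfl]
    by_cases h : u.2 = v.2
    · rw [if_pos h, inner_cellL2]
      simp [Prod.ext_iff, h]
    · rw [if_neg h, inner_zero_right, if_neg]
      rintro rfl
      exact h rfl
  · intro σ _ hσ
    rw [cell_apply, if_neg hσ, inner_zero_left]
  · exact fun hσ => absurd (Finset.mem_univ u.2) hσ

theorem inner_moveOp_cell (N : ℕ+) (j : Layer → ℤ) (ε : Layer) (f : LayerL2) (u : Site) :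
    ⟪moveOp (fun σ => j σ * (1 / N : ℝ)) ε f, cell N u⟫ = ⟪f, cell N (u.1 + j u.2, ε * u.2)⟫ := by
  rw [moveOp_apply, inner_layerMove]
  have h1 := layerMove_cell N (fun σ => -j (ε * σ)) ε u
  rw [← mul_assoc, Int.units_mul_self, one_mul, sub_neg_eq_add] at h1
  rw [← h1]
  simp

/-- A move by multiples of `1 / N` permutes the cells, so its adjoint acts on cell indicators as a
jump of the particle. This links the continuum operators to the lattice. -/
theorem inner_discGen_cell (κ lam γ : ℝ) (N : ℕ+) (f : LayerL2) (u : Site) :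
    ⟪discGen κ lam γ (1 / N) f, cell N u⟫ = walkGen κ lam γ N (fun v => ⟪f, cell N v⟫) u := by
  have h1 := inner_moveOp_cell N (fun _ => 1) 1 f u
  have h2 := inner_moveOp_cell N (fun _ => -1) 1 f u
  have h3 := inner_moveOp_cell N (fun σ => (σ : ℤ)) 1 f u
  have h4 := inner_moveOp_cell N (fun _ => 0) (-1) f u
  simp only [Int.cast_one, one_mul, Int.cast_neg, neg_mul, Int.cast_zero, zero_mul] at h1 h2 h3 h4
  have h4' : ⟪flipOp f, cell N u⟫ = ⟪f, cell N (u.1, -u.2)⟫ := by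
    rw [add_zero] at h4; exact h4
  simp only [discGen, secondDiff, diffQuot, add_apply, smul_apply, sub_apply, inner_add_left,
    real_inner_smul_left, inner_sub_left, one_apply_eq_self, layerSign, h1, h2, h3, h4', walkGen]
  simp only [one_div, inv_pow, inv_inv]
  ring_nf

theorem abs_walkGen_le {κ lam γ : ℝ} (hκ : 0 ≤ κ) (hlam : 0 ≤ lam) (hγ : 0 ≤ γ) (N : ℕ+)
    {f : Site → ℝ} {C : ℝ} (hf : ∀ v, |f v| ≤ C) (u : Site) :
    |walkGen κ lam γ N f u| ≤ (κ * (N : ℝ) ^ 2 * 4 + lam * N * 2 + γ * 2) * C := by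
  have h1 := fun v => abs_le.1 (hf v)
  have hN : (0 : ℝ) < N := by exact_mod_cast N.pos
  have h2 : ∀ v, |f v - f u| ≤ 2 * C := fun v => by
    rw [abs_le]; constructor <;> linarith [(h1 v).1, (h1 v).2, (h1 u).1, (h1 u).2]
  have h3 : |f (u.1 + 1, u.2) + f (u.1 - 1, u.2) - 2 * f u| ≤ 4 * C := by
    have h4 := abs_le.1 (h2 (u.1 + 1, u.2))
    have h5 := abs_le.1 (h2 (u.1 - 1, u.2))
    rw [abs_le]; constructor <;> linarith
  rw [walkGen]
  refine (abs_add_three _ _ _).trans ?_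
  rw [abs_mul (κ * _), abs_mul (lam * _), abs_mul γ,
    abs_of_nonneg (by positivity : 0 ≤ κ * (N : ℝ) ^ 2),
    abs_of_nonneg (by positivity : 0 ≤ lam * (N : ℝ)), abs_of_nonneg hγ]
  calc _ ≤ κ * (N : ℝ) ^ 2 * (4 * C) + lam * N * (2 * C) + γ * (2 * C) := by
        gcongr <;> first | exact h3 | exact h2 _
    _ = _ := by ring

/-- Bounded solutions of the backward equation vanish if they vanish at time `0`. -/
theorem eq_zero_of_backward {κ lam γ : ℝ} (hκ : 0 ≤ κ) (hlam : 0 ≤ lam) (hγ : 0 ≤ γ) (N : ℕ+)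
    {z : ℝ → Site → ℝ} {C : ℝ} (hz : ∀ s, 0 ≤ s → ∀ u,
      HasDerivWithinAt (fun s => z s u) (walkGen κ lam γ N (z s) u) (Set.Ici 0) s)
    (hC : ∀ s u, 0 ≤ s → |z s u| ≤ C) (h0 : ∀ u, z 0 u = 0) (t : ℝ) (ht : 0 ≤ t) (u : Site) :
    z t u = 0 := by
  set c := κ * (N : ℝ) ^ 2 * 4 + lam * N * 2 + γ * 2 with hc
  -- On functions bounded by `C` the generator is bounded by `c * C`. Feeding a bound back into the
  -- equation and integrating gains one term of the exponential series each time, and these terms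
  -- tend to `0`.
  have key : ∀ n : ℕ, ∀ s u, 0 ≤ s → |z s u| ≤ C * ((c * s) ^ n / n.factorial) := by
    intro n
    induction n with
    | zero => simpa using hC
    | succ n ih =>
      intro s u hs
      have hB : ∀ r, HasDerivAt (fun r => C * ((c * r) ^ (n + 1) / (n + 1).factorial))
          (c * (C * ((c * r) ^ n / n.factorial))) r := by
        intro r
        have h1 := ((((hasDerivAt_id r).const_mul c).pow (n + 1)).div_const
          ((n + 1).factorial : ℝ)).const_mul C
        refine h1.congr_deriv ?_
        have h2 : ((n + 1).factorial : ℝ) = (n + 1) * n.factorial := by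
          exact_mod_cast Nat.factorial_succ n
        rw [h2]
        have h3 : (n.factorial : ℝ) ≠ 0 := by exact_mod_cast n.factorial_ne_zero
        have h4 : (n + 1 : ℝ) ≠ 0 := by positivity
        simp only [id, Nat.add_sub_cancel, Nat.cast_add, Nat.cast_one, mul_one]
        field_simp
      have := image_norm_le_of_norm_deriv_right_le_deriv_boundary (f := fun s => z s u)
        (a := 0) (b := s) (fun r hr => ((hz r hr.1 u).mono Set.Icc_subset_Ici_self).continuousWithinAt)
        (fun r hr => (hz r hr.1 u).mono (Set.Ici_subset_Ici.2 hr.1)) (by simp [h0]) hB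
        (fun r hr => abs_walkGen_le hκ hlam hγ N (fun v => ih r v hr.1) u)
      exact this ⟨hs, le_rfl⟩
  have hlim : Tendsto (fun n : ℕ => C * ((c * t) ^ n / n.factorial)) atTop (𝓝 0) := by
    simpa using (FloorSemiring.tendsto_pow_div_factorial_atTop (c * t)).const_mul C
  exact abs_nonpos_iff.1 (ge_of_tendsto hlim (Eventually.of_forall fun n => key n t u ht))

/-! ### Transition probabilities as matrix elements, and time reversal -/

variable {κ lam γ : ℝ} {N : ℕ+} {p : ℝ≥0 → Site → Site → ℝ}

theorem IsTransitionFunction.le_one {L : (Site → ℝ) → Site → ℝ} (hp : IsTransitionFunction L p)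
    (t : ℝ≥0) (u v : Site) : p t u v ≤ 1 :=
  le_hasSum (hp.hasSum_one t u) v fun w _ => hp.nonneg t u w

/-- For fixed `v`, both sides are bounded solutions of the backward equation with the same initial
value. The factor `N` normalizes the cells, whose squared norm is `1 / N`. -/
theorem IsTransitionFunction.eq_inner (hκ : 0 ≤ κ) (hlam : 0 ≤ lam) (hγ : 0 ≤ γ)
    (hp : IsTransitionFunction (walkGen κ lam γ N) p) (t : ℝ≥0) (u v : Site) :
    p t u v = N * ⟪expOp (discGen κ lam γ (1 / N)) t (cell N v), cell N u⟫ := by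
  have hN : (0 : ℝ) < N := by exact_mod_cast N.pos
  have hlin : ∀ (f g : Site → ℝ) (u : Site), walkGen κ lam γ N (fun w => f w - N * g w) u =
      walkGen κ lam γ N f u - N * walkGen κ lam γ N g u := by
    intro f g u
    simp only [walkGen]
    ring
  have h := eq_zero_of_backward hκ hlam hγ N (C := 1 + N * (‖cell N v‖ * (N : ℝ)⁻¹ + ‖cell N v‖))
    (z := fun s u => p s.toNNReal u v -
      N * ⟪expOp (discGen κ lam γ (1 / N)) s (cell N v), cell N u⟫) ?_ ?_ ?_ t t.2 u
  · simpa [sub_eq_zero] using h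
  · intro s hs u
    have h1 := hp.backward s.toNNReal u v
    rw [Real.coe_toNNReal _ hs] at h1
    have h2 : HasDerivAt (fun s => ⟪expOp (discGen κ lam γ (1 / N)) s (cell N v), cell N u⟫)
        (walkGen κ lam γ N
          (fun w => ⟪expOp (discGen κ lam γ (1 / N)) s (cell N v), cell N w⟫) u) s := by
      have h3 := ((hasDerivAt_expOp' (discGen κ lam γ (1 / N)) s).clm_apply
        (hasDerivAt_const s (cell N v))).inner ℝ (hasDerivAt_const s (cell N u))
      refine h3.congr_deriv ?_
      rw [← inner_discGen_cell]
      simp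
    rw [hlin]
    exact h1.sub (h2.const_mul _).hasDerivWithinAt
  · intro s u hs
    have hcell : ‖cell N u‖ ^ 2 = (N : ℝ)⁻¹ := by
      rw [← real_inner_self_eq_norm_sq, inner_cell, if_pos rfl]
    have h1 : |p s.toNNReal u v| ≤ 1 := by
      rw [abs_of_nonneg (hp.nonneg _ _ _)]; exact hp.le_one _ _ _
    have h2 := abs_real_inner_le_norm (expOp (discGen κ lam γ (1 / N)) s (cell N v)) (cell N u)
    have h3 := norm_apply_le_of_norm_le_one (norm_expOp_discGen_le_one hκ hlam hγ
      (by positivity : (0 : ℝ) < 1 / N) hs) (cell N v)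
    refine (abs_sub _ _).trans (add_le_add h1 ?_)
    rw [abs_mul, abs_of_pos hN]
    gcongr
    refine h2.trans ((mul_le_mul_of_nonneg_right h3 (norm_nonneg _)).trans ?_)
    rw [← hcell]
    nlinarith [norm_nonneg (cell N v), norm_nonneg (cell N u), sq_nonneg (‖cell N u‖ - 1)]
  · intro u
    simp only [Real.toNNReal_zero, hp.zero, expOp_zero, one_apply_eq_self, inner_cell]
    by_cases h : u = v
    · subst h; simp
    · rw [if_neg h, if_neg (Ne.symm h)]; simp

theorem adjoint_expOp_discGen (κ lam γ h t : ℝ) :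
    ContinuousLinearMap.adjoint (expOp (discGen κ lam γ h) t) =
      flipOp * expOp (discGen κ lam γ h) t * flipOp := by
  let _ : NormedAlgebra ℚ (LayerL2 →L[ℝ] LayerL2) := NormedAlgebra.restrictScalars ℚ ℝ _
  let U : (LayerL2 →L[ℝ] LayerL2)ˣ := ⟨flipOp, flipOp, flipOp_mul_flipOp, flipOp_mul_flipOp⟩
  have h1 := NormedSpace.exp_units_conj U (t • discGen κ lam γ h)
  have h2 := NormedSpace.star_exp (t • discGen κ lam γ h)
  rw [ContinuousLinearMap.star_eq_adjoint, ContinuousLinearMap.star_eq_adjoint] at h2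
  have h3 : ContinuousLinearMap.adjoint (t • discGen κ lam γ h) =
      (U : LayerL2 →L[ℝ] LayerL2) * (t • discGen κ lam γ h) * (U⁻¹ : (LayerL2 →L[ℝ] LayerL2)ˣ) := by
    rw [LinearIsometryEquiv.map_smulₛₗ, adjoint_discGen, conj_trivial]
    change _ = flipOp * (t • discGen κ lam γ h) * flipOp
    rw [mul_smul_comm, smul_mul_assoc]
  rw [expOp, h2, h3, h1]
  rfl

theorem flipOp_cell (N : ℕ+) (u : Site) : flipOp (cell N u) = cell N (u.1, -u.2) := by
  have h := layerMove_cell N (fun _ => 0) (-1) u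
  simp only [Int.cast_zero, zero_mul, sub_zero, neg_mul, one_mul] at h
  exact h

/-- Time reversal: the adjoint of the discrete semigroup is its conjugate by the flip, read off on
cells. -/
theorem IsTransitionFunction.reverse (hκ : 0 ≤ κ) (hlam : 0 ≤ lam) (hγ : 0 ≤ γ)
    (hp : IsTransitionFunction (walkGen κ lam γ N) p) (t : ℝ≥0) (u v : Site) :
    p t u v = p t (v.1, -v.2) (u.1, -u.2) := by
  rw [hp.eq_inner hκ hlam hγ, hp.eq_inner hκ hlam hγ, ← ContinuousLinearMap.adjoint_inner_right,
    adjoint_expOp_discGen, real_inner_comm, ← flipOp_cell, ← flipOp_cell]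
  congr 1
  change ⟪layerMove 0 (-1) _, _⟫ = _
  rw [inner_layerMove]
  congr 1
  rw [moveOp_apply]
  congr 2
  ext; simp

/-- Reversal turns column sums into row sums. This is the invariance of counting measure on `Site`.
-/
theorem IsTransitionFunction.hasSum_left (hκ : 0 ≤ κ) (hlam : 0 ≤ lam) (hγ : 0 ≤ γ)
    (hp : IsTransitionFunction (walkGen κ lam γ N) p) (t : ℝ≥0) (v : Site) :
    HasSum (fun u => p t u v) 1 := by
  let e : Site ≃ Site := Equiv.prodCongr (Equiv.refl ℤ) (Equiv.neg Layer)
  have h := (e.hasSum_iff).2 (hp.hasSum_one t (v.1, -v.2))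
  refine h.congr_fun ?_
  intro u
  exact hp.reverse hκ hlam hγ t u v

end Lattice

/-! ### Lattice approximation of the limiting covariances -/

section LatticeCovariance

theorem finite_latticeSupport (N : ℕ+) (φ : TestFn) : {k : ℤ | φ ((k : ℝ) / N) ≠ 0}.Finite := by
  obtain ⟨R, -, hR⟩ := φ.exists_support
  have hN : (0 : ℝ) < N := by exact_mod_cast N.pos
  refine (Set.finite_Icc (-⌈R * N⌉) ⌈R * N⌉).subset fun k hk => ?_
  have h1 : |(k : ℝ) / N| ≤ R := by
    by_contra h
    exact hk (hR _ (not_le.1 h))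
  rw [abs_div, abs_of_pos hN, div_le_iff₀ hN] at h1
  have h2 : ((|k| : ℤ) : ℝ) ≤ ⌈R * N⌉ := by
    rw [Int.cast_abs]; exact h1.trans (Int.le_ceil _)
  exact abs_le.1 (by exact_mod_cast h2)

/-- The lattice points `k` with `φ (k / N) ≠ 0`. -/
def latticeSupport (N : ℕ+) (φ : TestFn) : Finset ℤ := (finite_latticeSupport N φ).toFinset

theorem mem_latticeSupport {N : ℕ+} {φ : TestFn} {k : ℤ} :
    k ∈ latticeSupport N φ ↔ φ ((k : ℝ) / N) ≠ 0 := by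
  simp [latticeSupport]

/-- The sites on which `φ` does not vanish. -/
def siteSupport (N : ℕ+) (φ : TestFn) : Finset Site := latticeSupport N φ ×ˢ Finset.univ

theorem mem_siteSupport {N : ℕ+} {φ : TestFn} {v : Site} :
    v ∈ siteSupport N φ ↔ φ ((v.1 : ℝ) / N) ≠ 0 := by
  rw [siteSupport, Finset.mem_product, mem_latticeSupport]
  exact and_iff_left (Finset.mem_univ _)

theorem eq_zero_of_notMem_siteSupport {N : ℕ+} {φ : TestFn} {v : Site}
    (hv : v ∉ siteSupport N φ) : φ ((v.1 : ℝ) / N) = 0 := by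
  rwa [mem_siteSupport, not_not] at hv

/-- The step function approximation of a test function. -/
def stepL2 (N : ℕ+) (φ : TestFn) : Lp ℝ 2 (volume : Measure ℝ) :=
  ∑ k ∈ latticeSupport N φ, φ ((k : ℝ) / N) • cellL2 N k

theorem coeFn_stepL2 (N : ℕ+) (φ : TestFn) :
    stepL2 N φ =ᵐ[volume] fun x => φ ((⌊(N : ℝ) * x⌋ : ℝ) / N) := by
  have hN : (0 : ℝ) < N := by exact_mod_cast N.pos
  have h1 : ∀ k : ℤ, ∀ᵐ x ∂(volume : Measure ℝ), (φ ((k : ℝ) / N) • cellL2 N k :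
      Lp ℝ 2 (volume : Measure ℝ)) x = φ ((k : ℝ) / N) *
        (Set.Ico ((k : ℝ) / N) (((k : ℝ) + 1) / N)).indicator (fun _ => 1) x := by
    intro k
    filter_upwards [Lp.coeFn_smul (φ ((k : ℝ) / N)) (cellL2 N k),
      indicatorConstLp_coeFn (p := 2) (hs := measurableSet_Ico (a := (k : ℝ) / N)
        (b := ((k : ℝ) + 1) / N)) (hμs := by simp) (c := (1 : ℝ)) (μ := volume)] with x h1 h2
    rw [h1, Pi.smul_apply, smul_eq_mul, cellL2, h2]
  filter_upwards [Lp.coeFn_finsetSum (latticeSupport N φ)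
    (fun k : ℤ => (φ ((k : ℝ) / N) • cellL2 N k : Lp ℝ 2 (volume : Measure ℝ))),
    ae_all_iff.2 h1] with x h2 h3
  rw [stepL2, h2, Finset.sum_apply]
  simp only [h3]
  have h4 : ∀ k : ℤ, x ∈ Set.Ico ((k : ℝ) / N) (((k : ℝ) + 1) / N) ↔ ⌊(N : ℝ) * x⌋ = k := by
    intro k
    rw [Int.floor_eq_iff, Set.mem_Ico, div_le_iff₀ hN, lt_div_iff₀ hN, mul_comm x]
  rw [Finset.sum_eq_single ⌊(N : ℝ) * x⌋]
  · rw [Set.indicator_of_mem ((h4 _).2 rfl), mul_one]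
  · intro k _ hk
    rw [Set.indicator_of_notMem, mul_zero]
    exact fun h => hk ((h4 k).1 h).symm
  · intro h
    rw [mem_latticeSupport, not_not] at h
    rw [h, zero_mul]

theorem tendsto_stepL2 (φ : TestFn) :
    Tendsto (fun N : ℕ+ => stepL2 N φ) atTop (𝓝 (testL2 φ)) := by
  obtain ⟨C, hC0, hC⟩ := φ.abs_sub_le
  obtain ⟨R, hR0, hR⟩ := φ.exists_support
  have hb : ∀ N : ℕ+, ‖stepL2 N φ - testL2 φ‖ ≤ C * (1 / N) * √(2 * (R + 1)) := by
    intro N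
    have hN : (0 : ℝ) < N := by exact_mod_cast N.pos
    have hN1 : (1 : ℝ) / N ≤ 1 := by
      rw [div_le_one hN]; exact_mod_cast (one_le : 1 ≤ N)
    have hfl : ∀ x : ℝ, |(⌊(N : ℝ) * x⌋ : ℝ) / N - x| ≤ 1 / N := by
      intro x
      have h1 := Int.floor_le ((N : ℝ) * x)
      have h2 := Int.lt_floor_add_one ((N : ℝ) * x)
      rw [show (⌊(N : ℝ) * x⌋ : ℝ) / N - x = (⌊(N : ℝ) * x⌋ - N * x) / N by field_simp,
        abs_div, abs_of_pos hN]
      gcongr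
      rw [abs_le]
      constructor <;> linarith
    have hae : (stepL2 N φ - testL2 φ : Lp ℝ 2 (volume : Measure ℝ)) =ᵐ[volume]
        fun x => φ ((⌊(N : ℝ) * x⌋ : ℝ) / N) - φ x := by
      filter_upwards [Lp.coeFn_sub (stepL2 N φ) (testL2 φ), coeFn_stepL2 N φ,
        (φ.continuous.memLp_of_hasCompactSupport (μ := volume) (p := 2)
          φ.hasCompactSupport).coeFn_toLp] with x h1 h2 h3
      rw [h1, Pi.sub_apply, h2, testL2, h3]
    have hmem := (memLp_congr_ae hae).1 (Lp.memLp _)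
    have heq : stepL2 N φ - testL2 φ = hmem.toLp _ := by
      refine Lp.ext (hae.trans hmem.coeFn_toLp.symm)
    rw [heq]
    refine norm_toLp_le_of_bound hmem (by positivity) (fun x => ?_) fun x hx => ?_
    · exact (hC x _).trans (by gcongr; exact hfl x)
    · have h1 : |x| ≤ |(⌊(N : ℝ) * x⌋ : ℝ) / N| + |(⌊(N : ℝ) * x⌋ : ℝ) / N - x| := by
        simpa using abs_sub ((⌊(N : ℝ) * x⌋ : ℝ) / N) ((⌊(N : ℝ) * x⌋ : ℝ) / N - x)
      have h2 := hfl x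
      rw [hR x (by linarith), hR _ (by linarith), sub_zero]
  rw [tendsto_iff_norm_sub_tendsto_zero]
  refine squeeze_zero (fun _ => norm_nonneg _) hb ?_
  have h1 : Tendsto (fun N : ℕ+ => (1 : ℝ) / (N : ℝ)) atTop (𝓝 0) :=
    tendsto_one_div_atTop_nhds_zero_nat.comp tendsto_PNat_val_atTop_atTop
  simpa using (h1.const_mul C).mul_const (√(2 * (R + 1)))

/-- The step function approximation of a layer-constant test function. -/
def stepLayer (N : ℕ+) (φ : TestFn) : LayerL2 :=
  ∑ v ∈ siteSupport N φ, φ ((v.1 : ℝ) / N) • cell N v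

theorem stepLayer_apply (N : ℕ+) (φ : TestFn) (σ : Layer) : stepLayer N φ σ = stepL2 N φ := by
  rw [stepLayer, siteSupport, Finset.sum_product, WithLp.ofLp_sum, Finset.sum_apply, stepL2]
  refine Finset.sum_congr rfl fun k _ => ?_
  rw [WithLp.ofLp_sum, Finset.sum_apply, Finset.sum_eq_single σ]
  · rw [PiLp.smul_apply, cell_apply, if_pos rfl]
  · intro τ _ hτ
    rw [PiLp.smul_apply, cell_apply, if_neg (Ne.symm hτ), smul_zero]
  · exact fun h => absurd (Finset.mem_univ σ) h

theorem tendsto_stepLayer (φ : TestFn) :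
    Tendsto (fun N : ℕ+ => stepLayer N φ) atTop (𝓝 (toL2 (layerConst φ))) := by
  have h1 := (PiLp.continuous_toLp 2 (fun _ : Layer => Lp ℝ 2 (volume : Measure ℝ))).tendsto
    (fun σ => toL2 (layerConst φ) σ) |>.comp
      (tendsto_pi_nhds.2 fun σ : Layer => tendsto_stepL2 φ)
  refine h1.congr fun N => ?_
  ext1 σ
  rw [stepLayer_apply]
  rfl

theorem tendsto_one_div_pnat : Tendsto (fun N : ℕ+ => (1 : ℝ) / (N : ℝ)) atTop (𝓝[>] 0) := by
  refine tendsto_nhdsWithin_iff.2 ⟨tendsto_one_div_atTop_nhds_zero_nat.comp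
    tendsto_PNat_val_atTop_atTop, Eventually.of_forall fun N => ?_⟩
  have hN : (0 : ℝ) < N := by exact_mod_cast N.pos
  exact one_div_pos.2 hN

/-- The covariance of the lattice fields at two times with difference `t`, up to the factor `ρ`. -/
def latticeCov (N : ℕ+) (p : ℝ≥0 → Site → Site → ℝ) (t : ℝ≥0) (φ ψ : TestFn) : ℝ :=
  (N : ℝ)⁻¹ * ∑ v ∈ siteSupport N ψ, ∑ w ∈ siteSupport N φ,
    ψ ((v.1 : ℝ) / N) * φ ((w.1 : ℝ) / N) * p t v w

variable {κ lam γ : ℝ}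

theorem latticeCov_eq_inner (hκ : 0 ≤ κ) (hlam : 0 ≤ lam) (hγ : 0 ≤ γ) {N : ℕ+}
    {p : ℝ≥0 → Site → Site → ℝ} (hp : IsTransitionFunction (walkGen κ lam γ N) p) (t : ℝ≥0)
    (φ ψ : TestFn) :
    latticeCov N p t φ ψ =
      ⟪expOp (discGen κ lam γ (1 / N)) t (stepLayer N φ), stepLayer N ψ⟫ := by
  have hN : (0 : ℝ) < N := by exact_mod_cast N.pos
  rw [latticeCov, stepLayer, stepLayer, map_sum, inner_sum, Finset.mul_sum]
  refine Finset.sum_congr rfl fun v _ => ?_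
  rw [sum_inner, Finset.mul_sum]
  refine Finset.sum_congr rfl fun w _ => ?_
  rw [map_smul, real_inner_smul_left, real_inner_smul_right, hp.eq_inner hκ hlam hγ]
  field_simp

/-- Contractivity, uniform in `N`, separates replacing the step functions by their limits from the
convergence of the semigroups. -/
theorem tendsto_latticeCov (hκ : 0 ≤ κ) (hlam : 0 ≤ lam) (hγ : 0 ≤ γ)
    {T : ℝ≥0 → LayerL2 →L[ℝ] LayerL2} (hT : IsSemigroupGeneratedBy κ lam γ T)
    {p : ℕ+ → ℝ≥0 → Site → Site → ℝ}
    (hp : ∀ N, IsTransitionFunction (walkGen κ lam γ N) (p N)) (t : ℝ≥0) (φ ψ : TestFn) :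
    Tendsto (fun N => latticeCov N (p N) t φ ψ) atTop
      (𝓝 ⟪T t (toL2 (layerConst φ)), toL2 (layerConst ψ)⟫) := by
  simp_rw [fun N => latticeCov_eq_inner hκ hlam hγ (hp N) t φ ψ]
  refine Tendsto.inner ?_ (tendsto_stepLayer ψ)
  have h1 := (hT.tendsto hκ hlam hγ t (toL2 (layerConst φ))).comp tendsto_one_div_pnat
  have h2 : Tendsto (fun N : ℕ+ => expOp (discGen κ lam γ (1 / N)) t
      (stepLayer N φ - toL2 (layerConst φ))) atTop (𝓝 0) := by
    refine squeeze_zero_norm (fun N => ?_)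
      (tendsto_iff_norm_sub_tendsto_zero.1 (tendsto_stepLayer φ))
    have hN : (0 : ℝ) < N := by exact_mod_cast N.pos
    exact norm_apply_le_of_norm_le_one
      (norm_expOp_discGen_le_one hκ hlam hγ (one_div_pos.2 hN) t.2) _
  have h3 := h2.add h1
  rw [zero_add] at h3
  refine h3.congr fun N => ?_
  simp

end LatticeCovariance

/-! ### Laws of one particle -/

section OneParticle

instance : MeasurableSingletonClass Layer where
  measurableSet_singleton ε :=
    ⟨{(ε : ℤ)}, measurableSet_singleton _, by ext σ; simp [Units.ext_iff]⟩

variable {Ω : Type*} [MeasurableSpace Ω] {P : Measure Ω} [IsProbabilityMeasure P]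

theorem integral_comp_eq_sum {β : Type*} [MeasurableSpace β] [MeasurableSingletonClass β]
    {Y : Ω → β} (hY : Measurable Y) {g : β → ℝ} {S : Finset β} (hg : ∀ b, b ∉ S → g b = 0) :
    ∫ ω, g (Y ω) ∂P = ∑ b ∈ S, g b * P.real {ω | Y ω = b} := by
  classical
  have h1 : ∀ ω, g (Y ω) = ∑ b ∈ S, {ω | Y ω = b}.indicator (fun _ => g b) ω := by
    intro ω
    by_cases h : Y ω ∈ S
    · rw [Finset.sum_eq_single (Y ω)]
      · simp
      · intro b _ hb
        exact Set.indicator_of_notMem (fun h' => hb h'.symm) _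
      · exact fun h' => absurd h h'
    · rw [hg _ h, Finset.sum_eq_zero]
      intro b hb
      refine Set.indicator_of_notMem (fun h' => h ?_) _
      have h'' : Y ω = b := h'
      rwa [h'']
  have hm : ∀ b, MeasurableSet {ω | Y ω = b} := fun b => hY (measurableSet_singleton b)
  simp_rw [h1]
  rw [integral_finsetSum _ fun b _ => (integrable_const _).indicator (hm b)]
  refine Finset.sum_congr rfl fun b _ => ?_
  rw [integral_indicator_const _ (hm b), smul_eq_mul, mul_comm]

variable {p : ℝ≥0 → Site → Site → ℝ} {L : (Site → ℝ) → Site → ℝ} {u : Site}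
  {X Y : ℝ≥0 → Ω → Site}

theorem IsMarkovChain.measureReal_eq (hp : IsTransitionFunction L p) (hX : IsMarkovChain p u P X)
    (t : ℝ≥0) (v : Site) : P.real {ω | X t ω = v} = p t u v := by
  have h := hX.fdd 0 (fun _ => t) monotone_const (fun _ => v)
  simp only [forall_const, Finset.univ_eq_empty, Finset.prod_empty, mul_one] at h
  rw [measureReal_def, h, ENNReal.toReal_ofReal (hp.nonneg _ _ _)]

theorem IsMarkovChain.measureReal_pair_eq (hp : IsTransitionFunction L p)
    (hX : IsMarkovChain p u P X) {s t : ℝ≥0} (hst : s ≤ t) (v w : Site) :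
    P.real {ω | (X s ω, X t ω) = (v, w)} = p s u v * p (t - s) v w := by
  have h := hX.fdd 1 ![s, t] (by
    intro i j hij
    fin_cases i <;> fin_cases j <;> simp_all) ![v, w]
  have h1 : {ω | ∀ i : Fin (1 + 1), X (![s, t] i) ω = ![v, w] i} =
      {ω | (X s ω, X t ω) = (v, w)} := by
    ext ω
    exact Fin.forall_fin_two.trans Prod.mk_inj.symm
  rw [measureReal_def, ← h1, h, Fin.prod_univ_one, ENNReal.toReal_ofReal]
  · rfl
  · exact mul_nonneg (hp.nonneg _ _ _) (hp.nonneg _ _ _)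

/-- The law of the chain at finitely many times is determined by the transition function. -/
theorem IsMarkovChain.map_eq (hX : IsMarkovChain p u P X) (hY : IsMarkovChain p u P Y) {n : ℕ}
    (t : Fin n → ℝ≥0) : P.map (fun ω i => X (t i) ω) = P.map (fun ω i => Y (t i) ω) := by
  rcases n with _ | n
  · congr 1
    funext ω i
    exact i.elim0
  have key : ∀ s : Fin (n + 1) → ℝ≥0, Monotone s →
      P.map (fun ω i => X (s i) ω) = P.map (fun ω i => Y (s i) ω) := by
    intro s hs
    refine Measure.ext_of_singleton fun v => ?_
    rw [Measure.map_apply (measurable_pi_lambda _ fun i => hX.measurable _)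
      (measurableSet_singleton v), Measure.map_apply (measurable_pi_lambda _ fun i =>
      hY.measurable _) (measurableSet_singleton v)]
    have h1 : ∀ Z : ℝ≥0 → Ω → Site, (fun ω i => Z (s i) ω) ⁻¹' {v} =
        {ω | ∀ i, Z (s i) ω = v i} := fun Z => by ext ω; simp [funext_iff]
    rw [h1, h1, hX.fdd n s hs v, hY.fdd n s hs v]
  -- The definition of a Markov chain prescribes the law at increasing times only, so arbitrary
  -- times are sorted and the coordinates permuted back.
  set σ := Tuple.sort t with hσ
  have h := key (t ∘ σ) (Tuple.monotone_sort t)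
  have hm : Measurable fun (x : Fin (n + 1) → Site) i => x (σ.symm i) :=
    measurable_pi_lambda _ fun i => measurable_pi_apply _
  have h2 : ∀ Z : ℝ≥0 → Ω → Site, (∀ t, Measurable (Z t)) → P.map (fun ω i => Z (t i) ω) =
      (P.map (fun ω i => Z ((t ∘ σ) i) ω)).map fun x i => x (σ.symm i) := by
    intro Z hZ
    rw [Measure.map_map hm (measurable_pi_lambda _ fun i => hZ _)]
    congr 1
    funext ω i
    simp [Function.comp]
  rw [h2 X hX.measurable, h2 Y hY.measurable, h]

/-- Reading off a function on the sites at scale `N`. -/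
def siteFn (N : ℕ+) (φ : TestFn) (v : Site) : ℝ := φ ((v.1 : ℝ) / N)

theorem siteFn_eq_zero {N : ℕ+} {φ : TestFn} {v : Site} (hv : v ∉ siteSupport N φ) :
    siteFn N φ v = 0 := eq_zero_of_notMem_siteSupport hv

variable {κ lam γ : ℝ} {N : ℕ+} {X : Site → ℝ≥0 → Ω → Site}

/-- Summing over all starting sites uses column sums equal to `1`. The result does not depend on
`t`, which is why the mean density is preserved. -/
theorem hasSum_integral_siteFn (hκ : 0 ≤ κ) (hlam : 0 ≤ lam) (hγ : 0 ≤ γ)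
    (hp : IsTransitionFunction (walkGen κ lam γ N) p) (hX : ∀ u, IsMarkovChain p u P (X u))
    (t : ℝ≥0) (φ : TestFn) :
    HasSum (fun u => ∫ ω, siteFn N φ (X u t ω) ∂P) (∑ v ∈ siteSupport N φ, siteFn N φ v) := by
  have h1 : ∀ u, ∫ ω, siteFn N φ (X u t ω) ∂P =
      ∑ v ∈ siteSupport N φ, siteFn N φ v * p t u v := by
    intro u
    rw [integral_comp_eq_sum ((hX u).measurable t) fun v hv => siteFn_eq_zero hv]
    refine Finset.sum_congr rfl fun v _ => ?_
    rw [(hX u).measureReal_eq hp]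
  simp_rw [h1]
  refine hasSum_sum fun v _ => ?_
  simpa using (hp.hasSum_left hκ hlam hγ t v).mul_left (siteFn N φ v)

/-- The starting site is summed out of `p s u v * p (t - s) v w` by invariance, leaving a function
of `t - s`. -/
theorem hasSum_integral_siteFn_mul (hκ : 0 ≤ κ) (hlam : 0 ≤ lam) (hγ : 0 ≤ γ)
    (hp : IsTransitionFunction (walkGen κ lam γ N) p) (hX : ∀ u, IsMarkovChain p u P (X u))
    {s t : ℝ≥0} (hst : s ≤ t) (φ ψ : TestFn) :
    HasSum (fun u => ∫ ω, siteFn N φ (X u t ω) * siteFn N ψ (X u s ω) ∂P)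
      (N * latticeCov N p (t - s) φ ψ) := by
  have hN : (0 : ℝ) < N := by exact_mod_cast N.pos
  have h1 : ∀ u, ∫ ω, siteFn N φ (X u t ω) * siteFn N ψ (X u s ω) ∂P =
      ∑ v ∈ siteSupport N ψ, ∑ w ∈ siteSupport N φ,
        (siteFn N ψ v * siteFn N φ w * p (t - s) v w) * p s u v := by
    intro u
    have h2 := integral_comp_eq_sum (P := P) (Y := fun ω => (X u s ω, X u t ω))
      (((hX u).measurable s).prodMk ((hX u).measurable t))
      (g := fun b => siteFn N φ b.2 * siteFn N ψ b.1)
      (S := siteSupport N ψ ×ˢ siteSupport N φ) (by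
        intro b hb
        rw [Finset.mem_product, not_and_or] at hb
        rcases hb with hb | hb <;> simp [siteFn_eq_zero hb])
    rw [h2, Finset.sum_product]
    refine Finset.sum_congr rfl fun v _ => Finset.sum_congr rfl fun w _ => ?_
    rw [(hX u).measureReal_pair_eq hp hst]
    ring
  simp_rw [h1]
  rw [latticeCov, ← mul_assoc, mul_inv_cancel₀ hN.ne', one_mul]
  refine hasSum_sum fun v _ => hasSum_sum fun w _ => ?_
  simpa [siteFn] using (hp.hasSum_left hκ hlam hγ s v).mul_left
    (siteFn N ψ v * siteFn N φ w * p (t - s) v w)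

/-- The covariance at two times, in terms of the covariance `c` at a time difference. -/
def timeCov (c : ℝ≥0 → TestFn → TestFn → ℝ) (s t : ℝ≥0) (φ ψ : TestFn) : ℝ :=
  if t ≤ s then c (s - t) φ ψ else c (t - s) ψ φ

theorem hasSum_integral_siteFn_mul' (hκ : 0 ≤ κ) (hlam : 0 ≤ lam) (hγ : 0 ≤ γ)
    (hp : IsTransitionFunction (walkGen κ lam γ N) p) (hX : ∀ u, IsMarkovChain p u P (X u))
    (s t : ℝ≥0) (φ ψ : TestFn) :
    HasSum (fun u => ∫ ω, siteFn N φ (X u s ω) * siteFn N ψ (X u t ω) ∂P)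
      (N * timeCov (latticeCov N p) s t φ ψ) := by
  rw [timeCov]
  split_ifs with h
  · exact hasSum_integral_siteFn_mul hκ hlam hγ hp hX h φ ψ
  · simp_rw [mul_comm (siteFn N φ _)]
    exact hasSum_integral_siteFn_mul hκ hlam hγ hp hX (not_le.1 h).le ψ φ

variable {n : ℕ}

/-- The contribution of one particle to a linear combination of the fields. -/
def particleFn (N : ℕ+) (a : Fin n → ℝ) (φ : Fin n → TestFn) (x : Fin n → Site) : ℝ :=
  ∑ i, a i * siteFn N (φ i) (x i)

theorem measurable_particleFn (N : ℕ+) (a : Fin n → ℝ) (φ : Fin n → TestFn) :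
    Measurable (particleFn N a φ) :=
  Finset.measurable_sum _ fun i _ => ((measurable_of_countable (siteFn N _)).comp
    (measurable_pi_apply i)).const_mul _

theorem exists_particleFn_bound (a : Fin n → ℝ) (φ : Fin n → TestFn) :
    ∃ K, 0 ≤ K ∧ ∀ N x, |particleFn N a φ x| ≤ K := by
  choose C hC0 hC using fun i => (φ i).exists_bound
  refine ⟨∑ i, |a i| * C i, Finset.sum_nonneg fun i _ => mul_nonneg (abs_nonneg _) (hC0 i),
    fun N x => (Finset.abs_sum_le_sum_abs _ _).trans (Finset.sum_le_sum fun i _ => ?_)⟩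
  rw [abs_mul]
  gcongr
  exact hC i _

theorem integrable_siteFn {Z : Ω → Site} (hZ : Measurable Z) (φ : TestFn) :
    Integrable (fun ω => siteFn N φ (Z ω)) P := by
  obtain ⟨C, -, hC⟩ := φ.exists_bound
  exact Integrable.of_bound ((measurable_of_countable (siteFn N _)).comp hZ).aestronglyMeasurable C
    (Eventually.of_forall fun ω => hC _)

theorem integrable_siteFn_mul {Z W : Ω → Site} (hZ : Measurable Z) (hW : Measurable W)
    (φ ψ : TestFn) : Integrable (fun ω => siteFn N φ (Z ω) * siteFn N ψ (W ω)) P := by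
  obtain ⟨C, -, hC⟩ := φ.exists_bound
  exact (integrable_siteFn hW ψ).bdd_mul
    ((measurable_of_countable (siteFn N _)).comp hZ).aestronglyMeasurable (Eventually.of_forall fun ω => hC _)

theorem hasSum_integral_particleFn (hκ : 0 ≤ κ) (hlam : 0 ≤ lam) (hγ : 0 ≤ γ)
    (hp : IsTransitionFunction (walkGen κ lam γ N) p) (hX : ∀ u, IsMarkovChain p u P (X u))
    (t : Fin n → ℝ≥0) (a : Fin n → ℝ) (φ : Fin n → TestFn) :
    HasSum (fun u => ∫ ω, particleFn N a φ (fun i => X u (t i) ω) ∂P)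
      (∑ i, a i * ∑ v ∈ siteSupport N (φ i), siteFn N (φ i) v) := by
  have h1 : ∀ u, ∫ ω, particleFn N a φ (fun i => X u (t i) ω) ∂P =
      ∑ i, a i * ∫ ω, siteFn N (φ i) (X u (t i) ω) ∂P := by
    intro u
    simp only [particleFn]
    rw [integral_finsetSum _ fun i _ => (integrable_siteFn ((hX u).measurable _) _).const_mul _]
    simp_rw [integral_const_mul]
  simp_rw [h1]
  exact hasSum_sum fun i _ => (hasSum_integral_siteFn hκ hlam hγ hp hX (t i) (φ i)).mul_left _

theorem hasSum_integral_particleFn_sq (hκ : 0 ≤ κ) (hlam : 0 ≤ lam) (hγ : 0 ≤ γ)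
    (hp : IsTransitionFunction (walkGen κ lam γ N) p) (hX : ∀ u, IsMarkovChain p u P (X u))
    (t : Fin n → ℝ≥0) (a : Fin n → ℝ) (φ : Fin n → TestFn) :
    HasSum (fun u => ∫ ω, particleFn N a φ (fun i => X u (t i) ω) ^ 2 ∂P)
      (N * ∑ i, ∑ j, a i * a j * timeCov (latticeCov N p) (t i) (t j) (φ i) (φ j)) := by
  have h1 : ∀ u, ∫ ω, particleFn N a φ (fun i => X u (t i) ω) ^ 2 ∂P =
      ∑ i, ∑ j, a i * a j *
        ∫ ω, siteFn N (φ i) (X u (t i) ω) * siteFn N (φ j) (X u (t j) ω) ∂P := by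
    intro u
    have hint : ∀ i j, Integrable (fun ω => a i * a j *
        (siteFn N (φ i) (X u (t i) ω) * siteFn N (φ j) (X u (t j) ω))) P := fun i j =>
      (integrable_siteFn_mul ((hX u).measurable _) ((hX u).measurable _) _ _).const_mul _
    have h2 : ∀ ω, particleFn N a φ (fun i => X u (t i) ω) ^ 2 = ∑ i, ∑ j, a i * a j *
        (siteFn N (φ i) (X u (t i) ω) * siteFn N (φ j) (X u (t j) ω)) := by
      intro ω
      rw [particleFn, sq, Finset.sum_mul_sum]
      refine Finset.sum_congr rfl fun i _ => Finset.sum_congr rfl fun j _ => ?_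
      ring
    simp_rw [h2]
    rw [integral_finsetSum _ fun i _ => integrable_finsetSum _ fun j _ => hint i j]
    refine Finset.sum_congr rfl fun i _ => ?_
    rw [integral_finsetSum _ fun j _ => hint i j]
    simp_rw [integral_const_mul]
  simp_rw [h1]
  rw [Finset.mul_sum]
  refine hasSum_sum fun i _ => ?_
  rw [Finset.mul_sum]
  refine hasSum_sum fun j _ => ?_
  rw [mul_left_comm]
  exact (hasSum_integral_siteFn_mul' hκ hlam hγ hp hX (t i) (t j) (φ i) (φ j)).mul_left _

end OneParticle

/-! ### Independent Poisson numbers of independent particles -/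

section CompoundPoisson

variable {Ω : Type*} [mΩ : MeasurableSpace Ω] {P : Measure Ω} [IsProbabilityMeasure P]

/-- Independence survives grouping the σ-algebras into disjoint blocks. It is used within one site,
and again with one block per site. -/
theorem integral_prod_of_iIndep {ι ι' : Type*} {m : ι → MeasurableSpace Ω} (hle : ∀ i, m i ≤ mΩ)
    (h : iIndep m P) {S : ι' → Set ι} (hS : Pairwise (Function.onFun Disjoint S)) {f : ι' → Ω → ℂ}
    (hf : ∀ j, Measurable[⨆ i ∈ S j, m i] (f j)) (Λ : Finset ι') :
    ∫ ω, ∏ j ∈ Λ, f j ω ∂P = ∏ j ∈ Λ, ∫ ω, f j ω ∂P := by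
  classical
  induction Λ using Finset.induction_on with
  | empty => simp
  | insert a Λ ha ih =>
    have hd : Disjoint (S a) (⋃ j ∈ Λ, S j) := by
      rw [Set.disjoint_iUnion₂_right]
      intro j hj
      exact hS (fun h => ha (h ▸ hj))
    have hm : Measurable[⨆ i ∈ ⋃ j ∈ Λ, S j, m i] fun ω => ∏ j ∈ Λ, f j ω := by
      refine @Finset.measurable_fun_prod _ _ _ _ _ _ (⨆ i ∈ ⋃ j ∈ Λ, S j, m i) _ _ fun j hj => ?_
      exact (hf j).mono (biSup_mono fun i hi => Set.mem_biUnion hj hi) le_rfl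
    have hle' : ∀ T : Set ι, ⨆ i ∈ T, m i ≤ mΩ := fun T => iSup₂_le fun i _ => hle i
    have hind : IndepFun (f a) (fun ω => ∏ j ∈ Λ, f j ω) P :=
      indep_of_indep_of_le_left (indep_of_indep_of_le_right (indep_iSup_of_disjoint hle h hd)
        hm.comap_le) (hf a).comap_le
    simp_rw [Finset.prod_insert ha]
    rw [hind.integral_fun_mul_eq_mul_integral ((hf a).mono (hle' _) le_rfl).aestronglyMeasurable
      (hm.mono (hle' _) le_rfl).aestronglyMeasurable, ih]

theorem measurable_prod_range {m : MeasurableSpace Ω} {M : Ω → ℕ} (hM : Measurable M)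
    {G : ℕ → Ω → ℂ} (hG : ∀ k, Measurable (G k)) :
    Measurable fun ω => ∏ k ∈ Finset.range (M ω), G k ω := by
  have h : Measurable fun q : ℕ × Ω => ∏ k ∈ Finset.range q.1, G k q.2 :=
    measurable_from_prod_countable_right fun n =>
      Finset.measurable_fun_prod (Finset.range n) fun k _ => hG k
  exact h.comp (hM.prodMk measurable_id)

variable {I : Type*} {m : I ⊕ (I × ℕ) → MeasurableSpace Ω} {M : I → Ω → ℕ} {G : I → ℕ → Ω → ℂ}
  {g : I → ℂ} {ρ : ℝ≥0}

/-- Splitting over the value `n` of the Poisson number gives `e^{-ρ} ρ^n / n! * g^n` by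
independence, and the exponential series sums this. -/
theorem integral_prod_range_poisson (hle : ∀ i, m i ≤ mΩ) (h : iIndep m P)
    (hM : ∀ u, Measurable[m (Sum.inl u)] (M u)) (hG : ∀ u k, Measurable[m (Sum.inr (u, k))] (G u k))
    (hG1 : ∀ u k ω, ‖G u k ω‖ ≤ 1) (hg : ∀ u k, ∫ ω, G u k ω ∂P = g u)
    (hlaw : ∀ u, HasLaw (M u) (poissonMeasure ρ) P) (u : I) :
    ∫ ω, ∏ k ∈ Finset.range (M u ω), G u k ω ∂P = Complex.exp (ρ * (g u - 1)) := by
  have hM' : Measurable (M u) := (hM u).mono (hle _) le_rfl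
  have hG' : ∀ k, Measurable (G u k) := fun k => (hG u k).mono (hle _) le_rfl
  have hsets : ∀ n, MeasurableSet (M u ⁻¹' {n}) := fun n => hM' (measurableSet_singleton n)
  have hint : Integrable (fun ω => ∏ k ∈ Finset.range (M u ω), G u k ω) P := by
    refine Integrable.of_bound (measurable_prod_range hM' hG').aestronglyMeasurable 1
      (Eventually.of_forall fun ω => ?_)
    rw [norm_prod]
    exact Finset.prod_le_one (fun _ _ => norm_nonneg _) fun k _ => hG1 u k ω
  have h1 := hasSum_integral_iUnion (f := fun ω => ∏ k ∈ Finset.range (M u ω), G u k ω) (μ := P)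
    hsets (fun i j hij => Disjoint.preimage _ (by simpa using hij)) hint.integrableOn
  have h2 : ⋃ n, M u ⁻¹' {n} = Set.univ := by ext ω; simp
  rw [h2, setIntegral_univ] at h1
  refine h1.unique ?_
  have h3 : ∀ n, ∫ ω in M u ⁻¹' {n}, ∏ k ∈ Finset.range (M u ω), G u k ω ∂P =
      ((Real.exp (-ρ) * (ρ : ℝ) ^ n / n.factorial : ℝ) : ℂ) * g u ^ n := by
    intro n
    -- The index `none` carries the event that the number of particles is `n`; `some k` carries the
    -- factor of particle `k`.
    let f : Option ℕ → Ω → ℂ := fun o => o.elim ((M u ⁻¹' {n}).indicator fun _ => 1) (G u)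
    let S : Option ℕ → Set (I ⊕ (I × ℕ)) := fun o => {o.elim (Sum.inl u) fun k => Sum.inr (u, k)}
    have hS : Pairwise (Function.onFun Disjoint S) := by
      intro a b hab
      rcases a with _ | a <;> rcases b with _ | b <;> simp_all [Function.onFun, S]
    have hf : ∀ o, Measurable[⨆ i ∈ S o, m i] (f o) := by
      intro o
      have hsup : ∀ i ∈ S o, m i ≤ ⨆ i ∈ S o, m i := fun i hi => le_biSup m hi
      rcases o with _ | k
      · exact Measurable.indicator measurable_const
          (hsup _ rfl _ (hM u (measurableSet_singleton n)))
      · exact (hG u k).mono (hsup _ rfl) le_rfl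
    have h4 := integral_prod_of_iIndep hle h hS hf (Finset.insertNone (Finset.range n))
    simp only [Finset.prod_insertNone] at h4
    have h5 : ∫ ω, f none ω ∂P = ((P.real (M u ⁻¹' {n}) : ℝ) : ℂ) := by
      simp only [f, Option.elim]
      rw [integral_indicator_const _ (hsets n)]
      simp
    have h6 : P.real (M u ⁻¹' {n}) = Real.exp (-ρ) * (ρ : ℝ) ^ n / n.factorial := by
      rw [← poissonMeasure_real_singleton, ← (hlaw u).map_eq, map_measureReal_apply hM'
        (measurableSet_singleton n)]
    rw [h5, h6] at h4
    rw [← integral_indicator (hsets n)]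
    have h7 : ∀ k, ∫ ω, f (some k) ω ∂P = g u := hg u
    simp only [h7, Finset.prod_const, Finset.card_range] at h4
    rw [← h4]
    refine integral_congr_ae (Eventually.of_forall fun ω => ?_)
    by_cases hω : M u ω = n
    · simp [f, hω, Set.indicator]
    · simp [f, hω, Set.indicator]
  simp_rw [h3]
  have h8 := (NormedSpace.expSeries_div_hasSum_exp ((ρ : ℂ) * g u)).mul_left (Complex.exp (-ρ))
  rw [← Complex.exp_eq_exp_ℂ, ← Complex.exp_add] at h8
  rw [show (ρ : ℂ) * (g u - 1) = -ρ + ρ * g u by ring]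
  refine h8.congr_fun fun n => ?_
  push_cast
  rw [mul_pow]
  ring

theorem integral_prod_prod_range_poisson (hle : ∀ i, m i ≤ mΩ) (h : iIndep m P)
    (hM : ∀ u, Measurable[m (Sum.inl u)] (M u)) (hG : ∀ u k, Measurable[m (Sum.inr (u, k))] (G u k))
    (hG1 : ∀ u k ω, ‖G u k ω‖ ≤ 1) (hg : ∀ u k, ∫ ω, G u k ω ∂P = g u)
    (hlaw : ∀ u, HasLaw (M u) (poissonMeasure ρ) P) (Λ : Finset I) :
    ∫ ω, ∏ u ∈ Λ, ∏ k ∈ Finset.range (M u ω), G u k ω ∂P =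
      Complex.exp (ρ * ∑ u ∈ Λ, (g u - 1)) := by
  -- The block of `u` consists of its Poisson number together with all paths started there.
  let S : I → Set (I ⊕ (I × ℕ)) := fun u => {i | i.elim id Prod.fst = u}
  have hS : Pairwise (Function.onFun Disjoint S) := by
    intro a b hab
    rw [Function.onFun, Set.disjoint_left]
    intro i hi hi'
    exact hab (hi.symm.trans hi')
  have hle' : ∀ (u : I) (i : I ⊕ (I × ℕ)), i ∈ S u → m i ≤ ⨆ i ∈ S u, m i := fun u i hi =>
    le_biSup m hi
  rw [integral_prod_of_iIndep hle h hS (fun u => measurable_prod_range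
    ((hM u).mono (hle' u _ rfl) le_rfl) fun k => (hG u k).mono (hle' u _ rfl) le_rfl),
    Finset.mul_sum, Complex.exp_sum]
  exact Finset.prod_congr rfl fun u _ => integral_prod_range_poisson hle h hM hG hG1 hg hlaw u

end CompoundPoisson

/-- Summing over the particles at time `0` is the same as summing over the occupied sites. -/
theorem exists_sum_particles_eq {I J : Type*} {M : I → ℕ} {Y : I → ℕ → J} {η : J → ℕ}
    (hη : ∀ v, (η v : ℕ∞) = {q : I × ℕ | q.2 < M q.1 ∧ Y q.1 q.2 = v}.encard)
    {f : J → ℝ} {S : Finset J} (hf : ∀ v, v ∉ S → f v = 0) :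
    ∃ Λ₀ : Finset I, ∀ Λ, Λ₀ ⊆ Λ →
      ∑ u ∈ Λ, ∑ k ∈ Finset.range (M u), f (Y u k) = ∑ v ∈ S, η v * f v := by
  classical
  -- Cardinalities that are natural numbers force finiteness. Only finitely many particles can sit
  -- in `S`, and `Λ₀` will collect their starting sites.
  have hfin : ∀ v, {q : I × ℕ | q.2 < M q.1 ∧ Y q.1 q.2 = v}.Finite := fun v =>
    Set.finite_of_encard_eq_coe (hη v).symm
  set A : J → Finset (I × ℕ) := fun v => (hfin v).toFinset with hA
  have hmem : ∀ v q, q ∈ A v ↔ q.2 < M q.1 ∧ Y q.1 q.2 = v := fun v q => by simp [hA]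
  have hcard : ∀ v, η v = (A v).card := fun v => by
    have h := hη v
    rw [(hfin v).encard_eq_coe_toFinset_card] at h
    exact_mod_cast h
  refine ⟨S.biUnion fun v => (A v).image Prod.fst, fun Λ hΛ => ?_⟩
  rw [Finset.sum_sigma']
  have h1 : ∀ v ∈ S, (η v : ℝ) * f v = ∑ q ∈ A v, f (Y q.1 q.2) := by
    intro v _
    rw [hcard, Finset.sum_congr rfl fun q hq => by rw [((hmem v q).1 hq).2], Finset.sum_const,
      nsmul_eq_mul]
  rw [Finset.sum_congr rfl h1, Finset.sum_sigma']
  refine (Finset.sum_of_injOn (fun x : (_ : J) × (I × ℕ) => (⟨x.2.1, x.2.2⟩ : (_ : I) × ℕ))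
    ?_ ?_ ?_ ?_).symm
  · rintro ⟨v, q, k⟩ hx ⟨w, q', k'⟩ hy hxy
    simp only [Finset.coe_sigma, Set.mem_sigma_iff, Finset.mem_coe, hmem] at hx hy
    simp only [Sigma.mk.injEq, heq_eq_eq] at hxy
    obtain ⟨rfl, rfl⟩ := hxy
    rw [← hx.2.2, ← hy.2.2]
  · rintro ⟨v, q, k⟩ hx
    simp only [Finset.coe_sigma, Set.mem_sigma_iff, Finset.mem_coe, hmem] at hx
    simp only [Finset.coe_sigma, Set.mem_sigma_iff, Finset.mem_coe, Finset.mem_range]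
    refine ⟨hΛ (Finset.mem_biUnion.2 ⟨v, hx.1, Finset.mem_image.2 ⟨(q, k), (hmem _ _).2 hx.2, rfl⟩⟩),
      hx.2.1⟩
  · rintro ⟨u, k⟩ hx hx'
    refine hf _ fun hS => hx' ⟨⟨Y u k, u, k⟩, ?_, rfl⟩
    simp only [Finset.mem_sigma, Finset.mem_range] at hx
    simp only [Finset.coe_sigma, Set.mem_sigma_iff, Finset.mem_coe, hmem]
    exact ⟨hS, hx.2, trivial⟩
  · rintro ⟨v, q, k⟩ _
    rfl

/-! ### Characteristic functions of the fluctuation fields -/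

section CharFun

/-- The cubic remainder is kept as `|x| * x ^ 2`: one factor will be bounded uniformly, and the
square is summed by the second-moment identity. -/
theorem norm_exp_mul_I_sub_le {x : ℝ} (hx : |x| ≤ 1) :
    ‖Complex.exp (x * Complex.I) - 1 - x * Complex.I + (x ^ 2 / 2 : ℝ)‖ ≤ |x| * x ^ 2 := by
  have h := Complex.exp_bound (x := x * Complex.I) (by simpa using hx) (n := 3) (by norm_num)
  simp only [Finset.sum_range_succ, Finset.sum_range_zero] at h
  have h1 : Complex.exp (x * Complex.I) - 1 - x * Complex.I + (x ^ 2 / 2 : ℝ) =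
      Complex.exp (x * Complex.I) - (0 + (x * Complex.I) ^ 0 / (Nat.factorial 0 : ℂ) +
        (x * Complex.I) ^ 1 / (Nat.factorial 1 : ℂ) +
        (x * Complex.I) ^ 2 / (Nat.factorial 2 : ℂ)) := by
    simp only [Nat.factorial, mul_pow, Complex.I_sq]
    push_cast
    ring
  rw [h1]
  refine h.trans ?_
  simp only [norm_mul, Complex.norm_real, Complex.norm_I, mul_one, Real.norm_eq_abs]
  have h2 : |x| ^ 3 = |x| * x ^ 2 := by rw [pow_succ', sq_abs]
  rw [h2]
  refine mul_le_of_le_one_right (by positivity) ?_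
  norm_num [Nat.factorial]

variable {Ω : Type*} [MeasurableSpace Ω] {P : Measure Ω} [IsProbabilityMeasure P]
  {κ lam γ : ℝ} {ρ : ℝ≥0} {N : ℕ+} {η : ℝ≥0 → Ω → Site → ℕ}

theorem totalField_eq (ρ : ℝ≥0) (N : ℕ+) (η : ℝ≥0 → Ω → Site → ℕ) (t : ℝ≥0) (φ : TestFn) (ω : Ω) :
    totalField ρ N η t φ ω = (√(N : ℝ))⁻¹ * (∑ v ∈ siteSupport N φ, (η t ω v : ℝ) * siteFn N φ v
      - ρ * ∑ v ∈ siteSupport N φ, siteFn N φ v) := by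
  rw [totalField, tsum_eq_sum (s := siteSupport N φ) fun v hv => by
    rw [eq_zero_of_notMem_siteSupport hv, mul_zero]]
  congr 1
  rw [Finset.mul_sum, ← Finset.sum_sub_distrib]
  refine Finset.sum_congr rfl fun v _ => ?_
  rw [siteFn]
  ring

theorem measurable_exp_particleFn {Ω : Type*} {m : MeasurableSpace Ω} (c : ℝ) {n : ℕ} (a : Fin n → ℝ)
    (φ : Fin n → TestFn) {Z : Fin n → Ω → Site} (hZ : ∀ i, Measurable (Z i)) :
    Measurable fun ω => Complex.exp ((c * particleFn N a φ (fun i => Z i ω) : ℝ) * Complex.I) := by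
  have := (measurable_particleFn N a φ).comp (measurable_pi_lambda _ hZ)
  simp only [Function.comp_def] at this
  fun_prop

theorem measurable_totalField (hη : IsRunAndTumble κ lam γ ρ N P η) (t : ℝ≥0) (φ : TestFn) :
    Measurable (totalField ρ N η t φ) := by
  have h1 : totalField ρ N η t φ = fun ω => (√(N : ℝ))⁻¹ *
      (∑ v ∈ siteSupport N φ, (η t ω v : ℝ) * siteFn N φ v
        - ρ * ∑ v ∈ siteSupport N φ, siteFn N φ v) := funext fun ω => totalField_eq ρ N η t φ ω
  rw [h1]
  refine ((Finset.measurable_fun_sum _ fun v _ => ?_).sub_const _).const_mul _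
  exact ((measurable_of_countable (fun k : ℕ => (k : ℝ))).comp (hη.1 t v)).mul_const _

/-- The characteristic function of the fluctuation field is close to a Gaussian one. -/
theorem IsRunAndTumble.exists_charFun (hκ : 0 ≤ κ) (hlam : 0 ≤ lam) (hγ : 0 ≤ γ)
    (hη : IsRunAndTumble κ lam γ ρ N P η) :
    ∃ p, IsTransitionFunction (walkGen κ lam γ N) p ∧
      ∀ (n : ℕ) (t : Fin n → ℝ≥0) (a : Fin n → ℝ) (φ : Fin n → TestFn),
        0 ≤ ∑ i, ∑ j, a i * a j * timeCov (latticeCov N p) (t i) (t j) (φ i) (φ j) ∧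
        ∀ K, (∀ x, |particleFn N a φ x| ≤ K) → (√(N : ℝ))⁻¹ * K ≤ 1 → ∃ r : ℂ,
          ‖r‖ ≤ (√(N : ℝ))⁻¹ * K *
            ∑ i, ∑ j, a i * a j * timeCov (latticeCov N p) (t i) (t j) (φ i) (φ j) ∧
          ∫ ω, Complex.exp ((∑ i, a i * totalField ρ N η (t i) (φ i) ω : ℝ) * Complex.I) ∂P =
            Complex.exp (ρ * (r - (∑ i, ∑ j, a i * a j *
              timeCov (latticeCov N p) (t i) (t j) (φ i) (φ j) : ℝ) / 2)) := by
  obtain ⟨hmeas, p, X, hp, hX, hlaw, hindep, hcount⟩ := hη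
  refine ⟨p, hp, fun n t a φ => ?_⟩
  set Q := ∑ i, ∑ j, a i * a j * timeCov (latticeCov N p) (t i) (t j) (φ i) (φ j) with hQdef
  have hN : (0 : ℝ) < N := by exact_mod_cast N.pos
  set c := (√(N : ℝ))⁻¹ with hc
  have hc0 : 0 ≤ c := by positivity
  have hcN : c ^ 2 * N = 1 := by
    rw [hc, inv_pow, Real.sq_sqrt hN.le, inv_mul_cancel₀ hN.ne']
  set F : Site → ℕ → Ω → ℝ := fun u k ω => particleFn N a φ fun i => X u k (t i) ω with hF
  have hFm : ∀ u k, Measurable (F u k) := fun u k => (measurable_particleFn N a φ).comp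
    (measurable_pi_lambda _ fun i => (hX u k).measurable _)
  have hQ := hasSum_integral_particleFn_sq hκ hlam hγ hp (fun u => hX u 0) t a φ
  have hM := hasSum_integral_particleFn hκ hlam hγ hp (fun u => hX u 0) t a φ
  rw [← hQdef] at hQ
  change HasSum (fun u => ∫ ω, F u 0 ω ^ 2 ∂P) _ at hQ
  change HasSum (fun u => ∫ ω, F u 0 ω ∂P) _ at hM
  set M := ∑ i, a i * ∑ v ∈ siteSupport N (φ i), siteFn N (φ i) v with hMdef
  have hQ0 : 0 ≤ Q := by
    have h1 : 0 ≤ N * Q := hQ.nonneg fun u => integral_nonneg fun ω => sq_nonneg _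
    exact nonneg_of_mul_nonneg_right h1 hN
  refine ⟨hQ0, fun K hK hcK => ?_⟩
  have hFK : ∀ u k ω, |F u k ω| ≤ K := fun u k ω => hK _
  have hK0 : 0 ≤ K := (abs_nonneg _).trans (hK fun _ => (0, 1))
  have hFint : ∀ u, Integrable (F u 0) P := fun u =>
    Integrable.of_bound (hFm u 0).aestronglyMeasurable K (Eventually.of_forall (hFK u 0))
  have hF2int : ∀ u, Integrable (fun ω => F u 0 ω ^ 2) P := fun u => by
    refine Integrable.of_bound ((hFm u 0).pow_const 2).aestronglyMeasurable (K ^ 2)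
      (Eventually.of_forall fun ω => ?_)
    rw [norm_pow]
    exact pow_le_pow_left₀ (abs_nonneg _) (hFK u 0 ω) 2
  -- the characteristic function of a finite number of sites
  set G : Site → ℕ → Ω → ℂ := fun u k ω => Complex.exp ((c * F u k ω : ℝ) * Complex.I) with hG
  have hG1 : ∀ u k ω, ‖G u k ω‖ ≤ 1 := fun u k ω => (Complex.norm_exp_ofReal_mul_I _).le
  have hGm' : Measurable fun x : Fin n → Site =>
      Complex.exp ((c * particleFn N a φ x : ℝ) * Complex.I) := by
    have := measurable_particleFn N a φ
    fun_prop
  have hGm : ∀ u k, Measurable (G u k) := fun u k => hGm'.comp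
    (measurable_pi_lambda _ fun i => (hX u k).measurable _)
  have hg : ∀ u k, ∫ ω, G u k ω ∂P = ∫ ω, G u 0 ω ∂P := by
    intro u k
    have h1 : ∀ k, ∫ ω, G u k ω ∂P = ∫ x, Complex.exp ((c * particleFn N a φ x : ℝ) * Complex.I)
        ∂(P.map fun ω i => X u k (t i) ω) := fun k => by
      rw [integral_map (measurable_pi_lambda _ fun i => (hX u k).measurable _).aemeasurable
        hGm'.aestronglyMeasurable]
    rw [h1, h1, (hX u k).map_eq (hX u 0) t]
  have hfinite := integral_prod_prod_range_poisson (P := P) (M := fun u ω => η 0 ω u) (G := G)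
    (g := fun u => ∫ ω, G u 0 ω ∂P) (ρ := ρ) (m := Sum.elim
      (fun u : Site => MeasurableSpace.comap (fun ω => η 0 ω u) inferInstance)
      (fun q : Site × ℕ => ⨆ t : ℝ≥0, MeasurableSpace.comap (X q.1 q.2 t) inferInstance))
    (by
      rintro (u | ⟨u, k⟩)
      · exact (hmeas 0 u).comap_le
      · exact iSup_le fun t => ((hX u k).measurable t).comap_le) hindep
    (fun u => comap_measurable _)
    (fun u k => by
      refine measurable_exp_particleFn (m := ⨆ t : ℝ≥0, MeasurableSpace.comap (X u k t) inferInstance)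
        c a φ fun i => ?_
      exact (comap_measurable (X u k (t i))).mono
        (le_iSup (fun s => MeasurableSpace.comap (X u k s) inferInstance) (t i)) le_rfl)
    hG1 hg hlaw
  -- passing to the limit over finite sets of sites
  have hae : ∀ᵐ ω ∂P, ∀ i, ∀ v,
      (η (t i) ω v : ℕ∞) = {q : Site × ℕ | q.2 < η 0 ω q.1 ∧ X q.1 q.2 (t i) ω = v}.encard :=
    ae_all_iff.2 fun i => hcount (t i)
  -- Almost surely the integrand is eventually constant in `Λ`, since only finitely many particles
  -- touch the supports. The extra factor with `c * ρ * M` undoes the centring of the fields.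
  have hlimL : Tendsto (fun Λ : Finset Site =>
      ∫ ω, ∏ u ∈ Λ, ∏ k ∈ Finset.range (η 0 ω u), G u k ω ∂P) atTop
      (𝓝 (∫ ω, Complex.exp ((∑ i, a i * totalField ρ N η (t i) (φ i) ω : ℝ) * Complex.I) *
        Complex.exp ((c * ρ * M : ℝ) * Complex.I) ∂P)) := by
    refine tendsto_integral_filter_of_dominated_convergence (fun _ => 1)
      (Eventually.of_forall fun Λ => (Finset.measurable_fun_prod _ fun u _ =>
        measurable_prod_range (hmeas 0 u) (hGm u)).aestronglyMeasurable)
      (Eventually.of_forall fun Λ => Eventually.of_forall fun ω => ?_) (integrable_const _) ?_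
    · rw [norm_prod]
      refine Finset.prod_le_one (fun _ _ => norm_nonneg _) fun u _ => ?_
      rw [norm_prod]
      exact Finset.prod_le_one (fun _ _ => norm_nonneg _) fun k _ => hG1 u k ω
    · filter_upwards [hae] with ω hω
      choose Λ₀ hΛ₀ using fun i => exists_sum_particles_eq (M := fun u => η 0 ω u)
        (Y := fun u k => X u k (t i) ω) (η := fun v => η (t i) ω v) (hω i)
        (f := siteFn N (φ i)) fun v hv => siteFn_eq_zero hv
      classical
      refine tendsto_const_nhds.congr' ?_
      filter_upwards [eventually_ge_atTop (Finset.univ.biUnion Λ₀)] with Λ hΛ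
      have h1 : ∀ i, ∑ u ∈ Λ, ∑ k ∈ Finset.range (η 0 ω u), siteFn N (φ i) (X u k (t i) ω) =
          ∑ v ∈ siteSupport N (φ i), (η (t i) ω v : ℝ) * siteFn N (φ i) v := fun i =>
        hΛ₀ i Λ ((Finset.subset_biUnion_of_mem Λ₀ (Finset.mem_univ i)).trans hΛ)
      have h2 : ∑ u ∈ Λ, ∑ k ∈ Finset.range (η 0 ω u), c * F u k ω =
          ∑ i, a i * totalField ρ N η (t i) (φ i) ω + c * ρ * M := by
        have h3 : ∀ i, a i * totalField ρ N η (t i) (φ i) ω = c * (a i *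
            ∑ u ∈ Λ, ∑ k ∈ Finset.range (η 0 ω u), siteFn N (φ i) (X u k (t i) ω)) -
            c * ρ * (a i * ∑ v ∈ siteSupport N (φ i), siteFn N (φ i) v) := by
          intro i
          rw [totalField_eq, h1]
          ring
        simp_rw [h3]
        rw [Finset.sum_sub_distrib, ← Finset.mul_sum, ← Finset.mul_sum, hMdef, sub_add_cancel]
        simp only [hF, particleFn, Finset.mul_sum]
        rw [Finset.sum_comm]
        simp_rw [Finset.sum_comm (s := Finset.univ)]
      rw [← Complex.exp_add, ← add_mul, ← Complex.ofReal_add, ← h2]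
      simp only [hG]
      push_cast
      simp_rw [Finset.sum_mul, Complex.exp_sum]
  have hlimL' := hlimL
  simp_rw [hfinite] at hlimL'
  rw [integral_mul_const] at hlimL'
  -- the exponents
  set R : Site → ℂ := fun u => ∫ ω, (Complex.exp ((c * F u 0 ω : ℝ) * Complex.I) - 1 -
    (c * F u 0 ω : ℝ) * Complex.I + ((c * F u 0 ω) ^ 2 / 2 : ℝ)) ∂P with hR
  have hRle : ∀ u, ‖R u‖ ≤ c * K * c ^ 2 * ∫ ω, F u 0 ω ^ 2 ∂P := by
    intro u
    rw [← integral_const_mul]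
    refine norm_integral_le_of_norm_le ((hF2int u).const_mul _) (Eventually.of_forall fun ω => ?_)
    have h1 : |c * F u 0 ω| ≤ c * K := by
      rw [abs_mul, abs_of_nonneg hc0]
      gcongr
      exact hFK u 0 ω
    refine (norm_exp_mul_I_sub_le (h1.trans hcK)).trans ?_
    rw [mul_pow, ← mul_assoc]
    gcongr
  have hRsum : Summable R := by
    refine Summable.of_norm_bounded (g := fun u => c * K * c ^ 2 * ∫ ω, F u 0 ω ^ 2 ∂P)
      (hQ.summable.mul_left _) hRle
  -- Each term is summable over the starting sites: the moments by invariance, and `R` by domination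
  -- with the second moments.
  have hGR : ∀ u, ∫ ω, G u 0 ω ∂P - 1 = R u - ((c ^ 2 / 2 * ∫ ω, F u 0 ω ^ 2 ∂P : ℝ) : ℂ) +
      ((c * ∫ ω, F u 0 ω ∂P : ℝ) : ℂ) * Complex.I := by
    intro u
    have hi1 : Integrable (fun ω => Complex.exp ((c * F u 0 ω : ℝ) * Complex.I)) P := Integrable.of_bound (hGm u 0).aestronglyMeasurable 1
      (Eventually.of_forall (hG1 u 0))
    have hi2 : Integrable (fun ω => ((c * F u 0 ω : ℝ) : ℂ) * Complex.I) P :=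
      ((hFint u).const_mul c).ofReal.mul_const _
    have hi3 : Integrable (fun ω => (((c * F u 0 ω) ^ 2 / 2 : ℝ) : ℂ)) P := by
      have h1 : ∀ ω, (c * F u 0 ω) ^ 2 / 2 = c ^ 2 / 2 * F u 0 ω ^ 2 := fun ω => by ring
      simp_rw [h1]
      exact ((hF2int u).const_mul _).ofReal
    have hi4 : Integrable (fun ω => Complex.exp ((c * F u 0 ω : ℝ) * Complex.I) - 1) P :=
      hi1.sub (integrable_const _)
    have hi5 : Integrable (fun ω => Complex.exp ((c * F u 0 ω : ℝ) * Complex.I) - 1 -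
      (c * F u 0 ω : ℝ) * Complex.I) P := hi4.sub hi2
    have hR1 : R u = ∫ ω, G u 0 ω ∂P - 1 - ((c * ∫ ω, F u 0 ω ∂P : ℝ) : ℂ) * Complex.I +
        ((c ^ 2 / 2 * ∫ ω, F u 0 ω ^ 2 ∂P : ℝ) : ℂ) := by
      simp only [hR]
      rw [integral_add hi5 hi3, integral_sub hi4 hi2, integral_sub hi1 (integrable_const _),
        integral_mul_const, integral_complex_ofReal, integral_complex_ofReal, integral_const_mul,
        ← integral_const_mul (c ^ 2 / 2)]
      congr 3
      · simp
      · ext ω; ring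
    rw [hR1]
    ring
  refine ⟨∑' u, R u, ?_, ?_⟩
  · refine (tsum_of_norm_bounded (hQ.mul_left (c * K * c ^ 2)) hRle).trans (le_of_eq ?_)
    calc c * K * c ^ 2 * (N * Q) = c * K * (c ^ 2 * N) * Q := by ring
      _ = c * K * Q := by rw [hcN, mul_one]
  · have h1 : Tendsto (fun Λ : Finset Site => Complex.exp (ρ * ∑ u ∈ Λ, (∫ ω, G u 0 ω ∂P - 1)))
        atTop (𝓝 (Complex.exp (ρ * (∑' u, R u - ((c ^ 2 / 2 * (N * Q) : ℝ) : ℂ) +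
          ((c * M : ℝ) : ℂ) * Complex.I)))) := by
      refine (Complex.continuous_exp.tendsto _).comp (Tendsto.const_mul _ ?_)
      simp_rw [hGR]
      exact (hRsum.hasSum.sub (Complex.hasSum_ofReal.2 (hQ.mul_left (c ^ 2 / 2)))).add
        ((Complex.hasSum_ofReal.2 (hM.mul_left c)).mul_right Complex.I)
    have h2 := tendsto_nhds_unique hlimL' h1
    -- The linear term of the exponent is exactly the phase from the centring, so it cancels; `c ^ 2
    -- * N = 1` normalizes the quadratic one.
    have h3 : (ρ : ℂ) * (∑' u, R u - ((c ^ 2 / 2 * (N * Q) : ℝ) : ℂ) +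
        ((c * M : ℝ) : ℂ) * Complex.I) = ρ * (∑' u, R u - (Q : ℂ) / 2) +
          ((c * ρ * M : ℝ) : ℂ) * Complex.I := by
      have h4 : c ^ 2 / 2 * (N * Q) = Q / 2 := by
        calc c ^ 2 / 2 * (N * Q) = (c ^ 2 * N) * Q / 2 := by ring
          _ = Q / 2 := by rw [hcN, one_mul]
      rw [h4]
      push_cast
      ring
    rw [h3, Complex.exp_add] at h2
    exact mul_right_cancel₀ (Complex.exp_ne_zero _) h2

end CharFun

/-! ### Convergence of the finite-dimensional distributions -/

section Convergence

/-- The centred Gaussian measure on `ℝⁿ` with covariance matrix `S`. -/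
def gaussianPi {n : ℕ} (S : Matrix (Fin n) (Fin n) ℝ) : Measure (Fin n → ℝ) :=
  (multivariateGaussian 0 S).map (WithLp.ofLp : EuclideanSpace ℝ (Fin n) → Fin n → ℝ)

variable {n : ℕ} {S : Matrix (Fin n) (Fin n) ℝ}

theorem isGaussian_gaussianPi : IsGaussian (gaussianPi S) :=
  (IsGaussian.hasGaussianLaw_id (μ := multivariateGaussian 0 S)).map_equiv
    (PiLp.continuousLinearEquiv 2 ℝ fun _ : Fin n => ℝ) |>.isGaussian_map

instance : IsProbabilityMeasure (gaussianPi S) := isGaussian_gaussianPi.toIsProbabilityMeasure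

theorem integral_eval_gaussianPi (i : Fin n) : ∫ x, x i ∂gaussianPi S = 0 := by
  rw [gaussianPi, integral_map (f := fun x : Fin n → ℝ => x i) (by fun_prop)
    (measurable_pi_apply i).aestronglyMeasurable]
  have h := (EuclideanSpace.proj (𝕜 := ℝ) i : EuclideanSpace ℝ (Fin n) →L[ℝ] ℝ).integral_comp_comm
    (IsGaussian.integrable_fun_id (μ := multivariateGaussian 0 S))
  simpa using h

theorem integral_mul_gaussianPi (hS : S.PosSemidef) (i j : Fin n) :
    ∫ x, x i * x j ∂gaussianPi S = S i j := by
  rw [← covariance_eval_multivariateGaussian (μ := 0) hS i j, covariance]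
  have h0 : ∀ i : Fin n, ∫ x, x i ∂multivariateGaussian (0 : EuclideanSpace ℝ (Fin n)) S = 0 := by
    intro i
    have h := integral_eval_gaussianPi (S := S) i
    rwa [gaussianPi, integral_map (f := fun x : Fin n → ℝ => x i) (by fun_prop)
    (measurable_pi_apply i).aestronglyMeasurable] at h
  rw [gaussianPi, integral_map (by fun_prop) (by measurability)]
  simp only [h0, sub_zero]

theorem tendsto_atTop_of_pnatIsoNat {α : Type*} {l : Filter α} {f : ℕ+ → α}
    (h : Tendsto (fun k : ℕ => f (OrderIso.pnatIsoNat.symm k)) atTop l) : Tendsto f atTop l := by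
  simpa [Function.comp_def] using h.comp OrderIso.pnatIsoNat.tendsto_atTop

/-- Convergence to a Gaussian characteristic function implies convergence in law. -/
theorem tendstoInDistribution_gaussianPi {Ω : ℕ+ → Type*} [∀ N, MeasurableSpace (Ω N)]
    {PN : ∀ N, Measure (Ω N)} [∀ N, IsProbabilityMeasure (PN N)] {X : ∀ N, Ω N → Fin n → ℝ}
    (hX : ∀ N, Measurable (X N)) (hS : S.PosSemidef)
    (h : ∀ a : Fin n → ℝ, Tendsto
      (fun N => ∫ ω, Complex.exp ((∑ i, a i * X N ω i : ℝ) * Complex.I) ∂PN N) atTop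
      (𝓝 (Complex.exp (-(a ⬝ᵥ S.mulVec a : ℝ) / 2)))) :
    TendstoInDistribution X atTop (fun x : Fin n → ℝ => x) PN (gaussianPi S) := by
  have hm : ∀ N, Measurable fun ω => (WithLp.toLp 2 (X N ω) : EuclideanSpace ℝ (Fin n)) := fun N =>
    (WithLp.measurable_toLp 2 _).comp (hX N)
  have hE : TendstoInDistribution (fun N ω => (WithLp.toLp 2 (X N ω) : EuclideanSpace ℝ (Fin n)))
      atTop (fun x : EuclideanSpace ℝ (Fin n) => x) PN (multivariateGaussian 0 S) := by
    refine ⟨fun N => (hm N).aemeasurable, aemeasurable_id, ?_⟩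
    refine tendsto_atTop_of_pnatIsoNat (ProbabilityMeasure.tendsto_of_tendsto_charFun fun a => ?_)
    simp only [ProbabilityMeasure.coe_mk, Measure.map_id']
    rw [charFun_multivariateGaussian hS, inner_zero_right]
    have h1 := (h a.ofLp).comp OrderIso.pnatIsoNat.symm.tendsto_atTop
    convert! h1 using 2 with N
    · rw [charFun_apply, integral_map (hm _).aemeasurable (by fun_prop)]
      simp [PiLp.inner_apply, mul_comm]
      rfl
    · congr 1
      push_cast
      ring
  have hF := hE.continuous_comp (PiLp.continuous_ofLp 2 _)
  refine ⟨fun N => (hX N).aemeasurable, aemeasurable_id, ?_⟩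
  convert! hF.tendsto using 2
  exact congrArg 𝓝 (Subtype.ext Measure.map_id')

/-- The covariance of the limiting field at two times with difference `s`, up to the factor `ρ`. -/
def limitCov (T : ℝ≥0 → LayerL2 →L[ℝ] LayerL2) (s : ℝ≥0) (φ ψ : TestFn) : ℝ :=
  ⟪T s (toL2 (layerConst φ)), toL2 (layerConst ψ)⟫

/-- The covariance matrix of the limiting field. -/
def covMatrix (ρ : ℝ≥0) (T : ℝ≥0 → LayerL2 →L[ℝ] LayerL2) (t : Fin n → ℝ≥0) (φ : Fin n → TestFn) :
    Matrix (Fin n) (Fin n) ℝ :=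
  Matrix.of fun i j => ρ * timeCov (limitCov T) (t i) (t j) (φ i) (φ j)

variable {κ lam γ : ℝ} {ρ : ℝ≥0} {T : ℝ≥0 → LayerL2 →L[ℝ] LayerL2}

theorem covMatrix_of_le {t : Fin n → ℝ≥0} {φ : Fin n → TestFn} {i j : Fin n} (h : t j ≤ t i) :
    covMatrix ρ T t φ i j = ρ * limitCov T (t i - t j) (φ i) (φ j) := by
  rw [covMatrix, Matrix.of_apply, timeCov, if_pos h]

theorem timeCov_limitCov_comm (hT : IsSemigroupGeneratedBy κ lam γ T) (s t : ℝ≥0) (φ ψ : TestFn) :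
    timeCov (limitCov T) s t φ ψ = timeCov (limitCov T) t s ψ φ := by
  rcases lt_trichotomy s t with h | rfl | h
  · rw [timeCov, timeCov, if_neg h.not_ge, if_pos h.le]
  · rw [timeCov, timeCov, if_pos le_rfl, if_pos le_rfl, tsub_self, limitCov, limitCov, hT.zero]
    exact real_inner_comm _ _
  · rw [timeCov, timeCov, if_pos h.le, if_neg h.not_ge]

theorem dotProduct_covMatrix (t : Fin n → ℝ≥0) (φ : Fin n → TestFn) (a : Fin n → ℝ) :
    a ⬝ᵥ (covMatrix ρ T t φ).mulVec a =
      ρ * ∑ i, ∑ j, a i * a j * timeCov (limitCov T) (t i) (t j) (φ i) (φ j) := by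
  simp only [dotProduct, Matrix.mulVec, covMatrix, Matrix.of_apply, Finset.mul_sum]
  refine Finset.sum_congr rfl fun i _ => Finset.sum_congr rfl fun j _ => ?_
  ring

variable {Ω : ℕ+ → Type*} [∀ N, MeasurableSpace (Ω N)] {PN : ∀ N, Measure (Ω N)}
  [∀ N, IsProbabilityMeasure (PN N)] {η : ∀ N, ℝ≥0 → Ω N → Site → ℕ}

theorem tendsto_timeCov (hκ : 0 ≤ κ) (hlam : 0 ≤ lam) (hγ : 0 ≤ γ)
    (hT : IsSemigroupGeneratedBy κ lam γ T) {p : ℕ+ → ℝ≥0 → Site → Site → ℝ}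
    (hp : ∀ N, IsTransitionFunction (walkGen κ lam γ N) (p N)) (s t : ℝ≥0) (φ ψ : TestFn) :
    Tendsto (fun N => timeCov (latticeCov N (p N)) s t φ ψ) atTop
      (𝓝 (timeCov (limitCov T) s t φ ψ)) := by
  unfold timeCov
  split_ifs
  · exact tendsto_latticeCov hκ hlam hγ hT hp _ φ ψ
  · exact tendsto_latticeCov hκ hlam hγ hT hp _ ψ φ

theorem tendsto_inv_sqrt_pnat : Tendsto (fun N : ℕ+ => (√(N : ℝ))⁻¹) atTop (𝓝 0) :=
  tendsto_inv_atTop_zero.comp (Real.tendsto_sqrt_atTop.comp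
    (tendsto_natCast_atTop_atTop.comp tendsto_PNat_val_atTop_atTop))

/-- The covariance matrix is positive semidefinite and the characteristic functions converge. -/
theorem posSemidef_covMatrix_and_tendsto (hκ : 0 ≤ κ) (hlam : 0 ≤ lam) (hγ : 0 ≤ γ)
    (hη : ∀ N, IsRunAndTumble κ lam γ ρ N (PN N) (η N)) (hT : IsSemigroupGeneratedBy κ lam γ T)
    (t : Fin n → ℝ≥0) (φ : Fin n → TestFn) :
    (covMatrix ρ T t φ).PosSemidef ∧ ∀ a : Fin n → ℝ, Tendsto
      (fun N => ∫ ω, Complex.exp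
        ((∑ i, a i * totalField ρ N (η N) (t i) (φ i) ω : ℝ) * Complex.I) ∂PN N) atTop
      (𝓝 (Complex.exp (-(a ⬝ᵥ (covMatrix ρ T t φ).mulVec a : ℝ) / 2))) := by
  choose p hp hchar using fun N => (hη N).exists_charFun hκ hlam hγ
  have hQ : ∀ a : Fin n → ℝ, Tendsto (fun N => ∑ i, ∑ j, a i * a j *
      timeCov (latticeCov N (p N)) (t i) (t j) (φ i) (φ j)) atTop
      (𝓝 (∑ i, ∑ j, a i * a j * timeCov (limitCov T) (t i) (t j) (φ i) (φ j))) := fun a =>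
    tendsto_finsetSum _ fun i _ => tendsto_finsetSum _ fun j _ =>
      (tendsto_timeCov hκ hlam hγ hT hp _ _ _ _).const_mul _
  refine ⟨Matrix.PosSemidef.of_dotProduct_mulVec_nonneg ?_ fun a => ?_, fun a => ?_⟩
  · ext i j
    simp [covMatrix, timeCov_limitCov_comm hT (t j) (t i)]
  -- Positivity is inherited from the lattice, where the quadratic form is a normalized sum of
  -- second moments.
  · rw [star_trivial, dotProduct_covMatrix]
    exact mul_nonneg ρ.coe_nonneg
      (ge_of_tendsto' (hQ a) fun N => (hchar N n t a φ).1)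
  · obtain ⟨K, hK0, hK⟩ := exists_particleFn_bound a φ
    have hcK : Tendsto (fun N : ℕ+ => (√(N : ℝ))⁻¹ * K) atTop (𝓝 0) := by
      simpa using tendsto_inv_sqrt_pnat.mul_const K
    have hev : ∀ᶠ N : ℕ+ in atTop, (√(N : ℝ))⁻¹ * K ≤ 1 :=
      hcK.eventually_le_const zero_lt_one
    choose! r hr hint using fun (N : ℕ+) (h : (√(N : ℝ))⁻¹ * K ≤ 1) => (hchar N n t a φ).2 K (hK N) h
    have hr0 : Tendsto r atTop (𝓝 0) := by
      refine squeeze_zero_norm' (hev.mono hr) ?_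
      simpa using hcK.mul (hQ a)
    have hQ2 := ((Complex.continuous_ofReal.tendsto _).comp (hQ a)).div_const (2 : ℂ)
    simp only [Function.comp_def] at hQ2
    have hlim := (Complex.continuous_exp.tendsto _).comp ((hr0.sub hQ2).const_mul ((ρ : ℝ) : ℂ))
    refine Tendsto.congr' ?_ (hlim.trans_eq ?_)
    · filter_upwards [hev] with N hN
      exact (hint N hN).symm
    · rw [dotProduct_covMatrix]
      congr 2
      push_cast
      ring

theorem posSemidef_covMatrix (hκ : 0 ≤ κ) (hlam : 0 ≤ lam) (hγ : 0 ≤ γ)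
    (hη : ∀ N, IsRunAndTumble κ lam γ ρ N (PN N) (η N)) (hT : IsSemigroupGeneratedBy κ lam γ T)
    (t : Fin n → ℝ≥0) (φ : Fin n → TestFn) : (covMatrix ρ T t φ).PosSemidef :=
  (posSemidef_covMatrix_and_tendsto hκ hlam hγ hη hT t φ).1

/-- The finite-dimensional distributions of the fluctuation fields converge. -/
theorem tendstoInDistribution_totalField (hκ : 0 ≤ κ) (hlam : 0 ≤ lam) (hγ : 0 ≤ γ)
    (hη : ∀ N, IsRunAndTumble κ lam γ ρ N (PN N) (η N)) (hT : IsSemigroupGeneratedBy κ lam γ T)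
    (t : Fin n → ℝ≥0) (φ : Fin n → TestFn) :
    TendstoInDistribution (fun N ω i => totalField ρ N (η N) (t i) (φ i) ω) atTop
      (fun x : Fin n → ℝ => x) PN (gaussianPi (covMatrix ρ T t φ)) := by
  obtain ⟨hS, h⟩ := posSemidef_covMatrix_and_tendsto hκ hlam hγ hη hT t φ
  exact tendstoInDistribution_gaussianPi
    (fun N => measurable_pi_lambda _ fun i => measurable_totalField (hη N) (t i) (φ i)) hS h

end Convergence

/-! ### The limiting field -/

section LimitField

variable {Ω : Type*} [MeasurableSpace Ω] {P : Measure Ω} {Z : ℝ≥0 → Ω → Distr}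
  {ρ : ℝ≥0} {T : ℝ≥0 → LayerL2 →L[ℝ] LayerL2}

/-- The finite-dimensional distributions of `Z` are centred Gaussian, with the limiting covariance
matrices. -/
structure IsGaussianField (ρ : ℝ≥0) (T : ℝ≥0 → LayerL2 →L[ℝ] LayerL2) (P : Measure Ω)
    (Z : ℝ≥0 → Ω → Distr) : Prop where
  measurable : ∀ t φ, Measurable fun ω => Z t ω φ
  posSemidef : ∀ (n : ℕ) (t : Fin n → ℝ≥0) (φ : Fin n → TestFn), (covMatrix ρ T t φ).PosSemidef
  map_eq : ∀ (n : ℕ) (t : Fin n → ℝ≥0) (φ : Fin n → TestFn),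
    P.map (fun ω i => Z (t i) ω (φ i)) = gaussianPi (covMatrix ρ T t φ)

theorem IsFluctuationLimit.isGaussianField {κ lam γ : ℝ} (hκ : 0 ≤ κ) (hlam : 0 ≤ lam) (hγ : 0 ≤ γ)
    {Ω' : ℕ+ → Type*} [∀ N, MeasurableSpace (Ω' N)] {PN : ∀ N, Measure (Ω' N)}
    [∀ N, IsProbabilityMeasure (PN N)] {η : ∀ N, ℝ≥0 → Ω' N → Site → ℕ}
    (hη : ∀ N, IsRunAndTumble κ lam γ ρ N (PN N) (η N)) (hT : IsSemigroupGeneratedBy κ lam γ T)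
    [IsProbabilityMeasure P]
    (hZ : IsFluctuationLimit PN (fun N => totalField ρ N (η N)) P Z) : IsGaussianField ρ T P Z where
  measurable := hZ.1
  posSemidef _ := posSemidef_covMatrix hκ hlam hγ hη hT
  map_eq n t φ := by
    rw [tendstoInDistribution_unique _ (hZ.2 n t φ)
      (tendstoInDistribution_totalField hκ hlam hγ hη hT t φ), Measure.map_id']

namespace IsGaussianField

theorem integral_comp (h : IsGaussianField ρ T P Z) {n : ℕ} (t : Fin n → ℝ≥0) (φ : Fin n → TestFn)
    {f : (Fin n → ℝ) → ℝ} (hf : Measurable f) :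
    ∫ ω, f (fun i => Z (t i) ω (φ i)) ∂P = ∫ x, f x ∂gaussianPi (covMatrix ρ T t φ) := by
  rw [← h.map_eq, integral_map
    (measurable_pi_lambda _ fun i => h.measurable (t i) (φ i)).aemeasurable hf.aestronglyMeasurable]

theorem isGaussian (h : IsGaussianField ρ T P Z) :
    IsGaussianProcess (fun (q : ℝ≥0 × TestFn) ω => Z q.1 ω q.2) P where
  hasGaussianLaw I := by
    classical
    have h1 : HasGaussianLaw (fun ω (i : Fin I.card) =>
        Z (I.equivFin.symm i).1.1 ω (I.equivFin.symm i).1.2) P :=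
      ⟨by rw [h.map_eq]; exact isGaussian_gaussianPi⟩
    have h2 := h1.map_equiv
      (ContinuousLinearEquiv.piCongrLeft ℝ (fun _ : I => ℝ) I.equivFin.symm)
    convert! h2 using 1
    ext ω q
    obtain ⟨i, rfl⟩ := I.equivFin.symm.surjective q
    exact (Equiv.piCongrLeft_apply_apply (fun _ : I => ℝ) I.equivFin.symm
      (fun i => Z (I.equivFin.symm i).1.1 ω (I.equivFin.symm i).1.2) i).symm

theorem integral_eq_zero (h : IsGaussianField ρ T P Z) (t : ℝ≥0) (φ : TestFn) :
    ∫ ω, Z t ω φ ∂P = 0 := by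
  have h1 := h.integral_comp (n := 1) (fun _ => t) (fun _ => φ) (measurable_pi_apply 0)
  rwa [integral_eval_gaussianPi] at h1

theorem memLp_two (h : IsGaussianField ρ T P Z) (t : ℝ≥0) (φ : TestFn) :
    MemLp (fun ω => Z t ω φ) 2 P :=
  (h.isGaussian.hasGaussianLaw_eval (t, φ)).memLp_two

theorem integrable_mul (h : IsGaussianField ρ T P Z) (s t : ℝ≥0) (φ ψ : TestFn) :
    Integrable (fun ω => Z s ω φ * Z t ω ψ) P :=
  (h.memLp_two s φ).integrable_mul (h.memLp_two t ψ)

theorem integral_mul (h : IsGaussianField ρ T P Z) (s t : ℝ≥0) (φ ψ : TestFn) :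
    ∫ ω, Z s ω φ * Z t ω ψ ∂P = ρ * timeCov (limitCov T) s t φ ψ := by
  have h1 := h.integral_comp ![s, t] ![φ, ψ] (f := fun x => x 0 * x 1)
    ((measurable_pi_apply 0).mul (measurable_pi_apply 1))
  rw [integral_mul_gaussianPi (h.posSemidef _ _ _)] at h1
  simpa [covMatrix] using h1

/-- Centred Gaussian laws are determined by their covariance matrices, and these involve only time
differences. -/
theorem isStationary (h : IsGaussianField ρ T P Z) : IsStationaryProcess P Z := by
  intro n t φ s
  refine ⟨(measurable_pi_lambda _ fun i => h.measurable _ _).aemeasurable,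
    (measurable_pi_lambda _ fun i => h.measurable _ _).aemeasurable, ?_⟩
  rw [h.map_eq, h.map_eq]
  congr 1
  ext i j
  simp [covMatrix, timeCov, add_tsub_add_eq_tsub_right]

end IsGaussianField

end LimitField

/-! ### Gaussian Hilbert spaces -/

section GaussianHilbertSpace

variable {Ω : Type*} [MeasurableSpace Ω] {P : Measure Ω} [IsProbabilityMeasure P]

theorem inner_L2_eq_integral (f g : Lp ℝ 2 P) : ⟪f, g⟫ = ∫ ω, f ω * g ω ∂P := by
  rw [L2.inner_def]
  refine integral_congr_ae (Eventually.of_forall fun ω => ?_)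
  simp [mul_comm]

theorem integral_abs_le_norm (f : Lp ℝ 2 P) : ∫ ω, |f ω| ∂P ≤ ‖f‖ := by
  have h1 : ∫ ω, ‖f ω‖ ∂P = (eLpNorm f 1 P).toReal := by
    rw [eLpNorm_one_eq_lintegral_enorm, integral_norm_eq_lintegral_enorm
      (Lp.aestronglyMeasurable f)]
  simp_rw [← Real.norm_eq_abs]
  rw [h1, Lp.norm_def]
  exact ENNReal.toReal_mono (Lp.eLpNorm_ne_top f)
    (eLpNorm_le_eLpNorm_of_exponent_le (by norm_num) (Lp.aestronglyMeasurable f))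

theorem norm_exp_mul_I_sub_exp_le (x y : ℝ) :
    ‖Complex.exp (x * Complex.I) - Complex.exp (y * Complex.I)‖ ≤ |x - y| := by
  have h : Complex.exp (x * Complex.I) - Complex.exp (y * Complex.I) =
      Complex.exp (y * Complex.I) * (Complex.exp (Complex.I * (x - y : ℝ)) - 1) := by
    rw [mul_sub, ← Complex.exp_add, mul_one]
    congr 2
    push_cast
    ring
  rw [h, norm_mul, Complex.norm_exp_ofReal_mul_I, one_mul]
  exact Real.norm_exp_I_mul_ofReal_sub_one_le

theorem continuous_integral_exp_mul_I :
    Continuous fun f : Lp ℝ 2 P => ∫ ω, Complex.exp (f ω * Complex.I) ∂P := by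
  have hint : ∀ f : Lp ℝ 2 P, Integrable (fun ω => Complex.exp (f ω * Complex.I)) P := fun f =>
    Integrable.of_bound (by have := Lp.stronglyMeasurable f; fun_prop) 1
      (Eventually.of_forall fun ω => (Complex.norm_exp_ofReal_mul_I _).le)
  refine (LipschitzWith.of_dist_le' (K := 1) fun f g => ?_).continuous
  rw [dist_eq_norm, dist_eq_norm, one_mul, ← integral_sub (hint f) (hint g)]
  refine (norm_integral_le_integral_norm _).trans (le_trans ?_ (integral_abs_le_norm (f - g)))
  refine integral_mono_ae ((hint f).sub (hint g)).norm ((Lp.memLp (f - g)).integrable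
    (by norm_num)).abs ?_
  filter_upwards [Lp.coeFn_sub f g] with ω hω
  rw [hω]
  exact norm_exp_mul_I_sub_exp_le _ _

/-- The law of `f` is centred Gaussian. -/
def IsCentredGaussian (f : Lp ℝ 2 P) : Prop :=
  ∫ ω, Complex.exp (f ω * Complex.I) ∂P = Complex.exp (-(‖f‖ ^ 2 : ℝ) / 2)

/-- Both sides of the defining identity are continuous on `L²(P)`. Gaussianity thus extends to
closed spans, where orthogonal projections live. -/
theorem isClosed_isCentredGaussian : IsClosed {f : Lp ℝ 2 P | IsCentredGaussian f} :=
  isClosed_eq continuous_integral_exp_mul_I (by fun_prop)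

theorem isCentredGaussian_topologicalClosure {S : Submodule ℝ (Lp ℝ 2 P)}
    (hS : ∀ f ∈ S, IsCentredGaussian f) : ∀ f ∈ S.topologicalClosure, IsCentredGaussian f :=
  fun _ hf => closure_minimal (s := (S : Set (Lp ℝ 2 P))) hS isClosed_isCentredGaussian hf

variable {S : Submodule ℝ (Lp ℝ 2 P)}

/-- The hypothesis fixes the characteristic function at `1` only; applying it to all multiples `t •
f` in the subspace recovers it everywhere. -/
theorem map_eq_gaussianReal_of_mem (hS : ∀ f ∈ S, IsCentredGaussian f) {f : Lp ℝ 2 P} (hf : f ∈ S) :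
    P.map f = gaussianReal 0 (‖f‖₊ ^ 2) := by
  have : IsProbabilityMeasure (P.map f) :=
    Measure.isProbabilityMeasure_map (Lp.aestronglyMeasurable f).aemeasurable
  refine Measure.ext_of_charFun (funext fun t => ?_)
  rw [charFun_gaussianReal, charFun_apply_real, integral_map
    (Lp.aestronglyMeasurable f).aemeasurable (by fun_prop)]
  have h := hS (t • f) (S.smul_mem t hf)
  rw [IsCentredGaussian, norm_smul] at h
  convert h using 1
  · refine integral_congr_ae ?_
    filter_upwards [Lp.coeFn_smul t f] with ω hω
    simp [hω]
  · congr 1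
    push_cast
    rw [mul_pow]
    norm_cast
    rw [Real.norm_eq_abs, sq_abs]
    push_cast
    ring

/-- Every linear functional of finitely many of the variables is again an element of `S`, hence
Gaussian. -/
theorem isGaussianProcess_of_forall_mem (hS : ∀ f ∈ S, IsCentredGaussian f) {ι : Type*}
    {f : ι → Lp ℝ 2 P} (hf : ∀ i, f i ∈ S) : IsGaussianProcess (fun i ω => f i ω) P where
  hasGaussianLaw I := by
    have hm : AEMeasurable (fun ω => I.restrict fun i => f i ω) P :=
      aemeasurable_pi_lambda _ fun i => (Lp.aestronglyMeasurable (f i)).aemeasurable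
    refine ⟨isGaussian_of_map_eq_gaussianReal fun L => ⟨0, ?_⟩⟩
    classical
    refine ⟨‖∑ i : I, L (Pi.single i 1) • f i‖₊ ^ 2, ?_⟩
    have hmem : ∑ i : I, L (Pi.single i 1) • f i ∈ S :=
      S.sum_mem fun i _ => S.smul_mem _ (hf i)
    rw [← map_eq_gaussianReal_of_mem hS hmem,
      AEMeasurable.map_map_of_aemeasurable (by fun_prop) hm]
    refine Measure.map_congr ?_
    have h1 : ∀ᵐ ω ∂P, ∀ i : I, (L (Pi.single i 1) • f i : Lp ℝ 2 P) ω =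
        L (Pi.single i 1) * f i ω := ae_all_iff.2 fun i => Lp.coeFn_smul _ _
    filter_upwards [h1, Lp.coeFn_finsetSum Finset.univ fun i : I => L (Pi.single i 1) • f i]
      with ω h1 h2
    rw [h2]
    simp_rw [Finset.sum_apply, h1]
    have h3 : (I.restrict fun i => f i ω) =
        ∑ i : I, (f i ω) • (Pi.single i 1 : I → ℝ) := by
      rw [← pi_eq_sum_univ']
      rfl
    simp only [Function.comp_apply, h3, map_sum, map_smul, smul_eq_mul, mul_comm]

theorem integral_eq_zero_of_mem (hS : ∀ f ∈ S, IsCentredGaussian f) {f : Lp ℝ 2 P} (hf : f ∈ S) :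
    ∫ ω, f ω ∂P = 0 := by
  have h := integral_map (Lp.aestronglyMeasurable f).aemeasurable (f := fun x : ℝ => x)
    (by fun_prop)
  rw [← h, map_eq_gaussianReal_of_mem hS hf, integral_id_gaussianReal]

/-- In a Gaussian Hilbert space, orthogonality implies independence. -/
theorem indepFun_of_inner_eq_zero (hS : ∀ f ∈ S, IsCentredGaussian f) {ι : Type*} {d : Lp ℝ 2 P}
    (hd : d ∈ S) {f : ι → Lp ℝ 2 P} (hf : ∀ i, f i ∈ S) (h : ∀ i, ⟪d, f i⟫ = 0) :
    IndepFun d (fun ω i => f i ω) P := by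
  have h1 : IsGaussianProcess (Sum.elim (fun (_ : Unit) ω => d ω) fun i ω => f i ω) P := by
    convert! isGaussianProcess_of_forall_mem hS (f := Sum.elim (fun _ : Unit => d) f)
      (by rintro (_ | i); exacts [hd, hf i]) using 1
    funext q
    rcases q with _ | i <;> rfl
  have h2 := h1.indepFun_of_covariance_eq_zero
    (fun _ => (Lp.aestronglyMeasurable d).aemeasurable)
    (fun i => (Lp.aestronglyMeasurable (f i)).aemeasurable) fun _ i => by
      refine Eq.trans ?_ ((inner_L2_eq_integral d (f i)).symm.trans (h i))
      rw [covariance, integral_eq_zero_of_mem hS hd, integral_eq_zero_of_mem hS (hf i)]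
      simp
  exact h2.comp (φ := fun x : Unit → ℝ => x ()) (ψ := id) (measurable_pi_apply _) measurable_id

end GaussianHilbertSpace

/-! ### Markovian Gaussian fields -/

section MarkovField

variable {Ω : Type*} [mΩ : MeasurableSpace Ω] {P : Measure Ω} [IsProbabilityMeasure P]
  {Z : ℝ≥0 → Ω → Distr} {ρ : ℝ≥0} {T : ℝ≥0 → LayerL2 →L[ℝ] LayerL2}

/-- Equality of conditional probabilities implies equality of conditional expectations. -/
theorem condExp_ae_eq_of_forall_measurableSet {Ω : Type*} {m m₁ m₂ mΩ : MeasurableSpace Ω}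
    {P : Measure Ω} [IsProbabilityMeasure P] (hm : m ≤ mΩ)
    (hm₁ : m₁ ≤ mΩ) (hm₂ : m₂ ≤ mΩ) (h : ∀ B, MeasurableSet[m] B → P⟦B | m₁⟧ =ᵐ[P] P⟦B | m₂⟧) {f : Ω → ℝ} (hf : Integrable f P)
    (hfm : AEStronglyMeasurable[m] f P) : P[f | m₁] =ᵐ[P] P[f | m₂] := by
  refine MemLp.induction_stronglyMeasurable (p := 1) hm (by norm_num)
    (fun f => P[f | m₁] =ᵐ[P] P[f | m₂]) ?_ ?_ ?_ ?_ (memLp_one_iff_integrable.2 hf) hfm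
  · intro c B hB _
    have h1 : B.indicator (fun _ => c) = c • B.indicator fun _ => (1 : ℝ) := by
      ext ω
      by_cases hω : ω ∈ B <;> simp [hω]
    rw [h1]
    exact (condExp_smul c _ _).trans (((h B hB).fun_const_smul c).trans (condExp_smul c _ _).symm)
  · intro f g _ hf hg _ _ h1 h2
    have hf' := memLp_one_iff_integrable.1 hf
    have hg' := memLp_one_iff_integrable.1 hg
    exact (condExp_add hf' hg' _).trans ((h1.add h2).trans (condExp_add hf' hg' _).symm)
  -- Conditional expectation is a continuous operator on `L¹`, so the functions with equal
  -- conditional expectations form a closed set.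
  · have hc : ∀ {m' : MeasurableSpace Ω} (hm' : m' ≤ mΩ) (f : Lp ℝ 1 P),
        P[f | m'] =ᵐ[P] condExpL1CLM ℝ hm' P f := fun hm' f => by
      have hf := L1.integrable_coeFn f
      have h1 := condExp_ae_eq_condExpL1CLM hm' hf
      rwa [Integrable.toL1_coeFn] at h1
    have h1 : {f : lpMeas ℝ ℝ m 1 P | P[((f : Lp ℝ 1 P) : Ω → ℝ) | m₁] =ᵐ[P]
        P[((f : Lp ℝ 1 P) : Ω → ℝ) | m₂]} =
        {f : lpMeas ℝ ℝ m 1 P | condExpL1CLM ℝ hm₁ P f = condExpL1CLM ℝ hm₂ P f} := by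
      ext f
      rw [Set.mem_ofPred_eq, Set.mem_ofPred_eq]
      exact ⟨fun hf => Lp.ext ((hc hm₁ f).symm.trans (hf.trans (hc hm₂ f))), fun hf =>
        (hc hm₁ f).trans ((Lp.ext_iff.1 hf).trans (hc hm₂ f).symm)⟩
    rw [h1]
    exact isClosed_eq (by fun_prop) (by fun_prop)
  · intro f g hfg _ h1
    exact (condExp_congr_ae hfg.symm).trans (h1.trans (condExp_congr_ae hfg))

theorem sigmaAt_le (hZ : ∀ t φ, Measurable fun ω => Z t ω φ) (t : ℝ≥0) : sigmaAt Z t ≤ mΩ :=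
  iSup_le fun φ => (hZ t φ).comap_le

theorem sigmaUpTo_le (hZ : ∀ t φ, Measurable fun ω => Z t ω φ) (s : ℝ≥0) : sigmaUpTo Z s ≤ mΩ :=
  iSup₂_le fun t _ => sigmaAt_le hZ t

theorem measurable_sigmaAt (t : ℝ≥0) (φ : TestFn) : Measurable[sigmaAt Z t] fun ω => Z t ω φ :=
  (comap_measurable fun ω => Z t ω φ).mono
    (le_iSup (fun φ : TestFn => MeasurableSpace.comap (fun ω => Z t ω φ) inferInstance) φ) le_rfl

theorem sigmaAt_le_sigmaUpTo {r s : ℝ≥0} (h : r ≤ s) : sigmaAt Z r ≤ sigmaUpTo Z s :=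
  le_iSup₂ (f := fun (r : ℝ≥0) (_ : r ≤ s) => sigmaAt Z r) r h

namespace IsGaussianField

/-- The field at time `t` as a linear map into `L²(P)`. -/
def toLp (h : IsGaussianField ρ T P Z) (t : ℝ≥0) : TestFn →ₗ[ℝ] Lp ℝ 2 P where
  toFun φ := (h.memLp_two t φ).toLp _
  map_add' φ ψ := by
    rw [← MemLp.toLp_add]
    congr 1
    ext ω
    simp
  map_smul' c φ := by
    rw [RingHom.id_apply, ← MemLp.toLp_const_smul]
    congr 1
    ext ω
    simp

theorem coeFn_toLp (h : IsGaussianField ρ T P Z) (t : ℝ≥0) (φ : TestFn) :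
    h.toLp t φ =ᵐ[P] fun ω => Z t ω φ := (h.memLp_two t φ).coeFn_toLp

theorem inner_toLp (h : IsGaussianField ρ T P Z) (s t : ℝ≥0) (φ ψ : TestFn) :
    ⟪h.toLp s φ, h.toLp t ψ⟫ = ρ * timeCov (limitCov T) s t φ ψ := by
  rw [inner_L2_eq_integral, ← h.integral_mul]
  refine integral_congr_ae ?_
  filter_upwards [h.coeFn_toLp s φ, h.coeFn_toLp t ψ] with ω h1 h2
  rw [h1, h2]

/-- The linear span of the field. -/
def span (h : IsGaussianField ρ T P Z) : Submodule ℝ (Lp ℝ 2 P) :=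
  Submodule.span ℝ (Set.range fun q : ℝ≥0 × TestFn => h.toLp q.1 q.2)

theorem toLp_mem_span (h : IsGaussianField ρ T P Z) (t : ℝ≥0) (φ : TestFn) :
    h.toLp t φ ∈ h.span := Submodule.subset_span ⟨(t, φ), rfl⟩

theorem isCentredGaussian_of_mem_span (h : IsGaussianField ρ T P Z) :
    ∀ f ∈ h.span, IsCentredGaussian f := by
  intro f hf
  obtain ⟨c, rfl⟩ := Finsupp.mem_span_range_iff_exists_finsupp.1 hf
  set f := c.sum fun q a => a • h.toLp q.1 q.2 with hfdef
  have h1 : HasGaussianLaw (fun ω => ∑ q ∈ c.support, c q • Z q.1 ω q.2) P :=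
    (h.isGaussian.smul c).hasGaussianLaw_fun_sum
  have h2 : f =ᵐ[P] fun ω => ∑ q ∈ c.support, c q • Z q.1 ω q.2 := by
    have h3 : ∀ᵐ ω ∂P, ∀ q : c.support, (c q • h.toLp q.1.1 q.1.2 : Lp ℝ 2 P) ω =
        c q • Z q.1.1 ω q.1.2 := ae_all_iff.2 fun q => by
      filter_upwards [Lp.coeFn_smul (c q) (h.toLp q.1.1 q.1.2), h.coeFn_toLp q.1.1 q.1.2]
        with ω h4 h5
      rw [h4, Pi.smul_apply, h5]
    filter_upwards [h3, Lp.coeFn_finsetSum c.support fun q => c q • h.toLp q.1 q.2] with ω h4 h5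
    rw [hfdef, Finsupp.sum, h5, Finset.sum_apply]
    exact Finset.sum_congr rfl fun q hq => h4 ⟨q, hq⟩
  have h3 := h1.congr h2.symm
  have h4 : ∫ ω, f ω ∂P = 0 := by
    rw [integral_congr_ae h2, integral_finsetSum _ fun q _ =>
      ((h.memLp_two q.1 q.2).integrable (by norm_num)).fun_smul (c q)]
    refine Finset.sum_eq_zero fun q _ => ?_
    rw [integral_smul, h.integral_eq_zero, smul_zero]
  have h5 : Var[f; P] = ‖f‖ ^ 2 := by
    rw [variance_of_integral_eq_zero (Lp.aestronglyMeasurable f).aemeasurable h4,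
      ← real_inner_self_eq_norm_sq, inner_L2_eq_integral]
    simp_rw [pow_two]
  have h6 := h3.charFun_map_eq 1
  rw [charFun_apply_real, integral_map (Lp.aestronglyMeasurable f).aemeasurable (by fun_prop)] at h6
  simp only [Complex.ofReal_one, one_mul, real_inner_eq_re_inner] at h6
  rw [IsCentredGaussian]
  convert h6 using 2
  simp [h4, h5, neg_div]

/-- The closed linear span of the field at time `s`. -/
def closedRange (h : IsGaussianField ρ T P Z) (s : ℝ≥0) : Submodule ℝ (Lp ℝ 2 P) :=
  (LinearMap.range (h.toLp s)).topologicalClosure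

theorem aestronglyMeasurable_of_mem (h : IsGaussianField ρ T P Z) {s : ℝ≥0} {f : Lp ℝ 2 P}
    (hf : f ∈ h.closedRange s) : AEStronglyMeasurable[sigmaAt Z s] f P := by
  have h1 : (LinearMap.range (h.toLp s) : Set (Lp ℝ 2 P)) ⊆
      {f : Lp ℝ 2 P | AEStronglyMeasurable[sigmaAt Z s] f P} := by
    rintro _ ⟨φ, rfl⟩
    exact ⟨fun ω => Z s ω φ, (measurable_sigmaAt s φ).stronglyMeasurable, h.coeFn_toLp s φ⟩
  exact closure_minimal h1 (isClosed_aestronglyMeasurable (sigmaAt_le h.measurable s)) hf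

/-- Conditional expectations given the field at one time are orthogonal projections. -/
theorem condExp_sigmaAt (h : IsGaussianField ρ T P Z) {s t : ℝ≥0} {φ : TestFn} {π : Lp ℝ 2 P}
    (hπ : π ∈ h.closedRange s) (horth : ∀ ψ, ⟪h.toLp t φ - π, h.toLp s ψ⟫ = 0) :
    P[fun ω => Z t ω φ | sigmaAt Z s] =ᵐ[P] π := by
  have hS := isCentredGaussian_topologicalClosure h.isCentredGaussian_of_mem_span
  have hmem : ∀ r ψ, h.toLp r ψ ∈ h.span.topologicalClosure := fun r ψ =>
    h.span.le_topologicalClosure (h.toLp_mem_span r ψ)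
  have hπ' : π ∈ h.span.topologicalClosure := by
    refine Submodule.topologicalClosure_mono ?_ hπ
    rintro _ ⟨ψ, rfl⟩
    exact h.toLp_mem_span s ψ
  -- The residual is orthogonal to the present field, hence independent of it, and being centred it
  -- has conditional expectation `0`.
  have hind := indepFun_of_inner_eq_zero hS (sub_mem (hmem t φ) hπ') (hmem s) horth
  set d := h.toLp t φ - π with hd
  have hind' : IndepFun d (fun ω ψ => Z s ω ψ) P :=
    hind.process_congr_right (h.coeFn_toLp s)
  have hcomap : sigmaAt Z s = MeasurableSpace.comap (fun ω ψ => Z s ω ψ) MeasurableSpace.pi :=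
    (MeasurableSpace.comap_process_pi fun (ψ : TestFn) ω => Z s ω ψ).symm
  have hd0 : P[d | sigmaAt Z s] =ᵐ[P] fun _ => 0 := by
    have h1 := condExp_indep_eq (f := d) (m₁ := MeasurableSpace.comap d inferInstance)
      (Lp.stronglyMeasurable d).measurable.comap_le (sigmaAt_le h.measurable s)
      (comap_measurable d).stronglyMeasurable
      (by rw [hcomap]; exact (IndepFun_iff_Indep _ _ _).1 hind')
    rwa [integral_eq_zero_of_mem hS (sub_mem (hmem t φ) hπ')] at h1
  have hdi : Integrable d P := (Lp.memLp d).integrable (by norm_num)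
  have hπi : Integrable π P := (Lp.memLp π).integrable (by norm_num)
  have h1 : (fun ω => Z t ω φ) =ᵐ[P] d + π := by
    filter_upwards [h.coeFn_toLp t φ, Lp.coeFn_sub (h.toLp t φ) π] with ω h1 h2
    rw [Pi.add_apply, hd, h2, Pi.sub_apply, h1, sub_add_cancel]
  refine (condExp_congr_ae h1).trans ((condExp_add hdi hπi _).trans ?_)
  filter_upwards [hd0, condExp_of_aestronglyMeasurable' (sigmaAt_le h.measurable s)
    (h.aestronglyMeasurable_of_mem hπ) hπi] with ω h2 h3
  rw [Pi.add_apply, h2, h3, zero_add]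

/-- In the Markovian case the projection to the present is orthogonal to the past. -/
theorem inner_eq_zero_of_isMarkovProcess (h : IsGaussianField ρ T P Z) (hM : IsMarkovProcess P Z)
    {r s t : ℝ≥0} (hrs : r ≤ s) (hst : s ≤ t) {φ χ : TestFn} {π : Lp ℝ 2 P}
    (hπ : π ∈ h.closedRange s) (horth : ∀ ψ, ⟪h.toLp t φ - π, h.toLp s ψ⟫ = 0) :
    ⟪h.toLp t φ - π, h.toLp r χ⟫ = 0 := by
  have hle := sigmaUpTo_le h.measurable s
  have hint : ∀ t φ, Integrable (fun ω => Z t ω φ) P := fun t φ =>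
    (h.memLp_two t φ).integrable (by norm_num)
  -- The Markov property replaces the past by the present, and conditioning on the present is the
  -- projection.
  have h1 : P[fun ω => Z t ω φ | sigmaUpTo Z s] =ᵐ[P] π :=
    (condExp_ae_eq_of_forall_measurableSet (sigmaAt_le h.measurable t) hle
      (sigmaAt_le h.measurable s) (hM s t hst) (hint t φ)
      (measurable_sigmaAt t φ).aestronglyMeasurable).trans (h.condExp_sigmaAt hπ horth)
  have h2 := condExp_mul_of_stronglyMeasurable_right (m := sigmaUpTo Z s) (μ := P)
    (f := fun ω => Z t ω φ) (g := fun ω => Z r ω χ)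
    ((measurable_sigmaAt r χ).mono (sigmaAt_le_sigmaUpTo hrs) le_rfl).stronglyMeasurable
    (h.integrable_mul t r φ χ) (hint t φ)
  rw [inner_sub_left, sub_eq_zero, inner_L2_eq_integral, inner_L2_eq_integral]
  calc ∫ ω, h.toLp t φ ω * h.toLp r χ ω ∂P = ∫ ω, Z t ω φ * Z r ω χ ∂P := by
        refine integral_congr_ae ?_
        filter_upwards [h.coeFn_toLp t φ, h.coeFn_toLp r χ] with ω h3 h4
        rw [h3, h4]
    _ = ∫ ω, (P[(fun ω => Z t ω φ) * (fun ω => Z r ω χ) | sigmaUpTo Z s]) ω ∂P :=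
        (integral_condExp hle).symm
    _ = ∫ ω, π ω * h.toLp r χ ω ∂P := by
        refine integral_congr_ae ?_
        filter_upwards [h1, h2, h.coeFn_toLp r χ] with ω h3 h4 h5
        rw [h4, Pi.mul_apply, h3, h5]

end IsGaussianField

end MarkovField

/-! ### Short-time expansion of the covariance -/

section Expansion

variable {κ lam γ : ℝ} {T : ℝ≥0 → LayerL2 →L[ℝ] LayerL2}

/-- The odd extension `(x, σ) ↦ σ φ(x)`. -/
def layerOdd (φ : TestFn) : LayerTestFn := fun σ => ((σ : ℤ) : ℝ) • φ

theorem TestFn.d_add (φ ψ : TestFn) : (φ + ψ).d = φ.d + ψ.d := LineDeriv.lineDerivOp_add _ _ _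

theorem TestFn.d_smul (c : ℝ) (φ : TestFn) : (c • φ).d = c • φ.d :=
  LineDeriv.lineDerivOp_smul _ _ _

theorem limitGen_layerConst (φ : TestFn) : limitGen κ lam γ (layerConst φ) =
    κ • layerConst φ.d.d + lam • layerOdd φ.d := by
  funext σ
  simp [limitGen, layerConst, layerOdd, smul_smul, mul_comm]

/-- Odd functions have flip eigenvalue `-1`, giving the damping `-2γ`. The drift sends them back to
layer-constant ones because `σ ^ 2 = 1`. -/
theorem limitGen_layerOdd (φ : TestFn) : limitGen κ lam γ (layerOdd φ) =
    κ • layerOdd φ.d.d + lam • layerConst φ.d - (2 * γ) • layerOdd φ := by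
  funext σ
  have h : (((σ : ℤ) : ℝ)) * ((σ : ℤ) : ℝ) = 1 := by
    rcases Int.units_eq_one_or σ with rfl | rfl <;> simp
  change κ • (((σ : ℤ) : ℝ) • φ).d.d + (((σ : ℤ) : ℝ) * lam) • (((σ : ℤ) : ℝ) • φ).d +
    γ • (layerOdd φ (-σ) - layerOdd φ σ) = _
  rw [TestFn.d_smul, TestFn.d_smul, smul_smul, smul_smul _ _ φ.d,
    mul_right_comm, h]
  simp only [layerOdd, layerConst, Pi.add_apply, Pi.sub_apply, Pi.smul_apply, Units.val_neg,
    Int.cast_neg]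
  module

theorem limitGen_add (φ ψ : LayerTestFn) :
    limitGen κ lam γ (φ + ψ) = limitGen κ lam γ φ + limitGen κ lam γ ψ := by
  funext σ
  change κ • (φ σ + ψ σ).d.d + (((σ : ℤ) : ℝ) * lam) • (φ σ + ψ σ).d +
    γ • ((φ (-σ) + ψ (-σ)) - (φ σ + ψ σ)) =
    (κ • (φ σ).d.d + (((σ : ℤ) : ℝ) * lam) • (φ σ).d + γ • (φ (-σ) - φ σ)) +
    (κ • (ψ σ).d.d + (((σ : ℤ) : ℝ) * lam) • (ψ σ).d + γ • (ψ (-σ) - ψ σ))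
  rw [TestFn.d_add, TestFn.d_add]
  module

theorem limitGen_smul (c : ℝ) (φ : LayerTestFn) :
    limitGen κ lam γ (c • φ) = c • limitGen κ lam γ φ := by
  funext σ
  change κ • (c • φ σ).d.d + (((σ : ℤ) : ℝ) * lam) • (c • φ σ).d +
    γ • (c • φ (-σ) - c • φ σ) =
    c • (κ • (φ σ).d.d + (((σ : ℤ) : ℝ) * lam) • (φ σ).d + γ • (φ (-σ) - φ σ))
  rw [TestFn.d_smul, TestFn.d_smul]
  module

/-- The term with `lam ^ 2` is the excursion from constant to odd and back. It is what a closed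
evolution of the density by `κ ∂²` would miss. -/
theorem limitGen_limitGen_layerConst (φ : TestFn) :
    limitGen κ lam γ (limitGen κ lam γ (layerConst φ)) =
      κ ^ 2 • layerConst φ.d.d.d.d + lam ^ 2 • layerConst φ.d.d +
        ((2 * κ * lam) • layerOdd φ.d.d.d - (2 * γ * lam) • layerOdd φ.d) := by
  rw [limitGen_layerConst, limitGen_add, limitGen_smul, limitGen_smul, limitGen_layerConst,
    limitGen_layerOdd]
  module

theorem inner_layerOdd_layerConst (φ ψ : TestFn) :
    ⟪toL2 (layerOdd φ), toL2 (layerConst ψ)⟫ = 0 := by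
  rw [inner_toL2]
  simp [layerOdd, layerConst, UnitsInt.univ, integral_neg]

theorem inner_limitGen_layerConst (φ ψ : TestFn) :
    ⟪toL2 (limitGen κ lam γ (layerConst φ)), toL2 (layerConst ψ)⟫ =
      κ * ⟪toL2 (layerConst φ.d.d), toL2 (layerConst ψ)⟫ := by
  rw [limitGen_layerConst, toL2_add, toL2_smul, toL2_smul, inner_add_left, inner_smul_left,
    inner_smul_left, inner_layerOdd_layerConst]
  simp

theorem inner_limitGen_limitGen_layerConst (φ ψ : TestFn) :
    ⟪toL2 (limitGen κ lam γ (limitGen κ lam γ (layerConst φ))), toL2 (layerConst ψ)⟫ =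
      κ ^ 2 * ⟪toL2 (layerConst φ.d.d.d.d), toL2 (layerConst ψ)⟫ +
        lam ^ 2 * ⟪toL2 (layerConst φ.d.d), toL2 (layerConst ψ)⟫ := by
  rw [limitGen_limitGen_layerConst, toL2_add, toL2_add, toL2_sub]
  simp only [toL2_smul, inner_add_left, inner_sub_left, inner_smul_left, inner_layerOdd_layerConst]
  simp

theorem TestFn.integrable_mul (φ ψ : TestFn) : Integrable (fun x => φ x * ψ x) :=
  (φ.continuous.mul ψ.continuous).integrable_of_hasCompactSupport φ.hasCompactSupport.mul_right

theorem inner_layerConst_d_d (φ : TestFn) :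
    ⟪toL2 (layerConst φ.d.d), toL2 (layerConst φ)⟫ = -(2 * ∫ x, φ.d x * φ.d x) := by
  have h := integral_mul_deriv_eq_deriv_mul_of_integrable (u := φ) (v := φ.d) (u' := φ.d)
    (v' := φ.d.d) (fun x _ => φ.hasDerivAt x) (fun x _ => φ.d.hasDerivAt x)
    (φ.integrable_mul _) (φ.d.integrable_mul _) (φ.integrable_mul _)
  rw [inner_toL2]
  simp only [layerConst, Finset.sum_const, Finset.card_univ, Fintype.card_units_int, nsmul_eq_mul]
  simp_rw [mul_comm (φ.d.d _)]
  rw [h]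
  push_cast
  ring

/-- By parts the pairing is `-2 ∫ (φ') ^ 2`; if it vanished, a bump function would be constant. -/
theorem exists_inner_layerConst_d_d_ne_zero :
    ∃ φ : TestFn, ⟪toL2 (layerConst φ.d.d), toL2 (layerConst φ)⟫ ≠ 0 := by
  let b : ContDiffBump (0 : ℝ) := ⟨1, 2, by norm_num, by norm_num⟩
  let φ : TestFn := ⟨b, b.contDiff, b.hasCompactSupport, by simp⟩
  refine ⟨φ, fun h => ?_⟩
  rw [inner_layerConst_d_d, neg_eq_zero, mul_eq_zero_iff_left (by norm_num)] at h
  have h1 : (fun x => φ.d x * φ.d x) = 0 :=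
    (φ.d.continuous.mul φ.d.continuous).ae_eq_iff_eq volume continuous_const |>.1
      ((integral_eq_zero_iff_of_nonneg (fun x => mul_self_nonneg _) (φ.d.integrable_mul _)).1 h)
  have h2 : ∀ x, φ.d x = 0 := fun x => mul_self_eq_zero.1 (congrFun h1 x)
  have h3 : φ 0 = φ 3 := is_const_of_deriv_eq_zero (f := φ) (φ.contDiff.differentiable (by simp))
    (fun x => by rw [← TestFn.coe_d, h2]) 0 3
  have h4 : φ 0 = 1 := b.one_of_mem_closedBall (by simp [b])
  have h5 : φ 3 = 0 := b.zero_of_le_dist (by simp [b]; norm_num)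
  rw [h4, h5] at h3
  exact one_ne_zero h3

theorem IsSemigroupGeneratedBy.norm_sub_sub_sub_le (hT : IsSemigroupGeneratedBy κ lam γ T) {C : ℝ}
    {t : ℝ≥0} (hC : ∀ s ≤ t, ‖T s‖ ≤ C) (hC0 : 0 ≤ C) (φ : LayerTestFn) :
    ‖T t (toL2 φ) - toL2 φ - (t : ℝ) • toL2 (limitGen κ lam γ φ) -
      ((t : ℝ) ^ 2 / 2) • toL2 (limitGen κ lam γ (limitGen κ lam γ φ))‖ ≤ t ^ 3 *
        (C * ‖toL2 (limitGen κ lam γ (limitGen κ lam γ (limitGen κ lam γ φ)))‖) := by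
  set Aφ := limitGen κ lam γ φ
  set B := C * ‖toL2 (limitGen κ lam γ (limitGen κ lam γ Aφ))‖
  have h1 := norm_image_sub_le_of_norm_deriv_right_le_segment
    (f := fun s : ℝ => T s.toNNReal (toL2 φ) - s • toL2 Aφ - (s ^ 2 / 2) • toL2 (limitGen κ lam γ Aφ))
    (a := 0) (b := t) (C := t * (t * B))
    ((((hT.continuous _).comp continuous_real_toNNReal).sub (by fun_prop)).sub
      (by fun_prop)).continuousOn
    (fun s hs => ((hT.hasDerivWithinAt φ hs.1).sub
      ((hasDerivWithinAt_id s _).smul_const (toL2 Aφ))).sub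
      ((((hasDerivAt_pow 2 s).div_const 2).hasDerivWithinAt).smul_const _))
    (fun s hs => by
      have hst : s.toNNReal ≤ t := Real.toNNReal_le_iff_le_coe.2 hs.2.le
      have h2 := hT.norm_sub_sub_le (fun r hr => hC r (hr.trans hst)) hC0 Aφ
      rw [Real.coe_toNNReal _ hs.1] at h2
      have h3 : (((2 : ℕ) : ℝ) * s ^ (2 - 1) / 2) = s := by norm_num
      rw [one_smul, h3]
      refine h2.trans ?_
      have := hs.2.le
      have := hs.1
      gcongr)
    t ⟨t.2, le_rfl⟩
  have h4 : (t : ℝ) * (t * B) * (t - 0) = t ^ 3 * B := by ring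
  rw [h4] at h1
  simpa [hT.zero, sub_right_comm] using h1

end Expansion

/-! ### The limiting field is not Markovian -/

section NonMarkov

/-- The difference `x - y` need not be small; only its pairings with `K` are. This bounds `‖π - y‖`
by `B`, and since `x - π` is orthogonal to both `u` and `z`, only `⟪π - y, u - z⟫` remains. -/
theorem abs_inner_sub_le_of_projection {E : Type*} [NormedAddCommGroup E] [InnerProductSpace ℝ E]
    {K : Submodule ℝ E} {x y z u π : E} {B : ℝ} (hπ : π ∈ K.topologicalClosure) (hy : y ∈ K)
    (hz : z ∈ K) (horth : ∀ w ∈ K, ⟪x - π, w⟫ = 0) (hu : ⟪x - π, u⟫ = 0) (hB0 : 0 ≤ B)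
    (hB : ∀ w ∈ K, |⟪x - y, w⟫| ≤ B * ‖w‖) :
    |⟪x - y, u⟫ - ⟪x - y, z⟫| ≤ B * ‖u - z‖ := by
  have h1 : ∀ w ∈ K, ⟪π - y, w⟫ = ⟪x - y, w⟫ := fun w hw => by
    have := horth w hw
    simp only [inner_sub_left] at this ⊢
    linarith
  have h2 : ∀ w ∈ K.topologicalClosure, |⟪π - y, w⟫| ≤ B * ‖w‖ := fun w hw => by
    refine closure_minimal (s := (K : Set E)) (t := {w | |⟪π - y, w⟫| ≤ B * ‖w‖})
      (fun w hw => ?_) (isClosed_le (by fun_prop) (by fun_prop)) hw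
    rw [Set.mem_ofPred_eq, h1 w hw]
    exact hB w hw
  have h3 : ‖π - y‖ ≤ B := by
    have h4 := h2 (π - y) (sub_mem hπ (K.le_topologicalClosure hy))
    rw [real_inner_self_eq_norm_mul_norm, abs_of_nonneg (by positivity)] at h4
    rcases (norm_nonneg (π - y)).eq_or_lt with h5 | h5
    · rwa [← h5]
    · exact le_of_mul_le_mul_right h4 h5
  have h5 : ⟪x - y, u⟫ - ⟪x - y, z⟫ = ⟪π - y, u - z⟫ := by
    rw [← h1 z hz, inner_sub_right (𝕜 := ℝ) (π - y)]
    have := hu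
    simp only [inner_sub_left] at this ⊢
    linarith
  rw [h5]
  exact (abs_real_inner_le_norm _ _).trans (by gcongr)

variable {κ lam γ : ℝ} {T : ℝ≥0 → LayerL2 →L[ℝ] LayerL2} {ρ : ℝ≥0}

/-- The defect of the Chapman-Kolmogorov equation for the first-order approximation of the best
linear predictor. -/
def markovDefect (κ : ℝ) (T : ℝ≥0 → LayerL2 →L[ℝ] LayerL2) (φ : TestFn) (h : ℝ≥0) : ℝ :=
  limitCov T (2 * h) φ φ - 2 * limitCov T h φ φ + limitCov T 0 φ φ
    - h * κ * (limitCov T h φ.d.d φ - limitCov T 0 φ.d.d φ)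

/-- The second difference contributes `h ^ 2 ⟪A ^ 2 φ̄, φ̄⟫`, and the correction removes its `κ ^ 2`
part. The drift part survives. -/
theorem exists_markovDefect_expansion (hT : IsSemigroupGeneratedBy κ lam γ T) (φ : TestFn) :
    ∃ K, ∀ h : ℝ≥0, h ≤ 1 → |markovDefect κ T φ h -
      h ^ 2 * (lam ^ 2 * ⟪toL2 (layerConst φ.d.d), toL2 (layerConst φ)⟫)| ≤ K * h ^ 3 := by
  obtain ⟨C, hC1, hC⟩ := hT.exists_norm_le 2
  have hC0 : 0 ≤ C := zero_le_one.trans hC1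
  set f := layerConst φ
  set f2 := layerConst φ.d.d
  set A := limitGen κ lam γ
  set e := fun h : ℝ≥0 => T h (toL2 f) - toL2 f - (h : ℝ) • toL2 (A f) -
      ((h : ℝ) ^ 2 / 2) • toL2 (A (A f)) with he
  set e2 := fun h : ℝ≥0 => T h (toL2 f2) - toL2 f2 - (h : ℝ) • toL2 (A f2) with he2
  set B := C * ‖toL2 (A (A (A f)))‖
  set B2 := C * ‖toL2 (A (A f2))‖
  have heB : ∀ h ≤ 2, ‖e h‖ ≤ h ^ 3 * B := fun h hh =>
    hT.norm_sub_sub_sub_le (fun s hs => hC s (hs.trans hh)) hC0 f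
  have he2B : ∀ h ≤ 2, ‖e2 h‖ ≤ h * (h * B2) := fun h hh =>
    hT.norm_sub_sub_le (fun s hs => hC s (hs.trans hh)) hC0 f2
  -- Here `10 = 2 ^ 3 + 2`, from the cubic remainders at times `2h` and `h`.
  refine ⟨(10 * B + |κ| * B2) * ‖toL2 f‖, fun h hh => ?_⟩
  have hh2 : h ≤ 2 := hh.trans (by norm_num)
  have h2h : 2 * h ≤ 2 := by simpa using mul_le_mul_right hh 2
  have hid : markovDefect κ T φ h - h ^ 2 * (lam ^ 2 * ⟪toL2 f2, toL2 f⟫) =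
      ⟪e (2 * h), toL2 f⟫ - 2 * ⟪e h, toL2 f⟫ - h * κ * ⟪e2 h, toL2 f⟫ := by
    have h1 := inner_limitGen_limitGen_layerConst (κ := κ) (lam := lam) (γ := γ) φ φ
    have h2 := inner_limitGen_layerConst (κ := κ) (lam := lam) (γ := γ) φ.d.d φ
    simp only [he, he2, markovDefect, limitCov, inner_sub_left, inner_smul_left, hT.zero,
      ContinuousLinearMap.id_apply]
    change _ = _ at h1
    rw [h1, h2]
    push_cast
    simp
    ring
  rw [hid]
  have hb1 : |⟪e (2 * h), toL2 f⟫| ≤ (2 * h) ^ 3 * B * ‖toL2 f‖ :=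
    (abs_real_inner_le_norm _ _).trans
      (mul_le_mul_of_nonneg_right (by simpa using heB _ h2h) (norm_nonneg _))
  have hb2 : |2 * ⟪e h, toL2 f⟫| ≤ 2 * (h ^ 3 * B * ‖toL2 f‖) := by
    rw [abs_mul, abs_two]
    exact mul_le_mul_of_nonneg_left ((abs_real_inner_le_norm _ _).trans
      (mul_le_mul_of_nonneg_right (heB _ hh2) (norm_nonneg _))) (by norm_num)
  have hb3 : |h * κ * ⟪e2 h, toL2 f⟫| ≤ h * |κ| * (h * (h * B2) * ‖toL2 f‖) := by
    rw [abs_mul, abs_mul, NNReal.abs_eq]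
    exact mul_le_mul_of_nonneg_left ((abs_real_inner_le_norm _ _).trans
      (mul_le_mul_of_nonneg_right (he2B _ hh2) (norm_nonneg _))) (by positivity)
  refine (abs_sub _ _).trans ((add_le_add ((abs_sub _ _).trans (add_le_add hb1 hb2)) hb3).trans
    (le_of_eq ?_))
  ring

variable {Ω : Type*} [MeasurableSpace Ω] {P : Measure Ω} [IsProbabilityMeasure P]
  {Z : ℝ≥0 → Ω → Distr}

/-- An approximation of the linear predictor to order `h ^ 2`, tested against an increment of the
field of size `√h`. The gain over `h ^ 2` is what contradicts the expansion. -/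
theorem IsGaussianField.exists_markovDefect_le (hZ : IsGaussianField ρ T P Z)
    (hT : IsSemigroupGeneratedBy κ lam γ T) (hM : IsMarkovProcess P Z) (φ : TestFn) :
    ∃ K, ∀ h : ℝ≥0, h ≤ 1 → |ρ * markovDefect κ T φ h| ≤ K * (h ^ 2 * √h) := by
  obtain ⟨C, hC1, hC⟩ := hT.exists_norm_le 1
  have hC0 : 0 ≤ C := zero_le_one.trans hC1
  set f := layerConst φ
  set A := limitGen κ lam γ
  set B2 := C * ‖toL2 (A (A f))‖
  set B1 := C * ‖toL2 (A f)‖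
  refine ⟨√ρ * B2 * √(2 * ρ * (B1 * ‖toL2 f‖)), fun h hh => ?_⟩
  have hcov : ∀ {s t : ℝ≥0} (_ : t ≤ s) (φ ψ : TestFn),
      ⟪hZ.toLp s φ, hZ.toLp t ψ⟫ = ρ * limitCov T (s - t) φ ψ := fun hst φ ψ => by
    rw [hZ.inner_toLp, timeCov, if_pos hst]
  have hnorm : ∀ ψ, ‖hZ.toLp h ψ‖ = √ρ * ‖toL2 (layerConst ψ)‖ := fun ψ => by
    rw [← sq_eq_sq₀ (norm_nonneg _) (by positivity), ← real_inner_self_eq_norm_sq, hcov le_rfl,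
      tsub_self, limitCov, hT.zero, mul_pow, Real.sq_sqrt ρ.coe_nonneg, ContinuousLinearMap.id_apply,
      real_inner_self_eq_norm_sq]
  have hhle : h ≤ 2 * h := by rw [two_mul]; exact le_self_add
  have hsub : 2 * h - h = h := by rw [two_mul, add_tsub_cancel_right]
  set x := hZ.toLp (2 * h) φ
  -- First-order guess for the predictor. Against layer-constant functions the odd part of `A φ̄` is
  -- invisible, so only `κ φ''` enters.
  set y := hZ.toLp h (φ + (h * κ : ℝ) • φ.d.d) with hy
  have hxy : ∀ ψ, ⟪x - y, hZ.toLp h ψ⟫ = ρ * (limitCov T h φ ψ - limitCov T 0 φ ψ -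
      h * κ * limitCov T 0 φ.d.d ψ) := fun ψ => by
    rw [hy, map_add, map_smul, inner_sub_left, inner_add_left, inner_smul_left, hcov hhle,
      hcov le_rfl, hcov le_rfl, hsub, tsub_self]
    simp
    ring
  set K := hZ.closedRange h
  have : CompleteSpace K := (Submodule.isClosed_topologicalClosure _).completeSpace_coe
  set π := K.starProjection x
  have hπ : π ∈ K := K.starProjection_apply_mem x
  have horth : ∀ ψ, ⟪x - π, hZ.toLp h ψ⟫ = 0 := fun ψ =>
    Submodule.inner_left_of_mem_orthogonal
      (Submodule.le_topologicalClosure _ (LinearMap.mem_range_self (hZ.toLp h) ψ))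
      (K.sub_starProjection_mem_orthogonal x)
  have hu := hZ.inner_eq_zero_of_isMarkovProcess hM (zero_le : 0 ≤ h) hhle (χ := φ) hπ horth
  have hmain := abs_inner_sub_le_of_projection (u := hZ.toLp 0 φ) (z := hZ.toLp h φ)
    (B := √ρ * (h * (h * B2))) hπ (LinearMap.mem_range_self (hZ.toLp h) _)
    (LinearMap.mem_range_self (hZ.toLp h) _) (by rintro _ ⟨ψ, rfl⟩; exact horth ψ) hu
    (by positivity) (by
      rintro _ ⟨ψ, rfl⟩
      have h1 : limitCov T h φ ψ - limitCov T 0 φ ψ - h * κ * limitCov T 0 φ.d.d ψ =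
          ⟪T h (toL2 f) - toL2 f - (h : ℝ) • toL2 (A f), toL2 (layerConst ψ)⟫ := by
        rw [inner_sub_left, inner_sub_left, inner_smul_left, inner_limitGen_layerConst, limitCov,
          limitCov, limitCov, hT.zero]
        simp [f, mul_assoc]
      rw [hxy, h1, hnorm, abs_mul, NNReal.abs_eq]
      have h2 := (abs_real_inner_le_norm (T h (toL2 f) - toL2 f - (h : ℝ) • toL2 (A f))
        (toL2 (layerConst ψ))).trans (mul_le_mul_of_nonneg_right
          (hT.norm_sub_sub_le (fun s hs => hC s (hs.trans hh)) hC0 f) (norm_nonneg _))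
      refine (mul_le_mul_of_nonneg_left h2 ρ.coe_nonneg).trans (le_of_eq ?_)
      nth_rewrite 1 [← Real.mul_self_sqrt ρ.coe_nonneg]
      ring)
  have hid : ⟪x - y, hZ.toLp 0 φ⟫ - ⟪x - y, hZ.toLp h φ⟫ = ρ * markovDefect κ T φ h := by
    rw [hxy, hy, map_add, map_smul, inner_sub_left, inner_add_left, inner_smul_left, hcov zero_le,
      hcov zero_le, hcov zero_le, tsub_zero, tsub_zero, markovDefect]
    simp
    ring
  -- The squared distance is `2ρ` times the loss of covariance over time `h`, and that loss is
  -- linear in `h`.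
  have hdist : ‖hZ.toLp 0 φ - hZ.toLp h φ‖ ≤ √(2 * ρ * (B1 * ‖toL2 f‖)) * √h := by
    rw [← Real.sqrt_mul (by positivity)]
    refine Real.le_sqrt_of_sq_le ?_
    rw [norm_sub_sq_real, real_inner_comm, hcov zero_le, ← real_inner_self_eq_norm_sq,
      ← real_inner_self_eq_norm_sq, hcov le_rfl, hcov le_rfl, tsub_self, tsub_self, tsub_zero]
    have h1 : limitCov T 0 φ φ - limitCov T h φ φ ≤ h * B1 * ‖toL2 f‖ := by
      have h2 : limitCov T 0 φ φ - limitCov T h φ φ = -⟪T h (toL2 f) - toL2 f, toL2 f⟫ := by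
        rw [inner_sub_left, limitCov, limitCov, hT.zero]
        simp [f]
      rw [h2]
      refine (neg_le_abs _).trans ((abs_real_inner_le_norm _ _).trans ?_)
      gcongr
      exact hT.norm_sub_le (fun s hs => hC s (hs.trans hh)) f
    have h3 := mul_le_mul_of_nonneg_left h1 ρ.coe_nonneg
    linarith
  rw [hid] at hmain
  refine hmain.trans ((mul_le_mul_of_nonneg_left hdist (by positivity)).trans (le_of_eq ?_))
  ring

theorem IsGaussianField.not_isMarkov (hZ : IsGaussianField ρ T P Z)
    (hT : IsSemigroupGeneratedBy κ lam γ T) (hlam : 0 < lam) (hρ : 0 < ρ) :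
    ¬ IsMarkovProcess P Z := by
  intro hM
  obtain ⟨φ, hφ⟩ := exists_inner_layerConst_d_d_ne_zero
  set L := lam ^ 2 * ⟪toL2 (layerConst φ.d.d), toL2 (layerConst φ)⟫ with hL
  obtain ⟨K, hK⟩ := exists_markovDefect_expansion hT φ
  obtain ⟨K', hK'⟩ := hZ.exists_markovDefect_le hT hM φ
  -- Both estimates of the defect are divided by `h ^ 2`; letting `h → 0` forces `ρ * L = 0`.
  have hle : ∀ h : ℝ, h ∈ Set.Ioc (0 : ℝ) 1 → |ρ * L| ≤ ρ * K * h + K' * √h := by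
    rintro h ⟨h0, h1⟩
    have hk : |markovDefect κ T φ ⟨h, h0.le⟩ - h ^ 2 * L| ≤ K * h ^ 3 := hK ⟨h, h0.le⟩ h1
    have hk' : |ρ * markovDefect κ T φ ⟨h, h0.le⟩| ≤ K' * (h ^ 2 * √h) := hK' ⟨h, h0.le⟩ h1
    have h2 : h ^ 2 * |ρ * L| ≤ h ^ 2 * (ρ * K * h + K' * √h) := by
      have h3 : h ^ 2 * |ρ * L| = |ρ * markovDefect κ T φ ⟨h, h0.le⟩ -
          ρ * (markovDefect κ T φ ⟨h, h0.le⟩ - h ^ 2 * L)| := by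
        rw [← abs_of_nonneg (sq_nonneg h), ← abs_mul, abs_of_nonneg (sq_nonneg h)]
        congr 1
        ring
      rw [h3]
      refine (abs_sub _ _).trans ((add_le_add hk' (b := _) (d := ρ * (K * h ^ 3)) ?_).trans
        (le_of_eq (by ring)))
      rw [abs_mul, NNReal.abs_eq]
      exact mul_le_mul_of_nonneg_left hk ρ.coe_nonneg
    exact le_of_mul_le_mul_left h2 (by positivity)
  have hlim : Tendsto (fun h : ℝ => ρ * K * h + K' * √h) (𝓝[>] 0) (𝓝 0) := by
    have h1 : Continuous fun h : ℝ => ρ * K * h + K' * √h := by fun_prop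
    simpa using (h1.tendsto 0).mono_left nhdsWithin_le_nhds
  have h0 : |ρ * L| ≤ 0 := ge_of_tendsto hlim (by
    filter_upwards [Ioc_mem_nhdsGT (zero_lt_one (α := ℝ))] with h hh using hle h hh)
  have h1 : ρ * L = 0 := abs_nonpos_iff.1 h0
  refine (mul_ne_zero (NNReal.coe_ne_zero.2 hρ.ne') (mul_ne_zero (pow_ne_zero 2 hlam.ne') hφ)) h1

end NonMarkov

end RunTumble

end

theorem mainTheorem5 (κ lam γ : ℝ) (ρ : ℝ≥0) (hκ : 0 ≤ κ) (hlam : 0 ≤ lam) (hγ : 0 < γ)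
    (Ω : ℕ+ → Type u) [∀ N, MeasurableSpace (Ω N)]
    (PN : ∀ N, Measure (Ω N)) [∀ N, IsProbabilityMeasure (PN N)]
    (η : ∀ N, ℝ≥0 → Ω N → RunTumble.Site → ℕ)
    (hη : ∀ N, RunTumble.IsRunAndTumble κ lam γ ρ N (PN N) (η N)) :
    (∃! T, RunTumble.IsSemigroupGeneratedBy κ lam γ T) ∧
    ∀ T, RunTumble.IsSemigroupGeneratedBy κ lam γ T →
      -- the finite-dimensional distributions of the fields converge
      (∀ (n : ℕ) (t : Fin n → ℝ≥0) (φ : Fin n → RunTumble.TestFn),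
        ∃ (μ : Measure (Fin n → ℝ)) (_ : IsProbabilityMeasure μ),
          TendstoInDistribution
            (fun N ω i => RunTumble.totalField ρ N (η N) (t i) (φ i) ω) atTop
            (fun x : Fin n → ℝ => x) PN μ ∧
          IsGaussian μ ∧
          (∀ i, ∫ x, x i ∂μ = 0) ∧
          ∀ i j, t j ≤ t i → ∫ x, x i * x j ∂μ =
            ρ * ⟪T (t i - t j) (RunTumble.toL2 (RunTumble.layerConst (φ i))),
              RunTumble.toL2 (RunTumble.layerConst (φ j))⟫) ∧
      -- every limiting field is a non-Markovian stationary Gaussian process with this covariance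
      ∀ (Ω' : Type v) [MeasurableSpace Ω'] (P : Measure Ω') [IsProbabilityMeasure P]
        (Z : ℝ≥0 → Ω' → RunTumble.Distr),
        RunTumble.IsFluctuationLimit PN (fun N => RunTumble.totalField ρ N (η N)) P Z →
          IsGaussianProcess (fun (q : ℝ≥0 × RunTumble.TestFn) ω => Z q.1 ω q.2) P ∧
          (∀ t φ, ∫ ω, Z t ω φ ∂P = 0) ∧
          RunTumble.IsStationaryProcess P Z ∧
          (0 < lam → 0 < ρ → ¬ RunTumble.IsMarkovProcess P Z) ∧
          ∀ (t : ℝ≥0) (φ ψ : RunTumble.TestFn),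
            Integrable (fun ω => Z t ω φ * Z 0 ω ψ) P ∧
            ∫ ω, Z t ω φ * Z 0 ω ψ ∂P =
              ρ * ⟪T t (RunTumble.toL2 (RunTumble.layerConst φ)),
                RunTumble.toL2 (RunTumble.layerConst ψ)⟫ := by
  refine ⟨RunTumble.existsUnique_isSemigroupGeneratedBy hκ hlam hγ.le, fun T hT => ⟨fun n t φ => ?_,
    fun Ω' _ P _ Z hZ => ?_⟩⟩
  · have hS := RunTumble.posSemidef_covMatrix hκ hlam hγ.le hη hT t φ
    refine ⟨RunTumble.gaussianPi (RunTumble.covMatrix ρ T t φ), inferInstance,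
      RunTumble.tendstoInDistribution_totalField hκ hlam hγ.le hη hT t φ,
      RunTumble.isGaussian_gaussianPi, RunTumble.integral_eval_gaussianPi, fun i j hij => ?_⟩
    rw [RunTumble.integral_mul_gaussianPi hS, RunTumble.covMatrix_of_le hij, RunTumble.limitCov]
  · have h := hZ.isGaussianField hκ hlam hγ.le hη hT
    refine ⟨h.isGaussian, h.integral_eq_zero, h.isStationary,
      fun hlam' hρ => h.not_isMarkov hT hlam' hρ,
      fun t φ ψ => ⟨h.integrable_mul t 0 φ ψ, ?_⟩⟩
    rw [h.integral_mul, RunTumble.timeCov, if_pos zero_le, tsub_zero, RunTumble.limitCov]
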